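/- Let $(\Sigma,\preceq)$ be a finite totally ordered alphabet. A Wheeler NFA $(\mathcal A,\le)$ consists of an NFA $\mathcal A=(Q,E,s,F)$ with $Q$ finite and $E\subseteq Q\times Q\times\Sigma$, all of whose states are reachable from $s$ and co-reachable (some final state can be reached from them), and a total order $\le$ on $Q$ such that (1) $s\le u$ for all $u\in Q$; (2) if $(u,v,a),(u',v',b)\in E$ and $v<v'$, then $a\preceq b$; (3) if $(u,v,a),(u',v',a)\in E$ and $v<v'$, then $u\le u'$. It is a Wheeler DFA if moreover for all $u\in Q$, $a\in\Sigma$ there is at most one $v$ with $(u,v,a)\in E$. A Wheeler autobisimulation on $(\mathcal A,\le)$ is a reflexive relation $R\subseteq Q\times Q$ that is a bisimulation from $\mathcal A$ to itself (if $u\,R\,u'$, then every edge $(u,v,a)\in E$ is matched by some $(u',v',a)\in E$ with $v\,R\,v'$ and vice versa, and $u\in F\iff u'\in F$) and for which the images $R(C)$ and preimages $R^{-1}(C)$ of $\le$-convex sets $C\subseteq Q$ are $\le$-convex. Let $\equiv$ be the maximum Wheeler autobisimulation on $(\mathcal A,\le)$, which is an equivalence relation. The quotient Wheeler NFA $(\mathcal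 A_*,\le_*)$ has as states the $\equiv$-classes, as edges all $([u],[v],a)$ with $(u,v,a)\in E$, initial state $[s]$, final states the classes that meet $F$, and $U\le_* V$ iff $u\le v$ for some $u\in U$, $v\in V$. Consider the comparison model: a program of a random access machine (unit-cost instructions on natural numbers) can copy characters, and the only query that it may make about characters is, for two characters $a_1,a_2$, whether $a_1\preceq a_2$, which takes one unit of time. The input is a Wheeler NFA, given by its states, numbered in the order $\le$, its initial state, its final states, and the list of its edges in an arbitrary order; the output is $(\mathcal A_*,\le_*)$ in the same format. The program does not depend on the alphabet and has to be correct for every finite totally ordered alphabet. Then the worst-case time complexity of building $(\mathcal A_*,\le_*)$ from $(\mathcal A,\le)$ is $\Theta(|E|\log|E|)$. That is, some program, using words of $O(\log |E|)$ bits only, builds $(\mathcal A_*,\le_*)$ for every Wheeler NFA $(\mathcal A,\le)$ in at most $f(|E|)$ time for a function $f$ with $f(m)=O(m\log m)$ as $m\to\infty$; and if a program builds $(\mathcal A_*,\le_*)$ for every Wheeler NFA $(\mathcal A,\le)$ in at most $f(|E|)$ time, then $f(m)=\Omega(m\log m)$ as $m\to\infty$. The same two statements hold if the inputs are restricted to Wheeler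 DFAs. -/

import Mathlib

open Filter Asymptotics

/-! ## Automata, Wheeler orders and Wheeler bisimulations -/

/-- A nondeterministic finite automaton `(Q, E, s, F)` over the alphabet `σ` (finiteness of `Q` and
trimness are part of `IsWheelerNFA`). -/
structure Automaton (σ Q : Type) where
  edges : Set (Q × Q × σ)
  start : Q
  final : Set Q

namespace Automaton

variable {σ Q Q' : Type}

/-- Some edge leads from `u` to `v`. -/
def Adj (A : Automaton σ Q) (u v : Q) : Prop := ∃ a, (u, v, a) ∈ A.edges

/-- There is a (possibly empty) walk from the initial state to `u`. -/
def Reachable (A : Automaton σ Q) (u : Q) : Prop := Relation.ReflTransGen A.Adj A.start u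

/-- There is a (possibly empty) walk from `u` to a final state. -/
def Coreachable (A : Automaton σ Q) (u : Q) : Prop :=
  ∃ v ∈ A.final, Relation.ReflTransGen A.Adj u v

def IsDFA (A : Automaton σ Q) : Prop :=
  ∀ u a v w, (u, v, a) ∈ A.edges → (u, w, a) ∈ A.edges → v = w

/-- `(A, le)` is a Wheeler NFA: the state set is finite, all states are reachable and co-reachable,
`le` is a total order on the states, and the three Wheeler axioms hold. -/
structure IsWheelerNFA [LE σ] (A : Automaton σ Q) (le : Q → Q → Prop) : Prop where
  finite : Finite Q
  reachable : ∀ u, A.Reachable u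
  coreachable : ∀ u, A.Coreachable u
  refl : ∀ u, le u u
  antisymm : ∀ u v, le u v → le v u → u = v
  trans : ∀ u v w, le u v → le v w → le u w
  total : ∀ u v, le u v ∨ le v u
  axiom_start : ∀ u, le A.start u
  axiom_labels : ∀ u v u' v' a b, (u, v, a) ∈ A.edges → (u', v', b) ∈ A.edges →
    le v v' → v ≠ v' → a ≤ b
  axiom_sources : ∀ u v u' v' a, (u, v, a) ∈ A.edges → (u', v', a) ∈ A.edges →
    le v v' → v ≠ v' → le u u'

end Automaton

/-- `C` is convex with respect to `le`. -/
def IsConvexFor {Q : Type} (le : Q → Q → Prop) (C : Set Q) : Prop :=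
  ∀ u v w, le u v → le v w → u ∈ C → w ∈ C → v ∈ C

namespace Automaton

variable {σ Q Q' : Type}

structure IsBisimulation (A : Automaton σ Q) (A' : Automaton σ Q') (R : Q → Q' → Prop) :
    Prop where
  forth : ∀ u v u' a, R u u' → (u, v, a) ∈ A.edges → ∃ v', R v v' ∧ (u', v', a) ∈ A'.edges
  back : ∀ u u' v' a, R u u' → (u', v', a) ∈ A'.edges → ∃ v, R v v' ∧ (u, v, a) ∈ A.edges
  start : R A.start A'.start
  final : ∀ u u', R u u' → (u ∈ A.final ↔ u' ∈ A'.final)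

/-- A bisimulation such that images and preimages of convex sets are convex. -/
structure IsWheelerBisimulation (A : Automaton σ Q) (le : Q → Q → Prop)
    (A' : Automaton σ Q') (le' : Q' → Q' → Prop) (R : Q → Q' → Prop) : Prop where
  bisim : IsBisimulation A A' R
  image_convex : ∀ C : Set Q, IsConvexFor le C → IsConvexFor le' {u' | ∃ u ∈ C, R u u'}
  preimage_convex : ∀ C' : Set Q', IsConvexFor le' C' → IsConvexFor le {u | ∃ u' ∈ C', R u u'}

/-- A reflexive Wheeler bisimulation from `(A, le)` to itself. -/
structure IsWheelerAutobisimulation (A : Automaton σ Q) (le : Q → Q → Prop)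
    (R : Q → Q → Prop) : Prop where
  wheeler : IsWheelerBisimulation A le A le R
  refl : ∀ u, R u u

/-- The maximum Wheeler autobisimulation, as the union of all of them
(see `wheelerEquiv_isMaximum`). -/
def wheelerEquiv (A : Automaton σ Q) (le : Q → Q → Prop) (u v : Q) : Prop :=
  ∃ R, IsWheelerAutobisimulation A le R ∧ R u v

/-- The union of two convex sets that share a point is convex. -/
theorem isConvexFor_iUnion {le : Q → Q → Prop} (ht : ∀ u v, le u v ∨ le v u)
    {ι : Type} (D : ι → Set Q) (hD : ∀ i, IsConvexFor le (D i)) (x : Q) (hx : ∀ i, x ∈ D i) :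
    IsConvexFor le {y | ∃ i, y ∈ D i} := by
  rintro u v w huv hvw ⟨i, hi⟩ ⟨j, hj⟩
  rcases ht v x with h | h
  · exact ⟨i, hD i u v x huv h hi (hx i)⟩
  · exact ⟨j, hD j x v w h hvw (hx j) hj⟩

theorem wheelerEquiv_isMaximum [LE σ] (A : Automaton σ Q) (le : Q → Q → Prop)
    (h : IsWheelerNFA A le) :
    IsWheelerAutobisimulation A le (wheelerEquiv A le) ∧
      ∀ R, IsWheelerAutobisimulation A le R → ∀ u v, R u v → wheelerEquiv A le u v := by
  have hid : IsWheelerAutobisimulation A le (fun u v => u = v) := by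
    refine ⟨⟨⟨?_, ?_, rfl, ?_⟩, ?_, ?_⟩, fun _ => rfl⟩
    · rintro u v _ a rfl huv
      exact ⟨v, rfl, huv⟩
    · rintro u _ v' a rfl huv
      exact ⟨v', rfl, huv⟩
    · rintro u _ rfl
      rfl
    · intro C hC
      simpa using hC
    · intro C hC
      simpa using hC
  have key : ∀ (C : Set Q) (T : (Q → Q → Prop) → Q → Q → Prop),
      (∀ R, IsWheelerAutobisimulation A le R →
        IsConvexFor le {v | ∃ u ∈ C, T R u v} ∧ ∀ u, T R u u) →
      IsConvexFor le {v | ∃ u ∈ C, ∃ R, IsWheelerAutobisimulation A le R ∧ T R u v} := by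
    intro C T hT
    rcases C.eq_empty_or_nonempty with rfl | ⟨x, hx⟩
    · rintro u v w _ _ ⟨y, hy, _⟩
      exact absurd hy (Set.notMem_empty y)
    · have := isConvexFor_iUnion h.total
        (fun R : {R // IsWheelerAutobisimulation A le R} => {v | ∃ u ∈ C, T R.1 u v})
        (fun R => (hT R.1 R.2).1) x (fun R => ⟨x, hx, (hT R.1 R.2).2 x⟩)
      convert this using 1
      ext v
      constructor
      · rintro ⟨u, hu, R, hR, huv⟩
        exact ⟨⟨R, hR⟩, u, hu, huv⟩
      · rintro ⟨⟨R, hR⟩, u, hu, huv⟩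
        exact ⟨u, hu, R, hR, huv⟩
  refine ⟨⟨⟨⟨?_, ?_, ⟨_, hid, rfl⟩, ?_⟩, ?_, ?_⟩, fun u => ⟨_, hid, rfl⟩⟩,
    fun R hR u v huv => ⟨R, hR, huv⟩⟩
  · rintro u v u' a ⟨R, hR, hu⟩ huv
    obtain ⟨v', h1, h2⟩ := hR.wheeler.bisim.forth u v u' a hu huv
    exact ⟨v', ⟨R, hR, h1⟩, h2⟩
  · rintro u u' v' a ⟨R, hR, hu⟩ huv
    obtain ⟨v, h1, h2⟩ := hR.wheeler.bisim.back u u' v' a hu huv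
    exact ⟨v, ⟨R, hR, h1⟩, h2⟩
  · rintro u u' ⟨R, hR, hu⟩
    exact hR.wheeler.bisim.final u u' hu
  · intro C hC
    exact key C (fun R => R) fun R hR => ⟨hR.wheeler.image_convex C hC, hR.refl⟩
  · intro C hC
    exact key C (fun R u v => R v u) fun R hR => ⟨hR.wheeler.preimage_convex C hC, hR.refl⟩

/-- The class `[u]` of a state. -/
def wheelerClass (A : Automaton σ Q) (le : Q → Q → Prop) (u : Q) : Set Q :=
  {v | wheelerEquiv A le u v}

/-- The set of all classes. -/
abbrev QuotientState (A : Automaton σ Q) (le : Q → Q → Prop) : Type :=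
  Set.range (wheelerClass A le)

/-- The quotient automaton `A_*`. -/
def quotient (A : Automaton σ Q) (le : Q → Q → Prop) : Automaton σ (QuotientState A le) where
  edges := {e | ∃ u ∈ e.1.1, ∃ v ∈ e.2.1.1, (u, v, e.2.2) ∈ A.edges}
  start := ⟨wheelerClass A le A.start, Set.mem_range_self _⟩
  final := {U | ∃ u ∈ U.1, u ∈ A.final}

/-- The order `≤_*` on the classes. -/
def quotientLE (A : Automaton σ Q) (le : Q → Q → Prop) (U V : QuotientState A le) : Prop :=
  ∃ u ∈ U.1, ∃ v ∈ V.1, le u v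

end Automaton

/-! ## Programs of the comparison model

A random access machine in the form of a small imperative language. Natural numbers live in
registers and in named arrays, characters live in separate named arrays. Characters can be copied
and two characters can be compared with `≤`; nothing else can be done with them. Every instruction
and every test costs one unit of time. -/

/-- An operand: a constant or the content of a register. -/
inductive Operand where
  | const (n : ℕ)
  | reg (x : ℕ)

inductive ArithOp where
  | add
  | sub
  | mul
  | div

inductive Test where
  /-- `o₁ ≤ o₂` for numbers -/
  | le (o₁ o₂ : Operand)
  /-- `o₁ < o₂` for numbers -/
  | lt (o₁ o₂ : Operand)
  /-- `o₁ = o₂` for numbers -/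
  | eq (o₁ o₂ : Operand)
  /-- `Λ_b₁[o₁] ≤ Λ_b₂[o₂]` for characters -/
  | charLE (b₁ : ℕ) (o₁ : Operand) (b₂ : ℕ) (o₂ : Operand)

inductive Program where
  | skip
  /-- `x := o` -/
  | set (x : ℕ) (o : Operand)
  /-- `x := o₁ op o₂` -/
  | arith (x : ℕ) (op : ArithOp) (o₁ o₂ : Operand)
  /-- `x := M_a[o]` -/
  | load (x a : ℕ) (o : Operand)
  /-- `M_a[o₁] := o₂` -/
  | store (a : ℕ) (o₁ o₂ : Operand)
  /-- `Λ_b₁[o₁] := Λ_b₂[o₂]` -/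
  | copyChar (b₁ : ℕ) (o₁ : Operand) (b₂ : ℕ) (o₂ : Operand)
  | seq (p q : Program)
  | ite (t : Test) (p q : Program)
  | while (t : Test) (p : Program)

/-- Memory contents: registers, arrays of numbers, arrays of characters (`none` is an empty cell). -/
@[ext]
structure Memory (σ : Type) where
  reg : ℕ → ℕ
  num : ℕ → ℕ → ℕ
  char : ℕ → ℕ → Option σ

def Operand.eval {σ : Type} (s : Memory σ) : Operand → ℕ
  | .const n => n
  | .reg x => s.reg x

/-- Subtraction is truncated, division is integer division. -/
def ArithOp.eval : ArithOp → ℕ → ℕ → ℕ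
  | .add, m, n => m + n
  | .sub, m, n => m - n
  | .mul, m, n => m * n
  | .div, m, n => m / n

/-- A test on an empty character cell fails. -/
def Test.Holds {σ : Type} [LE σ] (s : Memory σ) : Test → Prop
  | .le o₁ o₂ => o₁.eval s ≤ o₂.eval s
  | .lt o₁ o₂ => o₁.eval s < o₂.eval s
  | .eq o₁ o₂ => o₁.eval s = o₂.eval s
  | .charLE b₁ o₁ b₂ o₂ =>
      ∃ a ∈ s.char b₁ (o₁.eval s), ∃ a' ∈ s.char b₂ (o₂.eval s), a ≤ a'

namespace Memory

variable {σ : Type}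

def setReg (s : Memory σ) (x v : ℕ) : Memory σ :=
  { s with reg := Function.update s.reg x v }

def setNum (s : Memory σ) (a i v : ℕ) : Memory σ :=
  { s with num := Function.update s.num a (Function.update (s.num a) i v) }

def setChar (s : Memory σ) (b i : ℕ) (c : Option σ) : Memory σ :=
  { s with char := Function.update s.char b (Function.update (s.char b) i c) }

end Memory

/-- `Exec W p s t s'`: started in `s`, the program `p` halts in `s'` after exactly `t` units of time,
and no number written to a cell on the way exceeds the word bound `W` (a program that attempts to
write a larger number is stuck). -/
inductive Exec {σ : Type} [LE σ] (W : ℕ) : Program → Memory σ → ℕ → Memory σ → Prop where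
  | skip (s) : Exec W .skip s 1 s
  | set (s x o) (h : o.eval s ≤ W) : Exec W (.set x o) s 1 (s.setReg x (o.eval s))
  | arith (s x op o₁ o₂) (h : op.eval (o₁.eval s) (o₂.eval s) ≤ W) :
      Exec W (.arith x op o₁ o₂) s 1 (s.setReg x (op.eval (o₁.eval s) (o₂.eval s)))
  | load (s x a o) (h : s.num a (o.eval s) ≤ W) :
      Exec W (.load x a o) s 1 (s.setReg x (s.num a (o.eval s)))
  | store (s a o₁ o₂) (h : o₂.eval s ≤ W) :
      Exec W (.store a o₁ o₂) s 1 (s.setNum a (o₁.eval s) (o₂.eval s))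
  | copyChar (s b₁ o₁ b₂ o₂) :
      Exec W (.copyChar b₁ o₁ b₂ o₂) s 1 (s.setChar b₁ (o₁.eval s) (s.char b₂ (o₂.eval s)))
  | seq {p q s s' s'' t t'} (h : Exec W p s t s') (h' : Exec W q s' t' s'') :
      Exec W (.seq p q) s (t + t') s''
  | ite_true {c p q s s' t} (hc : c.Holds s) (h : Exec W p s t s') :
      Exec W (.ite c p q) s (t + 1) s'
  | ite_false {c p q s s' t} (hc : ¬ c.Holds s) (h : Exec W q s t s') :
      Exec W (.ite c p q) s (t + 1) s'
  | while_true {c p s s' s'' t t'} (hc : c.Holds s) (h : Exec W p s t s')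
      (h' : Exec W (.while c p) s' t' s'') : Exec W (.while c p) s (t + t' + 1) s''
  | while_false {c p s} (hc : ¬ c.Holds s) : Exec W (.while c p) s 1 s

/-! ## Inputs and outputs -/

/-- A concrete description of an automaton with ordered states: the states are numbered from `0`
and the edges are listed in some order. -/
structure Description (σ : Type) where
  numStates : ℕ
  edges : List (Fin numStates × Fin numStates × σ)
  start : Fin numStates
  final : Fin numStates → Bool

namespace Description

variable {σ Q : Type}

/-- `d` describes `(A, le)`: the states are numbered increasingly with respect to `le`, and every
edge is listed exactly once, in an arbitrary order. -/
def Describes (d : Description σ) (A : Automaton σ Q) (le : Q → Q → Prop) : Prop :=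
  ∃ e : Fin d.numStates ≃ Q,
    (∀ i j, i ≤ j ↔ le (e i) (e j)) ∧
    d.edges.Nodup ∧
    (∀ i j a, (i, j, a) ∈ d.edges ↔ (e i, e j, a) ∈ A.edges) ∧
    e d.start = A.start ∧
    ∀ i, d.final i = true ↔ e i ∈ A.final

/-- The initial memory for the input `d`. Registers 0, 1, 2 hold the number of states, the number of
edges and the initial state; the number arrays 0, 1 and the character array 0 hold the sources,
targets and labels of the edges; the number array 2 marks the final states. Everything else is
zero or empty. -/
def toMemory (d : Description σ) : Memory σ where
  reg x :=
    if x = 0 then d.numStates else if x = 1 then d.edges.length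
    else if x = 2 then (d.start : ℕ) else 0
  num a k :=
    if a = 0 then (d.edges[k]?.map fun e => (e.1 : ℕ)).getD 0
    else if a = 1 then (d.edges[k]?.map fun e => (e.2.1 : ℕ)).getD 0
    else if a = 2 then if h : k < d.numStates then (d.final ⟨k, h⟩).toNat else 0
    else 0
  char b k := if b = 0 then d.edges[k]?.map fun e => e.2.2 else none

/-- The memory `s` contains the description `d`, in the format of `toMemory`; the unused cells are
arbitrary. -/
def StoredIn (d : Description σ) (s : Memory σ) : Prop :=
  s.reg 0 = d.numStates ∧ s.reg 1 = d.edges.length ∧ s.reg 2 = d.start ∧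
    (∀ (k : ℕ) (h : k < d.edges.length),
      s.num 0 k = d.edges[k].1 ∧ s.num 1 k = d.edges[k].2.1 ∧ s.char 0 k = some d.edges[k].2.2) ∧
    ∀ i : Fin d.numStates, s.num 2 i = (d.final i).toNat

end Description

/-- On every Wheeler NFA `(A, le)` of the class `K`, over every finite totally ordered alphabet and
for every description of `(A, le)`, the program `p` halts after at most `f |E|` units of time, with a
description of `(A_*, ≤_*)` in memory, and writes no number larger than `W |E|`. -/
def BuildsQuotient (K : ∀ σ Q : Type, Automaton σ Q → Prop) (p : Program) (f W : ℕ → ℕ) : Prop :=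
  ∀ (σ : Type) [LinearOrder σ] [Finite σ] (Q : Type) (A : Automaton σ Q) (le : Q → Q → Prop),
    A.IsWheelerNFA le → K σ Q A →
    ∀ d : Description σ, d.Describes A le →
      ∃ t s', Exec (W A.edges.ncard) p d.toMemory t s' ∧ t ≤ f A.edges.ncard ∧
        ∃ d' : Description σ, d'.Describes (A.quotient le) (A.quotientLE le) ∧ d'.StoredIn s'

/-- The worst-case time needed to build the quotient of the Wheeler NFAs in the class `K` is
`Θ(g |E|)`. Upper bound: some program with words of `O(log |E|)` bits runs in time `O(g)`. Lower
bound: every time bound of every correct program is `Ω(g)`, whatever its word size. -/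
def QuotientTimeIsTheta (K : ∀ σ Q : Type, Automaton σ Q → Prop) (g : ℕ → ℝ) : Prop :=
  (∃ (p : Program) (f : ℕ → ℕ) (c : ℕ),
    BuildsQuotient K p f (fun m => (m + 2) ^ c) ∧ (fun m => (f m : ℝ)) =O[atTop] g) ∧
  ∀ (p : Program) (f W : ℕ → ℕ), BuildsQuotient K p f W → g =O[atTop] fun m => (f m : ℝ)

/-! Lower bound. The hard inputs are Wheeler DFAs on three states 0 < 1 < 2 with `k` edges from 1 to
2, `k` loops at 2, and one or two edges from 0 to 1 that fill the edge count up to `m`. States 1 and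
2 merge if their two label sets agree, and stay apart if some label of 1 is missing at 2. Label the
edges out of 1 by 4, 8, …, 4k and the loops by a permutation of these numbers. For every pair `x`,
`y` of equally labelled edges a correct program must have received the answers `x ≤ y` and `y ≤ x`:
otherwise the label of the loop can be moved by one unit without changing any recorded answer,
although the states no longer merge (`BuildsQuotient.query_mem`). So the trace determines the
permutation, and `k!` traces need different sequences of at most `f m` answers
(`BuildsQuotient.factorial_le`); Stirling's estimate with `k` about `m / 2` finishes. To compare
runs on different labellings, programs are run on symbolic characters, the positions of the edges,
so that all runs start in one memory. `Exec.exists_traced` and `Traced.exec` pass between concrete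
and symbolic runs, and `Traced.unique` says that the answers determine the trace.

Upper bound. Sort the edges by label, ties by source plus target. The third Wheeler axiom makes
sources and targets of equally labelled edges increase together, so the sum orders both
(`sortedEdges_of_sorted`). The classes of the maximum autobisimulation are intervals, so it suffices
to find their first states. Some of these boundaries are forced directly: by a change of finality,
or by the sources of neighbouring edges that differ in label or skip a state. Others propagate
backwards: where two linked neighbouring edges move on to a new target that is a boundary, their
sources have to be separated. `Boundary` is the closure under these rules. Bisimilar states are
never separated by it (`Boundary.not_rel`), and the intervals between boundaries do form a Wheeler
autobisimulation (`SortedEdges.sameClass_forth`, assembled in `classIndex_eq_iff_wheelerEquiv`).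

Each target carries at most one propagation arc (`SortedEdges.arc_unique`), so the closure is a
graph search in linear time. Equal edges of the quotient come from a contiguous piece of the sorted
list, so duplicates are removed by looking at the predecessor only (`runs_writeLoop`). Only the
merge sort costs more than linear time. One program serves NFAs and DFAs, and the lower bound for
DFAs implies the one for NFAs. -/

/-! ## Traces of programs on symbolic characters -/

/-- A comparison of two characters together with its outcome. -/
abbrev Query (ι : Type) : Type := (ι × ι) × Bool

/-- The outcomes of the queries of the list are those for the order `r`. -/
def ConsistentWith {ι : Type} (r : ι → ι → Prop) (L : List (Query ι)) : Prop :=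
  ∀ q ∈ L, q.2 = true ↔ r q.1.1 q.1.2

/-- The test evaluates to `b` while making the queries `l` (at most one). -/
def Test.Answers {ι : Type} (s : Memory ι) (l : List (Query ι)) (b : Bool) : Test → Prop
  | .le o₁ o₂ => l = [] ∧ (b = true ↔ o₁.eval s ≤ o₂.eval s)
  | .lt o₁ o₂ => l = [] ∧ (b = true ↔ o₁.eval s < o₂.eval s)
  | .eq o₁ o₂ => l = [] ∧ (b = true ↔ o₁.eval s = o₂.eval s)
  | .charLE b₁ o₁ b₂ o₂ =>
      (∃ x ∈ s.char b₁ (o₁.eval s), ∃ y ∈ s.char b₂ (o₂.eval s), l = [((x, y), b)]) ∨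
      ((s.char b₁ (o₁.eval s) = none ∨ s.char b₂ (o₂.eval s) = none) ∧ l = [] ∧ b = false)

/-- Apply a function to all characters in the memory. -/
def Memory.map {ι σ : Type} (f : ι → σ) (s : Memory ι) : Memory σ where
  reg := s.reg
  num := s.num
  char b i := (s.char b i).map f

/-- `Traced W p s t L s'`: if the character queries are answered as recorded in `L`, then `p` started
in `s` halts in `s'` after `t` units of time. -/
inductive Traced {ι : Type} (W : ℕ) :
    Program → Memory ι → ℕ → List (Query ι) → Memory ι → Prop where
  | skip (s) : Traced W .skip s 1 [] s
  | set (s x o) (h : o.eval s ≤ W) : Traced W (.set x o) s 1 [] (s.setReg x (o.eval s))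
  | arith (s x op o₁ o₂) (h : op.eval (o₁.eval s) (o₂.eval s) ≤ W) :
      Traced W (.arith x op o₁ o₂) s 1 [] (s.setReg x (op.eval (o₁.eval s) (o₂.eval s)))
  | load (s x a o) (h : s.num a (o.eval s) ≤ W) :
      Traced W (.load x a o) s 1 [] (s.setReg x (s.num a (o.eval s)))
  | store (s a o₁ o₂) (h : o₂.eval s ≤ W) :
      Traced W (.store a o₁ o₂) s 1 [] (s.setNum a (o₁.eval s) (o₂.eval s))
  | copyChar (s b₁ o₁ b₂ o₂) :
      Traced W (.copyChar b₁ o₁ b₂ o₂) s 1 []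
        (s.setChar b₁ (o₁.eval s) (s.char b₂ (o₂.eval s)))
  | seq {p q s s' s'' t t' L L'} (h : Traced W p s t L s') (h' : Traced W q s' t' L' s'') :
      Traced W (.seq p q) s (t + t') (L ++ L') s''
  | ite_true {c p q s s' t l L} (hc : c.Answers s l true) (h : Traced W p s t L s') :
      Traced W (.ite c p q) s (t + 1) (l ++ L) s'
  | ite_false {c p q s s' t l L} (hc : c.Answers s l false) (h : Traced W q s t L s') :
      Traced W (.ite c p q) s (t + 1) (l ++ L) s'
  | while_true {c p s s' s'' t t' l L L'} (hc : c.Answers s l true) (h : Traced W p s t L s')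
      (h' : Traced W (.while c p) s' t' L' s'') :
      Traced W (.while c p) s (t + t' + 1) (l ++ (L ++ L')) s''
  | while_false {c p s l} (hc : c.Answers s l false) : Traced W (.while c p) s 1 l s

section Traces

variable {ι σ : Type}

@[simp] theorem Operand.eval_map (f : ι → σ) (s : Memory ι) (o : Operand) :
    o.eval (s.map f) = o.eval s := by
  cases o <;> rfl

@[simp] theorem Memory.map_num (f : ι → σ) (s : Memory ι) : (s.map f).num = s.num := rfl

@[simp] theorem Memory.map_char (f : ι → σ) (s : Memory ι) (b i : ℕ) :
    (s.map f).char b i = (s.char b i).map f := rfl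

theorem Memory.map_setReg (f : ι → σ) (s : Memory ι) (x v : ℕ) :
    (s.setReg x v).map f = (s.map f).setReg x v := rfl

theorem Memory.map_setNum (f : ι → σ) (s : Memory ι) (a i v : ℕ) :
    (s.setNum a i v).map f = (s.map f).setNum a i v := rfl

theorem Memory.map_setChar (f : ι → σ) (s : Memory ι) (b i : ℕ) (c : Option ι) :
    (s.setChar b i c).map f = (s.map f).setChar b i (c.map f) := by
  ext1
  · rfl
  · rfl
  · funext b' i'
    simp only [Memory.map, Memory.setChar, Function.update_apply]
    by_cases hb : b' = b
    · by_cases hi : i' = i <;> simp [hb, hi]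
    · simp [hb]

theorem ConsistentWith.append {r : ι → ι → Prop} {L L' : List (Query ι)}
    (h : ConsistentWith r L) (h' : ConsistentWith r L') : ConsistentWith r (L ++ L') := by
  intro q hq
  rcases List.mem_append.1 hq with hq | hq
  · exact h q hq
  · exact h' q hq

theorem ConsistentWith.left {r : ι → ι → Prop} {L L' : List (Query ι)}
    (h : ConsistentWith r (L ++ L')) : ConsistentWith r L :=
  fun q hq => h q (List.mem_append_left _ hq)

theorem ConsistentWith.right {r : ι → ι → Prop} {L L' : List (Query ι)}
    (h : ConsistentWith r (L ++ L')) : ConsistentWith r L' :=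
  fun q hq => h q (List.mem_append_right _ hq)

theorem ConsistentWith.nil {r : ι → ι → Prop} : ConsistentWith r [] := by
  intro q hq
  simp at hq

/-- Every test can be answered consistently with the order of the characters. -/
theorem Test.exists_answers [LE σ] (f : ι → σ) (s : Memory ι) (c : Test) (b : Bool)
    (hb : b = true ↔ c.Holds (s.map f)) :
    ∃ l, l.length ≤ 1 ∧ c.Answers s l b ∧ ConsistentWith (fun i j => f i ≤ f j) l := by
  cases c with
  | le o₁ o₂ => exact ⟨[], by simp, ⟨rfl, by simpa [Test.Holds] using hb⟩, .nil⟩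
  | lt o₁ o₂ => exact ⟨[], by simp, ⟨rfl, by simpa [Test.Holds] using hb⟩, .nil⟩
  | eq o₁ o₂ => exact ⟨[], by simp, ⟨rfl, by simpa [Test.Holds] using hb⟩, .nil⟩
  | charLE b₁ o₁ b₂ o₂ =>
    simp only [Test.Holds, Memory.map_char, Operand.eval_map] at hb
    rcases h1 : s.char b₁ (o₁.eval s) with _ | x
    · exact ⟨[], by simp, .inr ⟨.inl h1, rfl, by simpa [h1] using hb⟩, .nil⟩
    rcases h2 : s.char b₂ (o₂.eval s) with _ | y
    · exact ⟨[], by simp, .inr ⟨.inr h2, rfl, by simpa [h2] using hb⟩, .nil⟩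
    refine ⟨[((x, y), b)], by simp, .inl ⟨x, h1, y, h2, rfl⟩, ?_⟩
    intro q hq
    simp only [List.mem_singleton] at hq
    subst hq
    simpa [h1, h2] using hb

theorem Test.Answers.holds_iff [LE σ] {f : ι → σ} {s : Memory ι} {c : Test} {b : Bool}
    {l : List (Query ι)} (h : c.Answers s l b) (hl : ConsistentWith (fun i j => f i ≤ f j) l) :
    c.Holds (s.map f) ↔ b = true := by
  cases c with
  | le o₁ o₂ => simpa [Test.Holds] using h.2.symm
  | lt o₁ o₂ => simpa [Test.Holds] using h.2.symm
  | eq o₁ o₂ => simpa [Test.Holds] using h.2.symm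
  | charLE b₁ o₁ b₂ o₂ =>
    simp only [Test.Holds, Memory.map_char, Operand.eval_map]
    rcases h with ⟨x, hx, y, hy, rfl⟩ | ⟨h1, rfl, rfl⟩
    · rw [Option.mem_def] at hx hy
      have := hl _ (List.mem_singleton_self _)
      simpa [hx, hy] using this.symm
    · rcases h1 with h1 | h1 <;> simp [h1]

/-- Characters are only moved and compared, so a concrete run lifts step by step along any naming
`f` of the characters. Each unit of time makes at most one query, which bounds the length of the
trace by the running time. -/
theorem Exec.exists_traced [LE σ] {W : ℕ} {p : Program} {S S' : Memory σ} {t : ℕ}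
    (h : Exec W p S t S') (f : ι → σ) (s : Memory ι) (hs : s.map f = S) :
    ∃ L s', L.length ≤ t ∧ Traced W p s t L s' ∧ s'.map f = S' ∧
      ConsistentWith (fun i j => f i ≤ f j) L := by
  induction h generalizing s with
  | skip S => exact ⟨[], s, by simp, .skip s, hs, .nil⟩
  | set S x o h =>
    subst hs
    rw [Operand.eval_map] at h ⊢
    exact ⟨[], _, by simp, .set s x o h, rfl, .nil⟩
  | arith S x op o₁ o₂ h =>
    subst hs
    rw [Operand.eval_map, Operand.eval_map] at h ⊢
    exact ⟨[], _, by simp, .arith s x op o₁ o₂ h, rfl, .nil⟩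
  | load S x a o h =>
    subst hs
    rw [Operand.eval_map] at h ⊢
    exact ⟨[], _, by simp, .load s x a o h, rfl, .nil⟩
  | store S a o₁ o₂ h =>
    subst hs
    rw [Operand.eval_map] at h
    rw [Operand.eval_map, Operand.eval_map]
    exact ⟨[], _, by simp, .store s a o₁ o₂ h, rfl, .nil⟩
  | copyChar S b₁ o₁ b₂ o₂ =>
    subst hs
    rw [Operand.eval_map, Operand.eval_map]
    exact ⟨[], _, by simp, .copyChar s b₁ o₁ b₂ o₂, Memory.map_setChar _ _ _ _ _, .nil⟩
  | seq h h' ih ih' =>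
    obtain ⟨L, s', h1, h2, h3, h4⟩ := ih s hs
    obtain ⟨L', s'', h1', h2', h3', h4'⟩ := ih' s' h3
    exact ⟨L ++ L', s'', by rw [List.length_append]; omega, .seq h2 h2', h3', h4.append h4'⟩
  | ite_true hc h ih =>
    subst hs
    obtain ⟨l, k1, k2, k3⟩ := Test.exists_answers f s _ true (by simpa using hc)
    obtain ⟨L, s', h1, h2, h3, h4⟩ := ih s rfl
    exact ⟨l ++ L, s', by rw [List.length_append]; omega, .ite_true k2 h2, h3, k3.append h4⟩
  | ite_false hc h ih =>
    subst hs
    obtain ⟨l, k1, k2, k3⟩ := Test.exists_answers f s _ false (by simpa using hc)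
    obtain ⟨L, s', h1, h2, h3, h4⟩ := ih s rfl
    exact ⟨l ++ L, s', by rw [List.length_append]; omega, .ite_false k2 h2, h3, k3.append h4⟩
  | while_true hc h h' ih ih' =>
    subst hs
    obtain ⟨l, k1, k2, k3⟩ := Test.exists_answers f s _ true (by simpa using hc)
    obtain ⟨L, s', h1, h2, h3, h4⟩ := ih s rfl
    obtain ⟨L', s'', h1', h2', h3', h4'⟩ := ih' s' h3
    exact ⟨l ++ (L ++ L'), s'', by rw [List.length_append, List.length_append]; omega,
      .while_true k2 h2 h2', h3', k3.append (h4.append h4')⟩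
  | while_false hc =>
    subst hs
    obtain ⟨l, k1, k2, k3⟩ := Test.exists_answers f s _ false (by simpa using hc)
    exact ⟨l, s, k1, .while_false k2, rfl, k3⟩

/-- A run feels the alphabet only through the recorded answers, so the same trace is a run for every
labelling that would give these answers. This is what lets the adversary change a label. -/
theorem Traced.exec [LE σ] {W : ℕ} {p : Program} {s s' : Memory ι} {t : ℕ} {L : List (Query ι)}
    (h : Traced W p s t L s') (f : ι → σ) (hL : ConsistentWith (fun i j => f i ≤ f j) L) :
    Exec W p (s.map f) t (s'.map f) := by
  induction h with
  | skip s => exact .skip _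
  | set s x o h => simpa [Memory.map_setReg] using Exec.set (s.map f) x o (by simpa using h)
  | arith s x op o₁ o₂ h =>
    simpa [Memory.map_setReg] using Exec.arith (s.map f) x op o₁ o₂ (by simpa using h)
  | load s x a o h =>
    simpa [Memory.map_setReg] using Exec.load (s.map f) x a o (by simpa using h)
  | store s a o₁ o₂ h =>
    simpa [Memory.map_setNum] using Exec.store (s.map f) a o₁ o₂ (by simpa using h)
  | copyChar s b₁ o₁ b₂ o₂ =>
    rw [Memory.map_setChar]
    simpa using Exec.copyChar (W := W) (s.map f) b₁ o₁ b₂ o₂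
  | seq h h' ih ih' => exact .seq (ih hL.left) (ih' hL.right)
  | ite_true hc h ih => exact .ite_true (by simp [hc.holds_iff hL.left]) (ih hL.right)
  | ite_false hc h ih => exact .ite_false (by simp [hc.holds_iff hL.left]) (ih hL.right)
  | while_true hc h h' ih ih' =>
    exact .while_true (by simp [hc.holds_iff hL.left]) (ih hL.right.left) (ih' hL.right.right)
  | while_false hc => exact .while_false (by simp [hc.holds_iff hL])

/-- The outcomes of the queries of a trace. -/
abbrev answers (L : List (Query ι)) : List Bool := L.map Prod.snd

theorem Test.Answers.unique {s : Memory ι} {c : Test} {b b' : Bool} {l l' : List (Query ι)}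
    (h : c.Answers s l b) (h' : c.Answers s l' b') (X X' : List Bool)
    (hX : answers l ++ X = answers l' ++ X') : b = b' ∧ l = l' ∧ X = X' := by
  cases c with
  | le o₁ o₂ =>
    obtain ⟨rfl, h⟩ := h
    obtain ⟨rfl, h'⟩ := h'
    exact ⟨by rw [Bool.eq_iff_iff, h, h'], rfl, by simpa using hX⟩
  | lt o₁ o₂ =>
    obtain ⟨rfl, h⟩ := h
    obtain ⟨rfl, h'⟩ := h'
    exact ⟨by rw [Bool.eq_iff_iff, h, h'], rfl, by simpa using hX⟩
  | eq o₁ o₂ =>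
    obtain ⟨rfl, h⟩ := h
    obtain ⟨rfl, h'⟩ := h'
    exact ⟨by rw [Bool.eq_iff_iff, h, h'], rfl, by simpa using hX⟩
  | charLE b₁ o₁ b₂ o₂ =>
    rcases h with ⟨x, hx, y, hy, rfl⟩ | ⟨h1, rfl, rfl⟩ <;>
    rcases h' with ⟨x', hx', y', hy', rfl⟩ | ⟨h1', rfl, rfl⟩
    · rw [Option.mem_def] at hx hy hx' hy'
      have hxx : x = x' := Option.some_injective _ (hx.symm.trans hx')
      have hyy : y = y' := Option.some_injective _ (hy.symm.trans hy')
      subst hxx hyy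
      simp only [answers, List.map_cons, List.map_nil, List.cons_append, List.nil_append,
        List.cons.injEq] at hX
      obtain ⟨rfl, rfl⟩ := hX
      exact ⟨rfl, rfl, rfl⟩
    · rw [Option.mem_def] at hx hy
      rw [hx, hy] at h1'
      simp at h1'
    · rw [Option.mem_def] at hx' hy'
      rw [hx', hy'] at h1
      simp at h1
    · exact ⟨rfl, rfl, by simpa using hX⟩

/-- Determinism, in a prefix-free form: two runs from the same memory cannot diverge while the
answers agree. The tails `X₁`, `X₂` carry the answers of the rest of the program through the
induction, and later absorb the padding of answer words to a common length. -/
theorem Traced.unique {W : ℕ} {p : Program} {s s₁ s₂ : Memory ι} {t₁ t₂ : ℕ}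
    {L₁ L₂ : List (Query ι)} (h₁ : Traced W p s t₁ L₁ s₁) (h₂ : Traced W p s t₂ L₂ s₂)
    (X₁ X₂ : List Bool) (hX : answers L₁ ++ X₁ = answers L₂ ++ X₂) :
    L₁ = L₂ ∧ s₁ = s₂ ∧ X₁ = X₂ := by
  induction h₁ generalizing s₂ t₂ L₂ X₁ X₂ with
  | skip s | set s x o h | arith s x op o₁ o₂ h | load s x a o h | store s a o₁ o₂ h
  | copyChar s b₁ o₁ b₂ o₂ =>
    cases h₂
    exact ⟨rfl, rfl, by simpa using hX⟩
  | seq h h' ih ih' =>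
    cases h₂ with
    | seq k k' =>
      simp only [answers, List.map_append, List.append_assoc] at hX
      obtain ⟨rfl, rfl, e⟩ := ih k _ _ hX
      obtain ⟨rfl, rfl, e'⟩ := ih' k' _ _ e
      exact ⟨rfl, rfl, e'⟩
  | ite_true hc h ih =>
    cases h₂ with
    | ite_true kc k =>
      simp only [answers, List.map_append, List.append_assoc] at hX
      obtain ⟨_, rfl, e⟩ := hc.unique kc _ _ hX
      obtain ⟨rfl, rfl, e'⟩ := ih k _ _ e
      exact ⟨rfl, rfl, e'⟩
    | ite_false kc k =>
      simp only [answers, List.map_append, List.append_assoc] at hX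
      exact absurd (hc.unique kc _ _ hX).1 (by simp)
  | ite_false hc h ih =>
    cases h₂ with
    | ite_false kc k =>
      simp only [answers, List.map_append, List.append_assoc] at hX
      obtain ⟨_, rfl, e⟩ := hc.unique kc _ _ hX
      obtain ⟨rfl, rfl, e'⟩ := ih k _ _ e
      exact ⟨rfl, rfl, e'⟩
    | ite_true kc k =>
      simp only [answers, List.map_append, List.append_assoc] at hX
      exact absurd (hc.unique kc _ _ hX).1 (by simp)
  | while_true hc h h' ih ih' =>
    cases h₂ with
    | while_true kc k k' =>
      simp only [answers, List.map_append, List.append_assoc] at hX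
      obtain ⟨_, rfl, e⟩ := hc.unique kc _ _ hX
      obtain ⟨rfl, rfl, e'⟩ := ih k _ _ e
      obtain ⟨rfl, rfl, e''⟩ := ih' k' _ _ e'
      exact ⟨rfl, rfl, e''⟩
    | while_false kc =>
      simp only [answers, List.map_append, List.append_assoc] at hX
      exact absurd (hc.unique kc _ _ hX).1 (by simp)
  | while_false hc =>
    cases h₂ with
    | while_true kc k k' =>
      simp only [answers, List.map_append, List.append_assoc] at hX
      exact absurd (hc.unique kc _ _ hX).1 (by simp)
    | while_false kc =>
      obtain ⟨_, rfl, e⟩ := hc.unique kc _ _ hX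
      exact ⟨rfl, rfl, e⟩

/-- Finitely many runs of a program that start with the same symbolic memory, take at most `T` units
of time and have pairwise different traces: there are at most `2 ^ T` of them. -/
theorem card_le_two_pow_of_traced {W T : ℕ} {p : Program} {s : Memory ι} {α : Type} [Fintype α]
    (L : α → List (Query ι)) (hlen : ∀ x, (L x).length ≤ T)
    (hL : ∀ x, ∃ t s', Traced W p s t (L x) s') (hinj : Function.Injective L) :
    Fintype.card α ≤ 2 ^ T := by
  -- The code of a run is its answer word, padded by `false` to length `T`. The padding causes no
  -- collisions, since `Traced.unique` allows arbitrary tails.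
  have key : Function.Injective fun x : α =>
      (⟨answers (L x) ++ List.replicate (T - (L x).length) false, by
        simp [answers, hlen x]⟩ : List.Vector Bool T) := by
    intro x y hxy
    obtain ⟨t, s', h⟩ := hL x
    obtain ⟨t', s'', h'⟩ := hL y
    exact hinj (h.unique h' _ _ (congrArg Subtype.val hxy)).1
  simpa using Fintype.card_le_of_injective (β := List.Vector Bool T) _ key

end Traces

theorem Exec.unique {σ : Type} [LE σ] {W : ℕ} {p : Program} {s s₁ s₂ : Memory σ} {t₁ t₂ : ℕ}
    (h₁ : Exec W p s t₁ s₁) (h₂ : Exec W p s t₂ s₂) : s₁ = s₂ := by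
  induction h₁ generalizing s₂ t₂ with
  | skip s | set s x o h | arith s x op o₁ o₂ h | load s x a o h | store s a o₁ o₂ h
  | copyChar s b₁ o₁ b₂ o₂ =>
    cases h₂
    rfl
  | seq h h' ih ih' =>
    cases h₂ with
    | seq k k' =>
      obtain rfl := ih k
      exact ih' k'
  | ite_true hc h ih =>
    cases h₂ with
    | ite_true kc k => exact ih k
    | ite_false kc k => exact absurd hc kc
  | ite_false hc h ih =>
    cases h₂ with
    | ite_true kc k => exact absurd kc hc
    | ite_false kc k => exact ih k
  | while_true hc h h' ih ih' =>
    cases h₂ with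
    | while_true kc k k' =>
      obtain rfl := ih k
      exact ih' k'
    | while_false kc => exact absurd hc kc
  | while_false hc =>
    cases h₂ with
    | while_true kc k k' => exact absurd kc hc
    | while_false kc => rfl

/-- This identifies the size `|E|` in which resources are measured with the length of the listed
input. -/
theorem Description.Describes.ncard_edges {σ Q : Type} {d : Description σ} {A : Automaton σ Q}
    {le : Q → Q → Prop} (h : d.Describes A le) : A.edges.ncard = d.edges.length := by
  classical
  obtain ⟨e, -, hnd, hE, -, -⟩ := h
  have h1 : A.edges = (fun x : Fin d.numStates × Fin d.numStates × σ =>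
      (e x.1, e x.2.1, x.2.2)) '' (d.edges.toFinset : Set _) := by
    ext ⟨u, v, a⟩
    simp only [Set.mem_image, List.coe_toFinset, Set.mem_ofPred_eq, Prod.mk.injEq]
    constructor
    · intro h
      refine ⟨(e.symm u, e.symm v, a), ?_, by simp, by simp, rfl⟩
      rw [hE]
      simpa using h
    · rintro ⟨⟨i, j, b⟩, hi, rfl, rfl, rfl⟩
      exact (hE i j _).1 hi
  rw [h1, Set.ncard_image_of_injective, Set.ncard_coe_finset, List.toFinset_card_of_nodup hnd]
  rintro ⟨i, j, a⟩ ⟨i', j', a'⟩ h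
  simpa using h

/-! ## A family of hard inputs -/

section HardInputs

variable {σ : Type} {m : ℕ}

/-- The end points of the `i`-th edge: `k` edges `1 → 2`, then `k` loops at `2`, then edges `0 → 1`. -/
def hardEnds (k i : ℕ) : Fin 3 × Fin 3 :=
  if i < k then (1, 2) else if i < 2 * k then (2, 2) else (0, 1)

/-- All states but 0 are final, so finality separates 0 from the rest, and the only open question is
whether 1 and 2 merge. Both send all their edges to 2, so this is a question about their label sets.
-/
def hardDescription (k : ℕ) (lab : Fin m → σ) : Description σ where
  numStates := 3
  edges := List.ofFn fun i : Fin m => ((hardEnds k i).1, (hardEnds k i).2, lab i)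
  start := (0 : Fin 3)
  final := fun x : Fin 3 => decide (x ≠ 0)

def hardAutomaton (k : ℕ) (lab : Fin m → σ) : Automaton σ (Fin 3) where
  edges := {e | ∃ i : Fin m, ((hardEnds k i).1, (hardEnds k i).2, lab i) = e}
  start := 0
  final := {x | x ≠ 0}

/-- Labels for which `hardAutomaton k lab` is a Wheeler DFA. -/
structure IsHardLabelling [LE σ] (k : ℕ) (lab : Fin m → σ) : Prop where
  pos : 0 < k
  lt : 2 * k < m
  le : ∀ i j : Fin m, 2 * k ≤ i → (j : ℕ) < 2 * k → lab i ≤ lab j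
  inj : ∀ i j : Fin m, hardEnds k i = hardEnds k j → lab i = lab j → i = j

theorem hardEnds_cases (k i : ℕ) :
    (i < k ∧ hardEnds k i = (1, 2)) ∨ (k ≤ i ∧ i < 2 * k ∧ hardEnds k i = (2, 2)) ∨
      (2 * k ≤ i ∧ hardEnds k i = (0, 1)) := by
  unfold hardEnds
  split_ifs with h1 h2
  · exact .inl ⟨h1, rfl⟩
  · exact .inr (.inl ⟨by omega, h2, rfl⟩)
  · exact .inr (.inr ⟨by omega, rfl⟩)

theorem hardDescription_describes [LE σ] {k : ℕ} {lab : Fin m → σ} (h : IsHardLabelling k lab) :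
    (hardDescription k lab).Describes (hardAutomaton k lab) (· ≤ ·) := by
  refine ⟨Equiv.refl _, fun i j => Iff.rfl, ?_, ?_, rfl, ?_⟩
  · refine List.nodup_ofFn.2 fun i j hij => ?_
    have h1 := congrArg Prod.fst hij
    have h2 := congrArg (fun e => e.2.1) hij
    exact h.inj i j (Prod.ext h1 h2) (congrArg (fun e => e.2.2) hij)
  · intro i j a
    exact List.mem_ofFn
  · intro i
    exact decide_eq_true_iff (p := (show Fin 3 from i) ≠ 0)

theorem hardAutomaton_isDFA (k : ℕ) (lab : Fin m → σ) : (hardAutomaton k lab).IsDFA := by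
  rintro u a v w ⟨i, hi⟩ ⟨j, hj⟩
  simp only [Prod.mk.injEq] at hi hj
  obtain ⟨rfl, rfl, -⟩ := hi
  obtain ⟨hj, rfl, -⟩ := hj
  rcases hardEnds_cases k i with ⟨-, h1⟩ | ⟨-, -, h1⟩ | ⟨-, h1⟩ <;>
  rcases hardEnds_cases k j with ⟨-, h2⟩ | ⟨-, -, h2⟩ | ⟨-, h2⟩ <;>
  simp_all

/-- Only 1 and 2 are targets, so the axioms compare an edge `0 → 1` with an edge into 2. The labels
are in order by `IsHardLabelling.le`, and the source 0 is the least state. -/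
theorem hardAutomaton_isWheelerNFA [LE σ] {k : ℕ} {lab : Fin m → σ} (h : IsHardLabelling k lab) :
    (hardAutomaton k lab).IsWheelerNFA (· ≤ ·) := by
  have e01 : (hardAutomaton k lab).Adj 0 1 := by
    refine ⟨lab ⟨2 * k, h.lt⟩, ⟨2 * k, h.lt⟩, ?_⟩
    have : ¬ 2 * k < k := by omega
    simp [hardEnds, this]
  have e12 : (hardAutomaton k lab).Adj 1 2 := by
    have hm : 0 < m := by have := h.lt; omega
    refine ⟨lab ⟨0, hm⟩, ⟨0, hm⟩, ?_⟩
    simp [hardEnds, h.pos]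
  refine ⟨inferInstance, ?_, ?_, le_refl, fun _ _ => le_antisymm, fun _ _ _ => le_trans,
    le_total, ?_, ?_, ?_⟩
  · intro u
    have h0 : (hardAutomaton k lab).Reachable 0 := Relation.ReflTransGen.refl
    have h1 : (hardAutomaton k lab).Reachable 1 := Relation.ReflTransGen.tail h0 e01
    have h2 : (hardAutomaton k lab).Reachable 2 := Relation.ReflTransGen.tail h1 e12
    fin_cases u <;> assumption
  · intro u
    by_cases hu : u = 0
    · subst hu
      exact ⟨1, by simp [hardAutomaton], .single e01⟩
    · exact ⟨u, hu, .refl⟩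
  · exact Fin.zero_le
  · rintro u v u' v' a b ⟨i, hi⟩ ⟨j, hj⟩ hle hne
    simp only [Prod.mk.injEq] at hi hj
    obtain ⟨rfl, rfl, rfl⟩ := hi
    obtain ⟨rfl, rfl, rfl⟩ := hj
    rcases hardEnds_cases k i with ⟨-, h1⟩ | ⟨-, -, h1⟩ | ⟨hi, h1⟩ <;>
    rcases hardEnds_cases k j with ⟨hj, h2⟩ | ⟨-, hj, h2⟩ | ⟨-, h2⟩ <;>
    rw [h1, h2] at hle hne <;>
    first
    | exact absurd rfl hne
    | exact absurd hle (by decide)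
    | exact h.le i j hi (by omega)
  · rintro u v u' v' a ⟨i, hi⟩ ⟨j, hj⟩ hle hne
    simp only [Prod.mk.injEq] at hi hj
    obtain ⟨rfl, rfl, -⟩ := hi
    obtain ⟨rfl, rfl, -⟩ := hj
    rcases hardEnds_cases k i with ⟨-, h1⟩ | ⟨-, -, h1⟩ | ⟨hi, h1⟩ <;>
    rcases hardEnds_cases k j with ⟨hj, h2⟩ | ⟨-, hj, h2⟩ | ⟨-, h2⟩ <;>
    rw [h1, h2] at hle hne ⊢ <;>
    first
    | exact absurd rfl hne
    | exact absurd hle (by decide)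
    | exact Fin.zero_le _

theorem Description.Describes.numStates_eq {Q : Type} {d : Description σ} {A : Automaton σ Q}
    {le : Q → Q → Prop} (h : d.Describes A le) : d.numStates = Nat.card Q := by
  obtain ⟨e, -⟩ := h
  simpa using Nat.card_congr e

/-- The states 1 and 2 are merged if the labels of their edges agree. -/
theorem card_quotient_of_labels_eq [LE σ] {k : ℕ} {lab : Fin m → σ}
    (h12 : ∀ i : Fin m, (i : ℕ) < k → ∃ j : Fin m, k ≤ j ∧ (j : ℕ) < 2 * k ∧ lab j = lab i)
    (h21 : ∀ j : Fin m, k ≤ j → (j : ℕ) < 2 * k → ∃ i : Fin m, (i : ℕ) < k ∧ lab i = lab j) :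
    Nat.card ((hardAutomaton k lab).QuotientState (· ≤ ·)) ≠ 3 := by
  set A := hardAutomaton k lab with hA
  have edge : ∀ u v a, (u, v, a) ∈ A.edges → u ≠ 0 → v = 2 ∧ ∀ u' ≠ 0, (u', 2, a) ∈ A.edges := by
    rintro u v a ⟨i, hi⟩ hu
    simp only [Prod.mk.injEq] at hi
    obtain ⟨rfl, rfl, rfl⟩ := hi
    have hu' : ∀ u' : Fin 3, u' ≠ 0 → u' = 1 ∨ u' = 2 := by decide
    rcases hardEnds_cases k i with ⟨hi, h1⟩ | ⟨hi, hi', h1⟩ | ⟨hi, h1⟩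
    · refine ⟨by simp [h1], fun u' hu'' => ?_⟩
      rcases hu' u' hu'' with rfl | rfl
      · exact ⟨i, by simp [h1]⟩
      · obtain ⟨j, hj, hj', hl⟩ := h12 i hi
        refine ⟨j, ?_⟩
        simp [hardEnds, hj', hl, not_lt.2 hj]
    · refine ⟨by simp [h1], fun u' hu'' => ?_⟩
      rcases hu' u' hu'' with rfl | rfl
      · obtain ⟨j, hj, hl⟩ := h21 i hi hi'
        refine ⟨j, ?_⟩
        simp [hardEnds, hj, hl]
      · exact ⟨i, by simp [h1]⟩
    · rw [h1] at hu
      exact absurd rfl hu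
  -- The equivalence with classes `{0}` and `{1, 2}`. Every union of its classes is convex, so
  -- convexity of images holds for arbitrary sets.
  set R : Fin 3 → Fin 3 → Prop := fun u v => u = 0 ↔ v = 0 with hR
  have hconv : ∀ C : Set (Fin 3), IsConvexFor (· ≤ ·) {v | ∃ u ∈ C, R u v} := by
    rintro C u v w huv hvw ⟨x, hx, hxu⟩ ⟨y, hy, hyw⟩
    by_cases hv : v = 0
    · subst hv
      exact ⟨x, hx, by rw [hR] at hxu ⊢; simp only [hxu]; simpa using Fin.le_zero_iff.1 huv⟩
    · refine ⟨y, hy, ?_⟩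
      rw [hR] at hyw ⊢
      simp only [hyw, hv, iff_false]
      rintro rfl
      exact hv (Fin.le_zero_iff.1 hvw)
  have hauto : A.IsWheelerAutobisimulation (· ≤ ·) R := by
    refine ⟨⟨⟨?_, ?_, Iff.rfl, ?_⟩, fun C _ => hconv C, fun C _ => ?_⟩, fun u => Iff.rfl⟩
    · intro u v u' a huu huv
      by_cases hu : u = 0
      · have hu' := huu.1 hu
        subst hu hu'
        exact ⟨v, Iff.rfl, huv⟩
      · obtain ⟨rfl, h2⟩ := edge u v a huv hu
        exact ⟨2, Iff.rfl, h2 u' fun h => hu (huu.2 h)⟩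
    · intro u u' v a huu huv
      by_cases hu : u' = 0
      · have hu' := huu.2 hu
        subst hu hu'
        exact ⟨v, Iff.rfl, huv⟩
      · obtain ⟨rfl, h2⟩ := edge u' v a huv hu
        exact ⟨2, Iff.rfl, h2 u fun h => hu (huu.1 h)⟩
    · intro u u' huu
      exact not_congr huu
    · have : {u | ∃ u' ∈ C, R u u'} = {v | ∃ u ∈ C, R u v} :=
        Set.ext fun u => exists_congr fun u' => and_congr Iff.rfl iff_comm
      rw [this]
      exact hconv C
  have hcls : A.wheelerClass (· ≤ ·) 1 = A.wheelerClass (· ≤ ·) 2 := by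
    ext v
    have key : ∀ x y : Fin 3, x ≠ 0 → y ≠ 0 → v ∈ A.wheelerClass (· ≤ ·) x →
        v ∈ A.wheelerClass (· ≤ ·) y := by
      rintro x y hx hy ⟨S, hS, hxv⟩
      refine ⟨R, hauto, ?_⟩
      have := hS.wheeler.bisim.final x v hxv
      rw [hR]
      simp only [hy, false_iff]
      exact this.1 hx
    exact ⟨key 1 2 (by decide) (by decide), key 2 1 (by decide) (by decide)⟩
  intro hcard
  have hsurj : Function.Surjective (Set.rangeFactorization (A.wheelerClass (· ≤ ·))) :=
    Set.rangeFactorization_surjective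
  -- With three classes the class map would be a surjection between sets of equal size, hence
  -- injective, although it identifies 1 and 2.
  have hbij := (Nat.bijective_iff_surjective_and_card _).2 ⟨hsurj, by rw [hcard]; simp⟩
  exact absurd (hbij.1 (a₁ := 1) (a₂ := 2) (Subtype.ext hcls)) (by decide)

/-- No states are merged if some label occurs only at state 1. -/
theorem card_quotient_of_labels_ne [LE σ] {k : ℕ} {lab : Fin m → σ} (i : Fin m) (hi : (i : ℕ) < k)
    (hne : ∀ j : Fin m, k ≤ j → (j : ℕ) < 2 * k → lab j ≠ lab i) :
    Nat.card ((hardAutomaton k lab).QuotientState (· ≤ ·)) = 3 := by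
  set A := hardAutomaton k lab with hA
  have he : ((1 : Fin 3), (2 : Fin 3), lab i) ∈ A.edges := ⟨i, by simp [hardEnds, hi]⟩
  have hne2 : ∀ v, ((2 : Fin 3), v, lab i) ∉ A.edges := by
    rintro v ⟨j, hj⟩
    simp only [Prod.mk.injEq] at hj
    rcases hardEnds_cases k j with ⟨-, h1⟩ | ⟨hj1, hj2, -⟩ | ⟨-, h1⟩
    · rw [h1] at hj
      exact absurd hj.1 (by decide)
    · exact hne j hj1 hj2 hj.2.2
    · rw [h1] at hj
      exact absurd hj.1 (by decide)
  have h12 : ∀ R, A.IsWheelerAutobisimulation (· ≤ ·) R → ¬ R 1 2 := by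
    intro R hR h
    obtain ⟨v, -, hv⟩ := hR.wheeler.bisim.forth _ _ _ _ h he
    exact hne2 v hv
  have h21 : ∀ R, A.IsWheelerAutobisimulation (· ≤ ·) R → ¬ R 2 1 := by
    intro R hR h
    obtain ⟨v, -, hv⟩ := hR.wheeler.bisim.back _ _ _ _ h he
    exact hne2 v hv
  have hinj : Function.Injective (A.wheelerClass (· ≤ ·)) := by
    intro u v huv
    have hv : ∃ R, A.IsWheelerAutobisimulation (· ≤ ·) R ∧ R v v :=
      ⟨_, (⟨⟨⟨by rintro u v _ a rfl h; exact ⟨v, rfl, h⟩, by rintro u _ v a rfl h; exact ⟨v, rfl, h⟩,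
        rfl, by rintro u _ rfl; rfl⟩, by simp, by simp⟩, fun _ => rfl⟩ :
          A.IsWheelerAutobisimulation (· ≤ ·) (fun x y => x = y)), rfl⟩
    have huv' : v ∈ A.wheelerClass (· ≤ ·) u := by
      rw [huv]
      exact hv
    obtain ⟨R, hR, h⟩ := huv'
    -- Finality separates 0 from 1 and 2; the label `lab i`, present at 1 and absent at 2, separates
    -- these two in both directions.
    have hf := hR.wheeler.bisim.final u v h
    have h12 := h12 R hR
    have h21 := h21 R hR
    simp only [hA, hardAutomaton, Set.mem_ofPred_eq] at hf
    fin_cases u <;> fin_cases v <;> simp_all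
  have := Nat.card_congr (Equiv.ofInjective _ hinj)
  simpa using this.symm

theorem hardDescription_getElem? (k : ℕ) (lab : Fin m → σ) (j : ℕ) :
    (hardDescription k lab).edges[j]? =
      if h : j < m then some ((hardEnds k j).1, (hardEnds k j).2, lab ⟨j, h⟩) else none :=
  List.getElem?_ofFn

/-- The numerical part of the input does not depend on the labels. Taking `lab` to be the identity,
all hard inputs of one size are images of a single symbolic memory. -/
theorem hardDescription_toMemory {ι : Type} (k : ℕ) (lab : Fin m → ι) (f : ι → σ) :
    (hardDescription k lab).toMemory.map f = (hardDescription k (fun i => f (lab i))).toMemory := by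
  ext1
  · funext x
    simp [Memory.map, Description.toMemory, hardDescription]
  · funext a j
    simp only [Memory.map, Description.toMemory, hardDescription_getElem?]
    by_cases h : j < m
    · simp only [dif_pos h]
      rfl
    · simp only [dif_neg h]
      rfl
  · funext b j
    simp only [Memory.map, Description.toMemory, hardDescription_getElem?]
    by_cases h : j < m
    · simp only [dif_pos h]
      split_ifs <;> rfl
    · simp only [dif_neg h]
      split_ifs <;> rfl

/-- A run on a hard input, traced on the positions of the edges. -/
theorem BuildsQuotient.exists_trace {p : Program} {f W : ℕ → ℕ}
    (hp : BuildsQuotient (fun _ _ A => A.IsDFA) p f W) {k : ℕ} {lab : Fin m → ℕ}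
    (h : IsHardLabelling k lab) :
    ∃ t L s', Traced (W m) p (hardDescription k (id : Fin m → Fin m)).toMemory t L s' ∧
      L.length ≤ f m ∧ ConsistentWith (fun i j => lab i ≤ lab j) L ∧
      s'.reg 0 = Nat.card ((hardAutomaton k (Set.rangeFactorization lab)).QuotientState (· ≤ ·)) := by
  -- The program is only assumed correct over finite alphabets, so the labels are taken in the
  -- finite range of `lab` instead of in `ℕ`.
  set lab' := Set.rangeFactorization lab
  have h' : IsHardLabelling k lab' :=
    ⟨h.pos, h.lt, h.le, fun i j hij hl => h.inj i j hij (congrArg Subtype.val hl)⟩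
  have hd := hardDescription_describes h'
  obtain ⟨t, s', hex, ht, d', hd', hst⟩ := hp (Set.range lab) (Fin 3) (hardAutomaton k lab') (· ≤ ·)
    (hardAutomaton_isWheelerNFA h') (hardAutomaton_isDFA _ _) _ hd
  have hm : (hardAutomaton k lab').edges.ncard = m := by
    rw [hd.ncard_edges]
    simp [hardDescription]
  rw [hm] at hex ht
  obtain ⟨L, s0, h1, h2, rfl, h4⟩ := hex.exists_traced lab' _ (hardDescription_toMemory k id lab')
  refine ⟨t, L, s0, h2, h1.trans ht, h4, ?_⟩
  rw [← hd'.numStates_eq]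
  exact hst.1

/-- If the trace for `lab` is also consistent with `lab'`, the quotients have the same size. -/
theorem BuildsQuotient.card_eq_of_consistent {p : Program} {f W : ℕ → ℕ}
    (hp : BuildsQuotient (fun _ _ A => A.IsDFA) p f W) {k : ℕ} {lab' : Fin m → ℕ}
    (h' : IsHardLabelling k lab') {t : ℕ} {L : List (Query (Fin m))} {s : Memory (Fin m)}
    (hL : Traced (W m) p (hardDescription k (id : Fin m → Fin m)).toMemory t L s)
    (hc : ConsistentWith (fun i j => lab' i ≤ lab' j) L) :
    s.reg 0 = Nat.card ((hardAutomaton k (Set.rangeFactorization lab')).QuotientState (· ≤ ·)) := by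
  obtain ⟨t', L', s', h1, -, h3, h4⟩ := hp.exists_trace h'
  -- Both traces become runs over the characters `ℕ` from one initial memory, so determinism makes
  -- their final memories coincide.
  have e1 := hL.exec lab' hc
  have e2 := h1.exec lab' h3
  rw [← h4]
  exact congrArg (fun S : Memory ℕ => S.reg 0) (e1.unique e2)

/-- Labels `4 i + 4` at state 1, `x` at state 2, and small labels at state 0. -/
def hardLabels (m k : ℕ) (x : Fin k → ℕ) (i : Fin m) : ℕ :=
  if (i : ℕ) < k then 4 * i + 4 else if h : i - k < k then x ⟨i - k, h⟩ else i - 2 * k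

/-- At most two edges lead from 0 to 1, with the labels 0 and 1; all other labels are at least 3.
Labels at 1 may coincide with labels at 2, since only edges with the same end points need different
labels. -/
theorem isHardLabelling_hardLabels {k : ℕ} (hk : 0 < k) (hm : 2 * k < m) (hm' : m ≤ 2 * k + 2)
    (x : Fin k → ℕ) (hx : Function.Injective x) (hx3 : ∀ j, 3 ≤ x j) :
    IsHardLabelling k (hardLabels m k x) := by
  refine ⟨hk, hm, ?_, ?_⟩
  · intro i j hi hj
    have hi' : hardLabels m k x i ≤ 1 := by
      have := i.2
      rw [hardLabels, if_neg (by omega), dif_neg (by omega)]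
      omega
    refine hi'.trans ?_
    rw [hardLabels]
    split_ifs with h1 h2
    · omega
    · have := hx3 ⟨j - k, h2⟩
      omega
    · omega
  · intro i j hij hl
    rw [hardLabels, hardLabels] at hl
    apply Fin.ext
    rcases hardEnds_cases k i with ⟨hi, h1⟩ | ⟨hi, hi', h1⟩ | ⟨hi, h1⟩ <;>
    rcases hardEnds_cases k j with ⟨hj, h2⟩ | ⟨hj, hj', h2⟩ | ⟨hj, h2⟩ <;>
    rw [h1, h2] at hij <;>
    first
    | exact absurd hij (by decide)
    | skip
    · rw [if_pos hi, if_pos hj] at hl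
      omega
    · rw [if_neg (by omega), if_neg (by omega), dif_pos (by omega), dif_pos (by omega)] at hl
      have := congrArg Fin.val (hx hl)
      simp only at this
      omega
    · rw [if_neg (by omega), if_neg (by omega), dif_neg (by omega), dif_neg (by omega)] at hl
      omega

end HardInputs

/-! ## The lower bound -/

section LowerBound

variable {m k : ℕ}

theorem hardLabels_of_lt (x : Fin k → ℕ) (i : Fin m) (hi : (i : ℕ) < k) :
    hardLabels m k x i = 4 * i + 4 := if_pos hi

theorem hardLabels_of_mid (x : Fin k → ℕ) (i : Fin m) (j : Fin k) (hi : (i : ℕ) = k + j) :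
    hardLabels m k x i = x j := by
  have hj := j.2
  rw [hardLabels, if_neg (by omega), dif_pos (by omega)]
  congr 1
  apply Fin.ext
  simp only
  omega

/-- The labels of state 2 for the permutation `π`. -/
def permLabels (π : Equiv.Perm (Fin k)) (j : Fin k) : ℕ := 4 * (π j : ℕ) + 4

theorem permLabels_injective (π : Equiv.Perm (Fin k)) : Function.Injective (permLabels π) := by
  intro i j h
  apply π.injective
  apply Fin.ext
  simp only [permLabels] at h
  omega

/-- The permutation labels are multiples of 4, so a perturbed label cannot collide with any of the
others. -/
theorem update_permLabels_injective (π : Equiv.Perm (Fin k)) (j : Fin k) (v : ℕ) (hv : v % 4 ≠ 0) :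
    Function.Injective (Function.update (permLabels π) j v) := by
  intro a b h
  simp only [Function.update_apply] at h
  split_ifs at h with h1 h2 h2
  · rw [h1, h2]
  · simp only [permLabels] at h
    omega
  · simp only [permLabels] at h
    omega
  · exact permLabels_injective π h

/-- Moving one label of state 2 by one unit changes only its comparison with the equal label of
state 1. -/
theorem hardLabels_update (π : Equiv.Perm (Fin k)) (j : Fin k) (v : ℕ) (i : Fin m) :
    ((i : ℕ) = k + j ∧ hardLabels m k (permLabels π) i = 4 * (π j : ℕ) + 4 ∧
      hardLabels m k (Function.update (permLabels π) j v) i = v) ∨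
    ((i : ℕ) ≠ k + j ∧ hardLabels m k (Function.update (permLabels π) j v) i =
        hardLabels m k (permLabels π) i ∧
      ((i : ℕ) = π j ∨ ¬ (i : ℕ) < k ∧ ¬ i - k < k ∧ hardLabels m k (permLabels π) i = i - 2 * k ∨
      hardLabels m k (permLabels π) i % 4 = 0 ∧
        hardLabels m k (permLabels π) i ≠ 4 * (π j : ℕ) + 4)) := by
  by_cases hi : (i : ℕ) = k + j
  · refine .inl ⟨hi, ?_, ?_⟩
    · rw [hardLabels_of_mid _ _ j hi, permLabels]
    · rw [hardLabels_of_mid _ _ j hi, Function.update_self]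
  · refine .inr ⟨hi, ?_⟩
    rw [hardLabels, hardLabels]
    split_ifs with h1 h2
    · refine ⟨rfl, ?_⟩
      omega
    · have hne : (⟨i - k, h2⟩ : Fin k) ≠ j := by
        intro h
        have := congrArg Fin.val h
        simp only at this
        omega
      rw [Function.update_of_ne hne]
      have hne' := (π.injective.ne hne)
      rw [Ne, Fin.ext_iff] at hne'
      simp only [permLabels, true_and]
      omega
    · refine ⟨rfl, .inr (.inl ⟨h1, h2, rfl⟩)⟩

variable {p : Program} {f W : ℕ → ℕ}

/-- The trace of a hard input determines the permutation. -/
theorem BuildsQuotient.query_mem (hp : BuildsQuotient (fun _ _ A => A.IsDFA) p f W)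
    (hk : 0 < k) (hm : 2 * k < m) (hm' : m ≤ 2 * k + 2) (π : Equiv.Perm (Fin k)) (j : Fin k)
    {t : ℕ} {L : List (Query (Fin m))} {s : Memory (Fin m)}
    (hL : Traced (W m) p (hardDescription k (id : Fin m → Fin m)).toMemory t L s)
    (hc : ConsistentWith
      (fun i j => hardLabels m k (permLabels π) i ≤ hardLabels m k (permLabels π) j) L)
    (hs : s.reg 0 ≠ 3) (x y : Fin m) (hx : (x : ℕ) = π j) (hy : (y : ℕ) = k + j) :
    ((x, y), true) ∈ L ∧ ((y, x), true) ∈ L := by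
  have hπ := (π j).2
  have hj := j.2
  have hxl : hardLabels m k (permLabels π) x = 4 * (π j : ℕ) + 4 := by
    rw [hardLabels_of_lt _ _ (by omega), hx]
  have hyl : hardLabels m k (permLabels π) y = 4 * (π j : ℕ) + 4 := by
    rw [hardLabels_of_mid _ _ j hy, permLabels]
  -- The adversary: relabel loop `j` by `v`. The label of `x` then has no partner at state 2, so the
  -- quotient has three states; a trace consistent with this labelling would have ended with 3 in
  -- register 0.
  have contra : ∀ v, v % 4 ≠ 0 → 3 ≤ v → ¬ ConsistentWith (fun a b =>
      hardLabels m k (Function.update (permLabels π) j v) a ≤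
        hardLabels m k (Function.update (permLabels π) j v) b) L := by
    intro v hv hv3 hc'
    have hlab := isHardLabelling_hardLabels (m := m) hk hm hm' _
      (update_permLabels_injective π j v hv) (by
        intro a
        rw [Function.update_apply]
        split_ifs
        · exact hv3
        · rw [permLabels]
          omega)
    refine hs ((hp.card_eq_of_consistent hlab hL hc').trans ?_)
    refine card_quotient_of_labels_ne x (by omega) ?_
    intro b hb hb' hbx
    have hbx' := congrArg Subtype.val hbx
    simp only [Set.rangeFactorization] at hbx'
    have hxe : hardLabels m k (Function.update (permLabels π) j v) x = 4 * (π j : ℕ) + 4 := by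
      rw [hardLabels_of_lt _ _ (by omega), hx]
    rw [hxe] at hbx'
    rcases hardLabels_update π j v b with ⟨h1, h2, h3⟩ | ⟨h1, h2, h3⟩
    · omega
    · omega
  constructor
  · by_contra hmem
    -- Lowering the label of `y` by one falsifies `x ≤ y` and changes no other comparison: no other
    -- label lies between the old and the new value.
    refine contra (4 * (π j : ℕ) + 3) (by omega) (by omega) ?_
    rintro ⟨⟨a, b⟩, r⟩ hq
    refine (hc _ hq).trans ?_
    simp only
    rcases hardLabels_update π j (4 * (π j : ℕ) + 3) a with ⟨h1, h2, h3⟩ | ⟨h1, h2, h3⟩ <;>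
    rcases hardLabels_update π j (4 * (π j : ℕ) + 3) b with ⟨k1, k2, k3⟩ | ⟨k1, k2, k3⟩
    · rw [h2, h3, k2, k3]
      omega
    · have := b.2
      rw [h2, h3, k2]
      rcases k3 with k3 | k3 | k3
      · rw [hardLabels_of_lt _ b (by omega)]
        omega
      · omega
      · omega
    · have := a.2
      rw [h2, k2, k3]
      rcases h3 with h3 | h3 | h3
      · have ha : a = x := Fin.ext (by omega)
        have hb : b = y := Fin.ext (by omega)
        subst ha hb
        have := hc _ hq
        simp only [hxl, hyl, le_refl, iff_true] at this
        rw [this] at hq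
        exact absurd hq hmem
      · omega
      · omega
    · rw [h2, k2]
  · by_contra hmem
    -- Raising the label of `y` by one falsifies exactly `y ≤ x`.
    refine contra (4 * (π j : ℕ) + 5) (by omega) (by omega) ?_
    rintro ⟨⟨a, b⟩, r⟩ hq
    refine (hc _ hq).trans ?_
    simp only
    rcases hardLabels_update π j (4 * (π j : ℕ) + 5) a with ⟨h1, h2, h3⟩ | ⟨h1, h2, h3⟩ <;>
    rcases hardLabels_update π j (4 * (π j : ℕ) + 5) b with ⟨k1, k2, k3⟩ | ⟨k1, k2, k3⟩
    · rw [h2, h3, k2, k3]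
      omega
    · have := b.2
      rw [h2, h3, k2]
      rcases k3 with k3 | k3 | k3
      · have ha : a = y := Fin.ext (by omega)
        have hb : b = x := Fin.ext (by omega)
        subst ha hb
        have := hc _ hq
        simp only [hxl, hyl, le_refl, iff_true] at this
        rw [this] at hq
        exact absurd hq hmem
      · omega
      · omega
    · have := a.2
      rw [h2, k2, k3]
      rcases h3 with h3 | h3 | h3
      · rw [hardLabels_of_lt _ a (by omega)]
        omega
      · omega
      · omega
    · rw [h2, k2]

/-- Every permutation gives an input on which states 1 and 2 merge, and its trace contains both
comparisons for each matched pair of edges. Different permutations therefore have different traces,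
each of at most `f m` binary answers. -/
theorem BuildsQuotient.factorial_le (hp : BuildsQuotient (fun _ _ A => A.IsDFA) p f W)
    (hk : 0 < k) (hm : 2 * k < m) (hm' : m ≤ 2 * k + 2) : k.factorial ≤ 2 ^ f m := by
  have hlab : ∀ π : Equiv.Perm (Fin k), IsHardLabelling k (hardLabels m k (permLabels π)) :=
    fun π => isHardLabelling_hardLabels hk hm hm' _ (permLabels_injective π) fun j => by
      rw [permLabels]
      omega
  choose t L s h1 h2 h3 h4 using fun π => hp.exists_trace (hlab π)
  -- A permutation makes the label sets of states 1 and 2 equal.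
  have hs : ∀ π, (s π).reg 0 ≠ 3 := by
    intro π
    rw [h4 π]
    have hπ : ∀ j, (π j : ℕ) < k := fun j => (π j).2
    refine card_quotient_of_labels_eq ?_ ?_
    · intro i hi
      obtain ⟨j, hj⟩ := π.surjective ⟨i, hi⟩
      refine ⟨⟨k + j, by omega⟩, by simp, by simp only; omega, Subtype.ext ?_⟩
      simp only [Set.rangeFactorization]
      rw [hardLabels_of_lt _ _ hi, hardLabels_of_mid _ _ j rfl, permLabels, hj]
    · intro i hi hi'
      have hik : (i : ℕ) - k < k := by omega
      have := hπ ⟨i - k, hik⟩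
      refine ⟨⟨π ⟨i - k, hik⟩, by omega⟩, this, Subtype.ext ?_⟩
      simp only [Set.rangeFactorization]
      rw [hardLabels_of_lt (m := m) _ ⟨(π ⟨i - k, hik⟩ : ℕ), _⟩ this,
        hardLabels_of_mid _ i ⟨i - k, hik⟩ (by simp only; omega), permLabels]
  have hinj : Function.Injective L := by
    intro π π' hππ
    ext j
    have hπ := (π j).2
    have hj := j.2
    obtain ⟨q1, q2⟩ := hp.query_mem hk hm hm' π j (h1 π) (h3 π) (hs π)
      ⟨π j, by omega⟩ ⟨k + j, by omega⟩ rfl rfl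
    rw [hππ] at q1 q2
    -- The two answers recorded for the pair matched by `π` must also be true for `π'`, which forces
    -- equal labels and hence `π' j = π j`.
    have e1 := (h3 π' _ q1).1 rfl
    have e2 := (h3 π' _ q2).1 rfl
    simp only at e1 e2
    rw [hardLabels_of_mid _ ⟨k + j, _⟩ j rfl, hardLabels_of_lt (m := m) _ ⟨π j, _⟩ hπ,
      permLabels] at e1 e2
    simp only at e1 e2
    omega
  have := card_le_two_pow_of_traced L h2 (fun π => ⟨t π, s π, h1 π⟩) hinj
  rwa [Fintype.card_perm, Fintype.card_fin] at this

/-- The term `k ^ k / k!` of the exponential series is at most `exp k`; take logarithms. -/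
theorem mul_log_le_log_factorial (k : ℕ) (hk : 0 < k) :
    (k : ℝ) * (Real.log k - 1) ≤ Real.log (k.factorial) := by
  have h := Real.pow_div_factorial_le_exp (k : ℝ) (Nat.cast_nonneg k) k
  have hk' : (0 : ℝ) < k := by exact_mod_cast hk
  have hf : (0 : ℝ) < k.factorial := by exact_mod_cast Nat.factorial_pos k
  have h2 := Real.log_le_log (by positivity) h
  rw [Real.log_exp, Real.log_div (by positivity) (by positivity), Real.log_pow] at h2
  linarith

theorem BuildsQuotient.isBigO (hp : BuildsQuotient (fun _ _ A => A.IsDFA) p f W) :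
    (fun m : ℕ => m * Real.log m) =O[atTop] fun m => (f m : ℝ) := by
  have hlog : Tendsto (fun m : ℕ => Real.log m) atTop atTop :=
    Real.tendsto_log_atTop.comp tendsto_natCast_atTop_atTop
  -- The factor is 3 from `m ≤ 3 * k` times 2 from `log m / 2 ≤ log k - 1`; the threshold on `log m`
  -- below secures the latter.
  refine IsBigO.of_bound 6 ?_
  filter_upwards [eventually_ge_atTop 6, hlog.eventually_ge_atTop (2 * (Real.log 3 + 1))] with m h6 hl
  -- The largest `k` with `2 * k < m`; one or two edges are left over for `0 → 1`.
  set k := (m - 1) / 2 with hkdef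
  have hk : 0 < k := by omega
  have h1 := hp.factorial_le (m := m) hk (by omega) (by omega)
  have h2 : Real.log k.factorial ≤ f m := by
    have h3 : (k.factorial : ℝ) ≤ 2 ^ f m := by exact_mod_cast h1
    have h4 := Real.log_le_log (by exact_mod_cast Nat.factorial_pos k) h3
    rw [Real.log_pow] at h4
    have : Real.log 2 ≤ 1 := by linarith [Real.log_two_lt_d9]
    nlinarith [Nat.cast_nonneg (α := ℝ) (f m)]
  have h3 := mul_log_le_log_factorial k hk
  have hm : (0 : ℝ) < m := by exact_mod_cast (by omega : 0 < m)
  have hkm : (m : ℝ) / 3 ≤ k := by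
    have : (m : ℝ) ≤ 3 * k := by exact_mod_cast (by omega : m ≤ 3 * k)
    linarith
  have hlk : Real.log m - Real.log 3 ≤ Real.log k := by
    rw [← Real.log_div hm.ne' (by norm_num)]
    exact Real.log_le_log (by positivity) hkm
  have h0 : 0 ≤ Real.log m := Real.log_natCast_nonneg m
  have h5 : (m : ℝ) / 3 * (Real.log m / 2) ≤ k * (Real.log k - 1) :=
    mul_le_mul hkm (by linarith) (by linarith) (Nat.cast_nonneg k)
  rw [Real.norm_of_nonneg (by positivity), Real.norm_of_nonneg (Nat.cast_nonneg _)]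
  nlinarith

end LowerBound

/-! ## Verification of programs -/

section Verification

variable {σ : Type}

@[simp] theorem Memory.setReg_reg (s : Memory σ) (x v y : ℕ) :
    (s.setReg x v).reg y = if y = x then v else s.reg y := by
  simp [Memory.setReg, Function.update_apply]

@[simp] theorem Memory.setReg_num (s : Memory σ) (x v : ℕ) : (s.setReg x v).num = s.num := rfl

@[simp] theorem Memory.setReg_char (s : Memory σ) (x v : ℕ) : (s.setReg x v).char = s.char := rfl

@[simp] theorem Memory.setNum_reg (s : Memory σ) (a i v : ℕ) : (s.setNum a i v).reg = s.reg := rfl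

@[simp] theorem Memory.setNum_num (s : Memory σ) (a i v b : ℕ) :
    (s.setNum a i v).num b = if b = a then Function.update (s.num a) i v else s.num b := by
  simp [Memory.setNum, Function.update_apply]

@[simp] theorem Memory.setNum_char (s : Memory σ) (a i v : ℕ) : (s.setNum a i v).char = s.char := rfl

@[simp] theorem Memory.setChar_reg (s : Memory σ) (b i : ℕ) (c : Option σ) :
    (s.setChar b i c).reg = s.reg := rfl

@[simp] theorem Memory.setChar_num (s : Memory σ) (b i : ℕ) (c : Option σ) :
    (s.setChar b i c).num = s.num := rfl

@[simp] theorem Memory.setChar_char (s : Memory σ) (b i : ℕ) (c : Option σ) (b' : ℕ) :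
    (s.setChar b i c).char b' = if b' = b then Function.update (s.char b) i c else s.char b' := by
  simp [Memory.setChar, Function.update_apply]

variable [LE σ]

/-- Started in `s`, the program halts within `T` units of time in a memory satisfying `Post`. -/
def Runs (W : ℕ) (p : Program) (s : Memory σ) (T : ℕ) (Post : Memory σ → Prop) : Prop :=
  ∃ t s', Exec W p s t s' ∧ t ≤ T ∧ Post s'

/-- The number of instructions, a bound for the running time of programs without loops. -/
def Program.size : Program → ℕ
  | .seq p q => p.size + q.size
  | .ite _ p q => p.size + q.size + 1
  | .while _ p => p.size + 1
  | _ => 1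

/-- The weakest precondition of a program without loops. -/
def wp (W : ℕ) : Program → (Memory σ → Prop) → Memory σ → Prop
  | .skip, Post, s => Post s
  | .set x o, Post, s => o.eval s ≤ W ∧ Post (s.setReg x (o.eval s))
  | .arith x op o₁ o₂, Post, s =>
      op.eval (o₁.eval s) (o₂.eval s) ≤ W ∧ Post (s.setReg x (op.eval (o₁.eval s) (o₂.eval s)))
  | .load x a o, Post, s => s.num a (o.eval s) ≤ W ∧ Post (s.setReg x (s.num a (o.eval s)))
  | .store a o₁ o₂, Post, s => o₂.eval s ≤ W ∧ Post (s.setNum a (o₁.eval s) (o₂.eval s))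
  | .copyChar b₁ o₁ b₂ o₂, Post, s =>
      Post (s.setChar b₁ (o₁.eval s) (s.char b₂ (o₂.eval s)))
  | .seq p q, Post, s => wp W p (wp W q Post) s
  | .ite c p q, Post, s => (c.Holds s → wp W p Post s) ∧ (¬ c.Holds s → wp W q Post s)
  | .while _ _, _, _ => False

variable {W : ℕ} {p q : Program} {s : Memory σ} {T T' : ℕ} {Post Post' : Memory σ → Prop}

/-- Without loops every instruction is executed at most once. The precondition of a loop is `False`,
so that case does not arise. -/
theorem Runs.of_wp (h : wp W p Post s) : Runs W p s p.size Post := by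
  induction p generalizing s Post with
  | skip => exact ⟨1, _, .skip s, le_rfl, h⟩
  | set x o => exact ⟨1, _, .set s x o h.1, le_rfl, h.2⟩
  | arith x op o₁ o₂ => exact ⟨1, _, .arith s x op o₁ o₂ h.1, le_rfl, h.2⟩
  | load x a o => exact ⟨1, _, .load s x a o h.1, le_rfl, h.2⟩
  | store a o₁ o₂ => exact ⟨1, _, .store s a o₁ o₂ h.1, le_rfl, h.2⟩
  | copyChar b₁ o₁ b₂ o₂ => exact ⟨1, _, .copyChar s b₁ o₁ b₂ o₂, le_rfl, h⟩
  | seq p q ihp ihq =>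
    obtain ⟨t, s', h1, h2, h3⟩ := ihp h
    obtain ⟨t', s'', k1, k2, k3⟩ := ihq h3
    exact ⟨t + t', s'', .seq h1 k1, Nat.add_le_add h2 k2, k3⟩
  | ite c p q ihp ihq =>
    by_cases hc : c.Holds s
    · obtain ⟨t, s', h1, h2, h3⟩ := ihp (h.1 hc)
      exact ⟨t + 1, s', .ite_true hc h1, by rw [Program.size]; omega, h3⟩
    · obtain ⟨t, s', h1, h2, h3⟩ := ihq (h.2 hc)
      exact ⟨t + 1, s', .ite_false hc h1, by rw [Program.size]; omega, h3⟩
  | _ => exact absurd h id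

theorem Runs.mono (h : Runs W p s T Post) (hT : T ≤ T') (hP : ∀ s', Post s' → Post' s') :
    Runs W p s T' Post' := by
  obtain ⟨t, s', h1, h2, h3⟩ := h
  exact ⟨t, s', h1, h2.trans hT, hP _ h3⟩

theorem Runs.seq (h : Runs W p s T fun s' => Runs W q s' T' Post) :
    Runs W (.seq p q) s (T + T') Post := by
  obtain ⟨t, s', h1, h2, t', s'', k1, k2, k3⟩ := h
  exact ⟨t + t', s'', .seq h1 k1, Nat.add_le_add h2 k2, k3⟩

/-- A loop whose body takes at most `B` units of time and that is passed through at most `N` times. -/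
theorem Runs.whileLoop {c : Test} (Inv : ℕ → Memory σ → Prop) (N B : ℕ)
    (h : ∀ i s, Inv i s → c.Holds s → i < N ∧ Runs W p s B (Inv (i + 1))) {i : ℕ} {s : Memory σ}
    (hi : i ≤ N) (hs : Inv i s) :
    Runs W (.while c p) s ((N - i) * (B + 1) + 1) fun s' => ∃ j ≤ N, Inv j s' ∧ ¬ c.Holds s' := by
  -- Induction on the number of passes that remain.
  obtain ⟨r, hr⟩ : ∃ r, N - i = r := ⟨_, rfl⟩
  induction r generalizing i s with
  | zero =>
    refine ⟨1, s, .while_false fun hc => ?_, by omega, i, hi, hs, fun hc => ?_⟩ <;>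
    · have := (h i s hs hc).1
      omega
  | succ r ih =>
    by_cases hc : c.Holds s
    · obtain ⟨h1, t, s', h2, h3, h4⟩ := h i s hs hc
      obtain ⟨t', s'', k1, k2, k3⟩ := ih (i := i + 1) h1 h4 (by omega)
      refine ⟨t + t' + 1, s'', .while_true hc h2 k1, ?_, k3⟩
      have : N - (i + 1) = r := by omega
      rw [this] at k2
      rw [hr, Nat.succ_mul]
      omega
    · exact ⟨1, s, .while_false hc, by omega, i, hi, hs, hc⟩

/-- `for x < y do p`, starting with the current value of `x`. -/
def forLoop (x y : ℕ) (p : Program) : Program :=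
  .while (.lt (.reg x) (.reg y)) (.seq p (.arith x .add (.reg x) (.const 1)))

/-- The body has to leave the counter and the bound alone and to establish the invariant for the
memory after the increment. A pass costs the body, the increment and the test. -/
theorem Runs.forLoop {x y : ℕ} (hxy : x ≠ y) (Inv : ℕ → Memory σ → Prop) (N : ℕ) (hN : N ≤ W)
    (h : ∀ i s, i < N → s.reg x = i → s.reg y = N → Inv i s →
      wp W p (fun s' => s'.reg x = i ∧ s'.reg y = N ∧ Inv (i + 1) (s'.setReg x (i + 1))) s)
    {i : ℕ} {s : Memory σ} (hi : i ≤ N) (hx : s.reg x = i) (hy : s.reg y = N) (hs : Inv i s) :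
    Runs W (forLoop x y p) s (N * (p.size + 2) + 1) fun s' => s'.reg y = N ∧ Inv N s' := by
  refine (Runs.whileLoop (p := .seq p (.arith x .add (.reg x) (.const 1)))
    (fun i s => s.reg x = i ∧ s.reg y = N ∧ Inv i s) N (p.size + 1)
    ?_ hi ⟨hx, hy, hs⟩).mono ?_ ?_
  · rintro i s ⟨h1, h2, h3⟩ hc
    simp only [Test.Holds, Operand.eval, h1, h2] at hc
    refine ⟨hc, Runs.seq (Runs.mono (Runs.of_wp (h i s hc h1 h2 h3)) le_rfl ?_)⟩
    rintro s' ⟨k1, k2, k3⟩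
    refine Runs.of_wp (p := .arith x .add (.reg x) (.const 1)) ?_
    simp only [wp, Operand.eval, ArithOp.eval, k1]
    exact ⟨by omega, by simp, by simp [hxy.symm, k2], k3⟩
  · have : (N - i) * (p.size + 1 + 1) ≤ N * (p.size + 2) := Nat.mul_le_mul (by omega) le_rfl
    omega
  · rintro s' ⟨j, hj, ⟨h1, h2, h3⟩, hc⟩
    simp only [Test.Holds, Operand.eval, h1, h2, not_lt] at hc
    obtain rfl : j = N := le_antisymm hj hc
    exact ⟨h2, h3⟩

end Verification

/-! ## Merging -/

/-- The state of a pass that merges adjacent sorted blocks of length `w` in `a`, writing to `b`: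
`k` entries of `b` are written, and the parts `[i, mid)` and `[j, hi)` of `a` remain to be merged. -/
structure MergeInv (r : ℕ → ℕ → Prop) (m w k i mid j hi : ℕ) (a b : ℕ → ℕ) : Prop where
  i_le : i ≤ mid
  mid_le : mid ≤ j
  j_le : j ≤ hi
  hi_le : hi ≤ m
  k_eq : k + mid = i + j
  perm : (Multiset.range k).map b = (Multiset.range i).map a + (Finset.Ico mid j).val.map a
  sorted : ∀ x y, x < y → y < k → x / (2 * w) = y / (2 * w) → r (b x) (b y)
  block : ∃ lo, 2 * w ∣ lo ∧ lo ≤ k ∧ hi ≤ lo + 2 * w ∧ (2 * w ∣ hi ∨ hi = m) ∧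
    ∀ x y, lo ≤ x → x < k → (i ≤ y ∧ y < mid ∨ j ≤ y ∧ y < hi) → r (b x) (a y)
  left : ∀ x y, i ≤ x → x < y → y < mid → r (a x) (a y)
  right : ∀ x y, j ≤ x → x < y → y < hi → r (a x) (a y)

section Merge

variable {r : ℕ → ℕ → Prop} {m w k i mid j hi : ℕ} {a b : ℕ → ℕ}

/-- A pass starts with an exhausted pair of empty blocks, so that the first pair is set up by the
same code as all later ones. -/
theorem MergeInv.init : MergeInv r m w 0 0 0 0 0 a b :=
  ⟨le_rfl, le_rfl, le_rfl, Nat.zero_le _, rfl, by simp, by intros; omega,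
    ⟨0, dvd_zero _, le_rfl, Nat.zero_le _, .inl (dvd_zero _), by intros; omega⟩,
    by intros; omega, by intros; omega⟩

theorem range_add_Ico {i j : ℕ} (h : i ≤ j) :
    Multiset.range i + (Finset.Ico i j).val = Multiset.range j := by
  induction j, h using Nat.le_induction with
  | base => simp
  | succ j hij ih =>
    rw [Nat.Ico_succ_right_eq_insert_Ico hij, Finset.insert_val_of_notMem (by simp),
      Multiset.add_cons, ih, Multiset.range_succ]

theorem div_eq_of_dvd_of_lt {d lo x : ℕ} (hlo : d ∣ lo) (h1 : lo ≤ x) (h2 : x < lo + d) :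
    x / d = lo / d := by
  obtain ⟨c, rfl⟩ := hlo
  have hd : 0 < d := by omega
  rw [Nat.mul_div_cancel_left _ hd]
  exact Nat.div_eq_of_lt_le (by rw [mul_comm]; exact h1) (by rw [add_mul, mul_comm c]; omega)

theorem le_of_div_eq {d lo x y : ℕ} (hd : 0 < d) (hlo : d ∣ lo) (h1 : lo ≤ y) (h : x / d = y / d) :
    lo ≤ x := by
  obtain ⟨c, rfl⟩ := hlo
  have h2 : c ≤ y / d := (Nat.le_div_iff_mul_le hd).2 (by rw [mul_comm]; exact h1)
  rw [← h, Nat.le_div_iff_mul_le hd] at h2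
  rwa [mul_comm]

/-- Once `k` reaches `hi` both parts are used up, and the next two blocks start at `hi`. Cutting
them off at `m` covers a shorter or empty last block. -/
theorem MergeInv.reset (hw : 0 < w) (ha : ∀ x y, x < y → y < m → x / w = y / w → r (a x) (a y))
    (h : MergeInv r m w k i mid j hi a b) (hk : k = hi) (hkm : k < m) :
    MergeInv r m w k hi (min (hi + w) m) (min (hi + w) m) (min (min (hi + w) m + w) m) a b := by
  obtain ⟨h1, h2, h3, h4, h5, h6, h7, ⟨lo, h8, h9, h10, h11, h12⟩, h13, h14⟩ := h
  have hi_mid : i = mid := by omega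
  have hj : j = hi := by omega
  subst hi_mid hj hk
  -- Only the last pair may end off the grid, at `m`, and `k < m` excludes it.
  have hdvd : 2 * w ∣ k := h11.resolve_right (by omega)
  have hdvd' : w ∣ k := (dvd_mul_left w 2).trans hdvd
  refine ⟨by omega, le_rfl, by omega, by omega, by omega, ?_, h7,
    ⟨k, hdvd, le_rfl, by omega, ?_, by intros; omega⟩, ?_, ?_⟩
  · rw [h6, Finset.Ico_self, Finset.empty_val, Multiset.map_zero, add_zero, ← Multiset.map_add,
      range_add_Ico h2]
  · by_cases hm : m ≤ k + w + w
    · right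
      omega
    · left
      have : min (min (k + w) m + w) m = k + 2 * w := by omega
      rw [this]
      exact (Nat.dvd_add_right hdvd).2 dvd_rfl
  · intro x y hx hxy hy
    refine ha x y hxy (by omega) ?_
    exact (div_eq_of_dvd_of_lt hdvd' hx (by omega)).trans
      (div_eq_of_dvd_of_lt hdvd' (by omega) (by omega)).symm
  · intro x y hx hxy hy
    have hdvd'' : w ∣ k + w := (Nat.dvd_add_right hdvd').2 dvd_rfl
    have : min (k + w) m = k + w := by omega
    refine ha x y hxy (by omega) ?_
    exact (div_eq_of_dvd_of_lt hdvd'' (by omega) (by omega)).trans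
      (div_eq_of_dvd_of_lt hdvd'' (by omega) (by omega)).symm

theorem map_range_succ_update (k v : ℕ) (b : ℕ → ℕ) :
    (Multiset.range (k + 1)).map (Function.update b k v) = v ::ₘ (Multiset.range k).map b := by
  rw [Multiset.range_succ, Multiset.map_cons, Function.update_self]
  congr 1
  refine Multiset.map_congr rfl fun x hx => ?_
  rw [Multiset.mem_range] at hx
  rw [Function.update_of_ne hx.ne]

/-- The new entry is compared only with entries of the current output block, and by `block` those
precede everything that remains to be merged. -/
theorem MergeInv.sorted_update (hw : 0 < w) (h : MergeInv r m w k i mid j hi a b) (hk : k < hi)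
    {v : ℕ} (hv : i ≤ v ∧ v < mid ∨ j ≤ v ∧ v < hi) :
    ∀ x y, x < y → y < k + 1 → x / (2 * w) = y / (2 * w) →
      r (Function.update b k (a v) x) (Function.update b k (a v) y) := by
  intro x y hxy hy hdiv
  obtain ⟨lo, h8, h9, h10, h11, h12⟩ := h.block
  rw [Function.update_of_ne (by omega)]
  by_cases hyk : y = k
  · subst hyk
    rw [Function.update_self]
    exact h12 x v (le_of_div_eq (by omega) h8 h9 hdiv) hxy hv
  · rw [Function.update_of_ne hyk]
    exact h.sorted x y hxy (by omega) hdiv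

/-- The left head precedes the rest of its own part because that part is sorted, and the rest of the
right part by transitivity through the right head. `MergeInv.takeRight` is the mirror image. -/
theorem MergeInv.takeLeft (hw : 0 < w) (h : MergeInv r m w k i mid j hi a b)
    (htrans : ∀ x y z, r x y → r y z → r x z) (hi' : i < mid) (hr : j < hi → r (a i) (a j)) :
    MergeInv r m w (k + 1) (i + 1) mid j hi a (Function.update b k (a i)) := by
  have hsort := h.sorted_update hw (by have := h.k_eq; have := h.j_le; omega) (.inl ⟨le_rfl, hi'⟩)
  obtain ⟨h1, h2, h3, h4, h5, h6, h7, ⟨lo, h8, h9, h10, h11, h12⟩, h13, h14⟩ := h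
  refine ⟨by omega, h2, h3, h4, by omega, ?_, hsort, ⟨lo, h8, by omega, h10, h11, ?_⟩,
    fun x y hx => h13 x y (by omega), h14⟩
  · rw [map_range_succ_update, h6, Multiset.range_succ, Multiset.map_cons, Multiset.cons_add]
  · intro x y hx hxk hy
    by_cases hxk' : x = k
    · subst hxk'
      rw [Function.update_self]
      rcases hy with hy | hy
      · exact h13 i y le_rfl (by omega) hy.2
      · rcases Nat.lt_or_ge j y with hjy | hjy
        · exact htrans _ _ _ (hr (by omega)) (h14 j y le_rfl hjy hy.2)
        · obtain rfl : j = y := by omega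
          exact hr hy.2
    · rw [Function.update_of_ne hxk']
      exact h12 x y hx (by omega) (by omega)

theorem MergeInv.takeRight (hw : 0 < w) (h : MergeInv r m w k i mid j hi a b)
    (htrans : ∀ x y z, r x y → r y z → r x z) (hj' : j < hi) (hr : i < mid → r (a j) (a i)) :
    MergeInv r m w (k + 1) i mid (j + 1) hi a (Function.update b k (a j)) := by
  have hsort := h.sorted_update hw (by have := h.k_eq; have := h.i_le; omega) (.inr ⟨le_rfl, hj'⟩)
  obtain ⟨h1, h2, h3, h4, h5, h6, h7, ⟨lo, h8, h9, h10, h11, h12⟩, h13, h14⟩ := h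
  refine ⟨h1, by omega, hj', h4, by omega, ?_, hsort, ⟨lo, h8, by omega, h10, h11, ?_⟩,
    h13, fun x y hx => h14 x y (by omega)⟩
  · rw [map_range_succ_update, h6, Nat.Ico_succ_right_eq_insert_Ico h2, Finset.insert_val_of_notMem (by simp),
      Multiset.map_cons, Multiset.add_cons]
  · intro x y hx hxk hy
    by_cases hxk' : x = k
    · subst hxk'
      rw [Function.update_self]
      rcases hy with hy | hy
      · rcases Nat.lt_or_ge i y with hiy | hiy
        · exact htrans _ _ _ (hr (by omega)) (h13 i y le_rfl hiy hy.2)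
        · obtain rfl : i = y := by omega
          exact hr hy.2
      · exact h14 j y le_rfl (by omega) hy.2
    · rw [Function.update_of_ne hxk']
      exact h12 x y hx (by omega) (by omega)

/-- When `m` entries are written, `k_eq` leaves no room for unread ones, so the consumed entries are
all of `a`. -/
theorem MergeInv.final (h : MergeInv r m w m i mid j hi a b) :
    (Multiset.range m).map b = (Multiset.range m).map a ∧
      ∀ x y, x < y → y < m → x / (2 * w) = y / (2 * w) → r (b x) (b y) := by
  refine ⟨?_, h.sorted⟩
  obtain ⟨h1, h2, h3, h4, h5, h6, -⟩ := h
  have e1 : i = mid := by omega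
  have e2 : j = m := by omega
  subst e1 e2
  rw [h6, ← Multiset.map_add, range_add_Ico h2]

end Merge

/-! ## Sorting the edges -/

namespace Description

variable {σ : Type} (d : Description σ)

/-- `src`, `tgt`, `fin` and `lab` are the input arrays as total functions of the index, so programs
and combinatorial arguments speak about the same functions without bound proofs. -/
def src (k : ℕ) : ℕ := d.toMemory.num 0 k

def tgt (k : ℕ) : ℕ := d.toMemory.num 1 k

def fin (i : ℕ) : ℕ := d.toMemory.num 2 i

/-- The label of the `k`-th edge; `⊥` if there is no such edge. -/
def lab (k : ℕ) : WithBot σ := d.toMemory.char 0 k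

/-- The edges are sorted by this key. -/
def sortKey (k : ℕ) : WithBot σ ×ₗ ℕ := toLex (d.lab k, d.src k + d.tgt k)

variable {d} {k : ℕ}

theorem src_eq (h : k < d.edges.length) : d.src k = d.edges[k].1 := by
  simp [src, toMemory, h]

theorem tgt_eq (h : k < d.edges.length) : d.tgt k = d.edges[k].2.1 := by
  simp [tgt, toMemory, h]

theorem lab_eq (h : k < d.edges.length) : d.lab k = (d.edges[k].2.2 : WithBot σ) := by
  simp only [lab, toMemory, if_pos, List.getElem?_eq_getElem h]
  rfl

theorem src_lt (h : k < d.edges.length) : d.src k < d.numStates := by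
  rw [src_eq h]
  exact Fin.is_lt _

theorem tgt_lt (h : k < d.edges.length) : d.tgt k < d.numStates := by
  rw [tgt_eq h]
  exact Fin.is_lt _

theorem fin_eq (i : Fin d.numStates) : d.fin i = (d.final i).toNat := by
  simp [fin, toMemory]

end Description

/-- The memory contains the input `d`. -/
structure HasInput {σ : Type} (d : Description σ) (s : Memory σ) : Prop where
  reg0 : s.reg 0 = d.numStates
  reg1 : s.reg 1 = d.edges.length
  reg2 : s.reg 2 = d.start
  num0 : s.num 0 = d.src
  num1 : s.num 1 = d.tgt
  num2 : s.num 2 = d.fin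
  char0 : s.char 0 = d.lab

/-- In addition, the array 5 holds the numerical parts of the sorting keys of the first `k` edges, and
the arrays from 6 on are not yet used. -/
structure HasKeys {σ : Type} (d : Description σ) (k : ℕ) (s : Memory σ) : Prop
    extends HasInput d s where
  key : ∀ i < k, s.num 5 i = d.src i + d.tgt i
  unused : ∀ a, 6 ≤ a → s.num a = fun _ => 0

theorem HasInput.congr {σ : Type} {d : Description σ} {s s' : Memory σ} (h : HasInput d s)
    (hr : ∀ x < 3, s'.reg x = s.reg x) (hn : ∀ a < 3, s'.num a = s.num a)
    (hc : s'.char 0 = s.char 0) : HasInput d s' :=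
  ⟨(hr 0 (by omega)).trans h.reg0, (hr 1 (by omega)).trans h.reg1, (hr 2 (by omega)).trans h.reg2,
    (hn 0 (by omega)).trans h.num0, (hn 1 (by omega)).trans h.num1, (hn 2 (by omega)).trans h.num2,
    hc.trans h.char0⟩

theorem HasKeys.congr {σ : Type} {d : Description σ} {k : ℕ} {s s' : Memory σ} (h : HasKeys d k s)
    (hr : ∀ x < 3, s'.reg x = s.reg x) (hn : ∀ a, a ≠ 3 → a ≠ 4 → s'.num a = s.num a)
    (hc : s'.char 0 = s.char 0) : HasKeys d k s' where
  toHasInput := h.toHasInput.congr hr (fun a ha => hn a (by omega) (by omega)) hc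
  key := by
    rw [hn 5 (by omega) (by omega)]
    exact h.key
  unused a ha := by
    rw [hn a (by omega) (by omega)]
    exact h.unused a ha

/-- The identity permutation goes to array 3, the numerical keys go to array 5. -/
def initLoop : Program :=
  .seq (.set 4 (.const 0)) <| forLoop 4 1 <|
    .seq (.store 3 (.reg 4) (.reg 4)) <|
    .seq (.load 5 0 (.reg 4)) <|
    .seq (.load 6 1 (.reg 4)) <|
    .seq (.arith 5 .add (.reg 5) (.reg 6)) <|
    .store 5 (.reg 4) (.reg 5)

/-- Compare the edges given by the registers 10 and 11; the result goes to register 9. -/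
def compareEdges : Program :=
  .ite (.charLE 0 (.reg 10) 0 (.reg 11))
    (.ite (.charLE 0 (.reg 11) 0 (.reg 10))
      (.seq (.load 12 5 (.reg 10)) <|
        .seq (.load 13 5 (.reg 11)) <|
        .ite (.le (.reg 12) (.reg 13)) (.set 9 (.const 1)) (.set 9 (.const 0)))
      (.set 9 (.const 1)))
    (.set 9 (.const 0))

/-- Put the next block boundaries into the registers 5 to 8. -/
def nextBlocks : Program :=
  .ite (.eq (.reg 4) (.reg 8))
    (.seq (.set 5 (.reg 8)) <|
      .seq (.arith 6 .add (.reg 8) (.reg 3)) <|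
      .seq (.ite (.lt (.reg 1) (.reg 6)) (.set 6 (.reg 1)) .skip) <|
      .seq (.set 7 (.reg 6)) <|
      .seq (.arith 8 .add (.reg 6) (.reg 3)) <|
      .ite (.lt (.reg 1) (.reg 8)) (.set 8 (.reg 1)) .skip)
    .skip

/-- Decide from which of the two blocks the next entry is taken. -/
def chooseSide : Program :=
  .ite (.lt (.reg 5) (.reg 6))
    (.ite (.lt (.reg 7) (.reg 8))
      (.seq (.load 10 3 (.reg 5)) <| .seq (.load 11 3 (.reg 7)) compareEdges)
      (.set 9 (.const 1)))
    (.set 9 (.const 0))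

/-- Copy the next entry. -/
def takeEntry : Program :=
  .ite (.eq (.reg 9) (.const 1))
    (.seq (.load 10 3 (.reg 5)) <|
      .seq (.store 4 (.reg 4) (.reg 10)) <| .arith 5 .add (.reg 5) (.const 1))
    (.seq (.load 10 3 (.reg 7)) <|
      .seq (.store 4 (.reg 4) (.reg 10)) <| .arith 7 .add (.reg 7) (.const 1))

def mergePass : Program :=
  .seq (.set 4 (.const 0)) <|
  .seq (.set 5 (.const 0)) <|
  .seq (.set 6 (.const 0)) <|
  .seq (.set 7 (.const 0)) <|
  .seq (.set 8 (.const 0)) <|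
  forLoop 4 1 (.seq nextBlocks (.seq chooseSide takeEntry))

def copyBack : Program :=
  .seq (.set 4 (.const 0)) <|
  forLoop 4 1 (.seq (.load 5 4 (.reg 4)) (.store 3 (.reg 4) (.reg 5)))

/-- Merge sort of array 3, using array 4. -/
def sortLoop : Program :=
  .seq (.set 3 (.const 1)) <|
  .while (.lt (.reg 3) (.reg 1)) <|
    .seq mergePass (.seq copyBack (.arith 3 .add (.reg 3) (.reg 3)))

/-! ### Correctness and cost of the merge sort -/

section Sorting

variable {σ : Type} [LinearOrder σ] {d : Description σ} {W : ℕ} {s : Memory σ}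

/-- The order of the edges. -/
def keyLE (d : Description σ) (x y : ℕ) : Prop := d.sortKey x ≤ d.sortKey y

/-- A cell is read as an element of `WithBot σ`. The test fails on empty cells although `⊥ ≤ ⊥`, so
both indices must be those of actual edges. -/
theorem charLE_holds {b₁ b₂ : ℕ} {o₁ o₂ : Operand} {x y : ℕ} (h₁ : s.char b₁ (o₁.eval s) = d.lab x)
    (h₂ : s.char b₂ (o₂.eval s) = d.lab y) (hx : x < d.edges.length) (hy : y < d.edges.length) :
    (Test.charLE b₁ o₁ b₂ o₂).Holds s ↔ d.lab x ≤ d.lab y := by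
  rw [Description.lab_eq hx] at h₁ ⊢
  rw [Description.lab_eq hy] at h₂ ⊢
  rw [WithBot.coe_le_coe, Test.Holds, h₁, h₂]
  constructor
  · rintro ⟨a, ha, a', ha', h⟩
    obtain rfl := Option.some_injective _ ha
    obtain rfl := Option.some_injective _ ha'
    exact h
  · intro h
    exact ⟨_, rfl, _, rfl, h⟩

/-- Queries in both directions detect equality of labels, and only then are the numerical keys
compared. -/
theorem wp_compareEdges (hW : 4 * d.edges.length + 8 ≤ W) (hn : d.numStates ≤ d.edges.length + 1)
    (h : HasKeys d d.edges.length s)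
    {x y : ℕ} (hx : x < d.edges.length) (hy : y < d.edges.length) (h10 : s.reg 10 = x)
    (h11 : s.reg 11 = y) {Post : Memory σ → Prop}
    (hP : ∀ s', (s'.reg 9 = 1 ↔ keyLE d x y) → (∀ z ≤ 8, s'.reg z = s.reg z) → s'.num = s.num →
      s'.char = s.char → Post s') : wp W compareEdges Post s := by
  have c1 := charLE_holds (s := s) (d := d) (b₁ := 0) (b₂ := 0) (o₁ := .reg 10) (o₂ := .reg 11)
    (by simp [Operand.eval, h.char0, h10]; rfl) (by simp [Operand.eval, h.char0, h11]; rfl) hx hy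
  have c2 := charLE_holds (s := s) (d := d) (b₁ := 0) (b₂ := 0) (o₁ := .reg 11) (o₂ := .reg 10)
    (by simp [Operand.eval, h.char0, h11]; rfl) (by simp [Operand.eval, h.char0, h10]; rfl) hy hx
  have kx := h.key x hx
  have ky := h.key y hy
  have b1 := Description.src_lt hx
  have b2 := Description.tgt_lt hx
  have b3 := Description.src_lt hy
  have b4 := Description.tgt_lt hy
  have hle : keyLE d x y ↔ d.lab x < d.lab y ∨
      d.lab x = d.lab y ∧ d.src x + d.tgt x ≤ d.src y + d.tgt y := Prod.Lex.le_iff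
  simp only [compareEdges, wp, c1, c2]
  simp only [Operand.eval, Test.Holds, Memory.setReg_num, Memory.setReg_reg, h10, h11, kx]
  refine ⟨fun h1 => ⟨fun h2 => ⟨by omega, by simp only [reduceIte, Nat.reduceEqDiff]; omega, ?_, ?_⟩,
    fun h2 => ⟨by omega, hP _ ?_ ?_ rfl rfl⟩⟩, fun h1 => ⟨by omega, hP _ ?_ ?_ rfl rfl⟩⟩
  · intro h3
    refine ⟨by omega, hP _ ?_ ?_ rfl rfl⟩
    · have := le_antisymm h1 h2
      simp [hle, this] at h3 ⊢
      omega
    · intro z hz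
      simp [show z ≠ 9 by omega, show z ≠ 12 by omega, show z ≠ 13 by omega]
  · intro h3
    refine ⟨by omega, hP _ ?_ ?_ rfl rfl⟩
    · have := le_antisymm h1 h2
      simp [hle, this] at h3 ⊢
      omega
    · intro z hz
      simp [show z ≠ 9 by omega, show z ≠ 12 by omega, show z ≠ 13 by omega]
  · simpa [hle] using Or.inl (lt_of_not_ge h2)
  · intro z hz
    simp [show z ≠ 9 by omega]
  · have := lt_of_not_ge h1
    simp [hle, this.not_gt, this.ne']
  · intro z hz
    simp [show z ≠ 9 by omega]

theorem runs_initLoop (hW : 4 * d.edges.length + 8 ≤ W) (hn : d.numStates ≤ d.edges.length + 1) :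
    Runs W initLoop d.toMemory (7 * d.edges.length + 2) fun s =>
      HasKeys d d.edges.length s ∧ ∀ i < d.edges.length, s.num 3 i = i := by
  refine (Runs.seq (T := 1) (T' := 7 * d.edges.length + 1) ?_).mono (by omega) fun _ h => h
  refine Runs.mono (Runs.of_wp (p := .set 4 (.const 0))
    (Post := fun s => s = d.toMemory.setReg 4 0) ?_) le_rfl ?_
  · simp [wp, Operand.eval]
  rintro s rfl
  refine (Runs.forLoop (W := W) (x := 4) (y := 1) (by omega) (fun i s => HasKeys d i s ∧ ∀ j < i, s.num 3 j = j)
    d.edges.length (by omega) ?_ (i := 0) (Nat.zero_le _) (by simp) ?_ ?_).mono ?_ ?_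
  · rintro i s hi h4 h1 ⟨hk, h3⟩
    have b1 := Description.src_lt hi
    have b2 := Description.tgt_lt hi
    simp only [wp, Operand.eval, ArithOp.eval, Memory.setReg_num, Memory.setReg_reg,
      Memory.setNum_num, Memory.setNum_reg, h4, hk.num0, hk.num1, reduceIte, Nat.reduceEqDiff]
    refine ⟨by omega, by omega, by omega, by omega, by omega, trivial, h1, ?_, ?_⟩
    · refine ⟨hk.toHasInput.congr ?_ ?_ rfl, ?_, ?_⟩
      · intro x hx
        simp [show x ≠ 4 by omega, show x ≠ 5 by omega, show x ≠ 6 by omega]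
      · intro a ha
        simp [show a ≠ 3 by omega, show a ≠ 5 by omega]
      · intro j hj
        simp only [Memory.setReg_num, Memory.setNum_num, reduceIte, Function.update_apply, Nat.reduceEqDiff]
        split_ifs with hij
        · rw [hij]
        · exact hk.key j (by omega)
      · intro a ha
        simp [show a ≠ 3 by omega, show a ≠ 5 by omega, hk.unused a ha]
    · intro j hj
      simp only [Function.update_apply]
      split_ifs with hij
      · exact hij.symm
      · exact h3 j (by omega)
  · simp [Description.toMemory]
  · refine ⟨⟨⟨rfl, rfl, rfl, rfl, rfl, rfl, rfl⟩, by intros; omega, ?_⟩, by intros; omega⟩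
    intro a ha
    funext k
    simp [Description.toMemory, show a ≠ 0 by omega, show a ≠ 1 by omega, show a ≠ 2 by omega]
  · simp only [Program.size]
    omega
  · rintro s ⟨-, h⟩
    exact h

/-- The invariant of a merge pass. -/
structure PassInv (d : Description σ) (w : ℕ) (a : ℕ → ℕ) (k : ℕ) (s : Memory σ) : Prop where
  keys : HasKeys d d.edges.length s
  reg3 : s.reg 3 = w
  num3 : s.num 3 = a
  merge : MergeInv (keyLE d) d.edges.length w k (s.reg 5) (s.reg 6) (s.reg 7) (s.reg 8) a (s.num 4)
  le : k ≤ s.reg 8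

/-- Its purpose is the strict inequality `k < s'.reg 8`: afterwards at least one of the two parts is
nonempty. -/
theorem wp_nextBlocks (hW : 4 * d.edges.length + 8 ≤ W) {w : ℕ} {a : ℕ → ℕ} {k : ℕ}
    (hw : 0 < w) (hwm : w < d.edges.length) (hk : k < d.edges.length)
    (ha : ∀ x y, x < y → y < d.edges.length → x / w = y / w → keyLE d (a x) (a y))
    (h : PassInv d w a k s) (h4 : s.reg 4 = k) {Post : Memory σ → Prop}
    (hP : ∀ s', PassInv d w a k s' → k < s'.reg 8 → s'.reg 4 = k → Post s') :
    wp W nextBlocks Post s := by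
  obtain ⟨h1, h2, h3, h5, h6⟩ := h
  have h8 := h5.hi_le
  have hr1 := h1.reg1
  simp only [nextBlocks, wp, Operand.eval, Test.Holds, ArithOp.eval, Memory.setReg_reg, h4, h2, hr1,
    reduceIte, Nat.reduceEqDiff]
  refine ⟨fun hc => ⟨by omega, by omega, ?_, ?_⟩, fun hc => hP s ⟨h1, h2, h3, h5, h6⟩ (by omega) h4⟩
  all_goals
    intro hc2
    have hres := h5.reset hw ha hc hk
  -- If the left block is cut off at the end of the array, the right block is empty and is cut off
  -- as well.
  · have e1 : min (s.reg 8 + w) d.edges.length = d.edges.length := by omega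
    have e2 : min (d.edges.length + w) d.edges.length = d.edges.length := by omega
    rw [e1, e2] at hres
    refine ⟨by omega, by omega, by omega, fun _ => ⟨by omega, hP _ ⟨h1.congr ?_ ?_ rfl, ?_, ?_, ?_, ?_⟩ ?_ ?_⟩,
      fun hc3 => absurd ?_ hc3⟩
    · intro x hx
      simp [show x ≠ 5 by omega, show x ≠ 6 by omega, show x ≠ 7 by omega, show x ≠ 8 by omega]
    · simp
    · simp [h2]
    · simp [h3]
    · simpa using hres
    · simp; omega
    · simp; omega
    · simp [h4]
    · omega
  · have e1 : min (s.reg 8 + w) d.edges.length = s.reg 8 + w := by omega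
    rw [e1] at hres
    refine ⟨by omega, by omega, fun hc3 => ?_, fun hc3 => ?_⟩
    · have e2 : min (s.reg 8 + w + w) d.edges.length = d.edges.length := by omega
      rw [e2] at hres
      refine ⟨by omega, hP _ ⟨h1.congr ?_ ?_ rfl, ?_, ?_, ?_, ?_⟩ ?_ ?_⟩
      · intro x hx
        simp [show x ≠ 5 by omega, show x ≠ 6 by omega, show x ≠ 7 by omega, show x ≠ 8 by omega]
      · simp
      · simp [h2]
      · simp [h3]
      · simpa using hres
      · simp; omega
      · simp; omega
      · simp [h4]
    · have e2 : min (s.reg 8 + w + w) d.edges.length = s.reg 8 + w + w := by omega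
      rw [e2] at hres
      refine hP _ ⟨h1.congr ?_ ?_ rfl, ?_, ?_, ?_, ?_⟩ ?_ ?_
      · intro x hx
        simp [show x ≠ 5 by omega, show x ≠ 6 by omega, show x ≠ 7 by omega, show x ≠ 8 by omega]
      · simp
      · simp [h2]
      · simp [h3]
      · simpa using hres
      · simp; omega
      · simp; omega
      · simp [h4]

theorem wp_chooseSide (hW : 4 * d.edges.length + 8 ≤ W) (hn : d.numStates ≤ d.edges.length + 1)
    {w : ℕ} {a : ℕ → ℕ} {k : ℕ} (ha : ∀ x < d.edges.length, a x < d.edges.length)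
    (h : PassInv d w a k s) (hk : k < s.reg 8) {Post : Memory σ → Prop}
    (hP : ∀ s', PassInv d w a k s' → k < s'.reg 8 → s'.reg 4 = s.reg 4 →
      (s'.reg 9 = 1 → s'.reg 5 < s'.reg 6 ∧
        (s'.reg 7 < s'.reg 8 → keyLE d (a (s'.reg 5)) (a (s'.reg 7)))) →
      (s'.reg 9 ≠ 1 → s'.reg 7 < s'.reg 8 ∧
        (s'.reg 5 < s'.reg 6 → keyLE d (a (s'.reg 7)) (a (s'.reg 5)))) → Post s') :
    wp W chooseSide Post s := by
  have hM := h.merge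
  have m1 := hM.i_le
  have m2 := hM.mid_le
  have m3 := hM.j_le
  have m4 := hM.hi_le
  have m5 := hM.k_eq
  -- The choice only touches registers above 8, so the invariant carries over whatever the outcome.
  have key : ∀ s' : Memory σ, (∀ z ≤ 8, s'.reg z = s.reg z) → s'.num = s.num → s'.char = s.char →
      (s'.reg 9 = 1 → s.reg 5 < s.reg 6 ∧
        (s.reg 7 < s.reg 8 → keyLE d (a (s.reg 5)) (a (s.reg 7)))) →
      (s'.reg 9 ≠ 1 → s.reg 7 < s.reg 8 ∧
        (s.reg 5 < s.reg 6 → keyLE d (a (s.reg 7)) (a (s.reg 5)))) → Post s' := by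
    intro s' e1 e2 e3 e4 e5
    rw [← e1 5 (by omega), ← e1 6 (by omega), ← e1 7 (by omega), ← e1 8 (by omega)] at e4 e5
    refine hP s' ⟨h.keys.congr (fun x hx => e1 x (by omega)) (fun x _ _ => by rw [e2]) (by rw [e3]), ?_, ?_, ?_, ?_⟩
      ?_ (e1 4 (by omega)) e4 e5
    · rw [e1 3 (by omega), h.reg3]
    · rw [e2, h.num3]
    · rw [e1 5 (by omega), e1 6 (by omega), e1 7 (by omega), e1 8 (by omega), e2]
      exact hM
    · rw [e1 8 (by omega)]
      exact h.le
    · rw [e1 8 (by omega)]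
      exact hk
  simp only [chooseSide, wp, Operand.eval, Test.Holds, Memory.setReg_reg, Memory.setReg_num, h.num3,
    reduceIte, Nat.reduceEqDiff]
  refine ⟨fun c1 => ⟨fun c2 => ?_, fun c2 => ?_⟩, fun c1 => ?_⟩
  · have a5 := ha (s.reg 5) (by omega)
    have a7 := ha (s.reg 7) (by omega)
    refine ⟨by omega, by omega, ?_⟩
    refine wp_compareEdges hW hn ?_ a5 a7 ?_ ?_ ?_
    · refine h.keys.congr (fun x hx => ?_) (by simp) rfl
      simp [show x ≠ 10 by omega, show x ≠ 11 by omega]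
    · simp
    · simp
    · intro s' e1 e2 e3 e4
      refine key s' ?_ e3 e4 ?_ ?_
      · intro z hz
        rw [e2 z hz]
        simp [show z ≠ 10 by omega, show z ≠ 11 by omega]
      · intro h9
        exact ⟨c1, fun _ => e1.1 h9⟩
      · intro h9
        exact ⟨c2, fun _ => (le_total _ _).resolve_left fun hle => h9 (e1.2 hle)⟩
  · refine ⟨by omega, key _ ?_ rfl rfl ?_ ?_⟩
    · intro z hz
      simp [show z ≠ 9 by omega]
    · exact fun _ => ⟨c1, fun h => absurd h c2⟩
    · simp
  · refine ⟨by omega, key _ ?_ rfl rfl ?_ ?_⟩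
    · intro z hz
      simp [show z ≠ 9 by omega]
    · simp
    · exact fun _ => ⟨by omega, fun h => absurd h c1⟩

theorem wp_takeEntry (hW : 4 * d.edges.length + 8 ≤ W)
    {w : ℕ} (hw : 0 < w) {a : ℕ → ℕ} {k : ℕ} (ha : ∀ x < d.edges.length, a x < d.edges.length)
    (h : PassInv d w a k s) (hk : k < s.reg 8) (h4 : s.reg 4 = k)
    (hL : s.reg 9 = 1 → s.reg 5 < s.reg 6 ∧
        (s.reg 7 < s.reg 8 → keyLE d (a (s.reg 5)) (a (s.reg 7))))
    (hR : s.reg 9 ≠ 1 → s.reg 7 < s.reg 8 ∧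
        (s.reg 5 < s.reg 6 → keyLE d (a (s.reg 7)) (a (s.reg 5)))) :
    wp W takeEntry (fun s' => s'.reg 4 = k ∧ s'.reg 1 = d.edges.length ∧
      PassInv d w a (k + 1) (s'.setReg 4 (k + 1))) s := by
  have hM := h.merge
  have m1 := hM.i_le
  have m2 := hM.mid_le
  have m3 := hM.j_le
  have m4 := hM.hi_le
  have htrans : ∀ x y z, keyLE d x y → keyLE d y z → keyLE d x z := fun _ _ _ => le_trans
  simp only [takeEntry, wp, Operand.eval, ArithOp.eval, Test.Holds, Memory.setReg_reg,
    Memory.setNum_reg, h.num3, reduceIte, Nat.reduceEqDiff, h4]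
  refine ⟨fun c => ?_, fun c => ?_⟩
  · obtain ⟨l1, l2⟩ := hL c
    have := ha (s.reg 5) (by omega)
    refine ⟨by omega, by omega, by omega, trivial, h.keys.reg1, h.keys.congr ?_ ?_ rfl, ?_, ?_, ?_, ?_⟩
    · intro x hx
      simp [show x ≠ 4 by omega, show x ≠ 5 by omega, show x ≠ 10 by omega]
    · intro x hx hx'
      simp [hx']
    · simp [h.reg3]
    · simp [h.num3]
    · simpa using hM.takeLeft hw htrans l1 l2
    · simp; omega
  · obtain ⟨l1, l2⟩ := hR c
    have := ha (s.reg 7) (by omega)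
    refine ⟨by omega, by omega, by omega, trivial, h.keys.reg1, h.keys.congr ?_ ?_ rfl, ?_, ?_, ?_, ?_⟩
    · intro x hx
      simp [show x ≠ 4 by omega, show x ≠ 7 by omega, show x ≠ 10 by omega]
    · intro x hx hx'
      simp [hx']
    · simp [h.reg3]
    · simp [h.num3]
    · simpa using hM.takeRight hw htrans l1 l2
    · simp; omega

theorem lt_of_map_range {m : ℕ} {a : ℕ → ℕ} (h : (Multiset.range m).map a = Multiset.range m) :
    ∀ x < m, a x < m := by
  intro x hx
  have : a x ∈ (Multiset.range m).map a :=
    Multiset.mem_map_of_mem a (Multiset.mem_range.2 hx)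
  rwa [h, Multiset.mem_range] at this

/-- The result of sorting blocks of length `w`. -/
structure SortInv (d : Description σ) (w : ℕ) (s : Memory σ) : Prop where
  keys : HasKeys d d.edges.length s
  reg3 : s.reg 3 = w
  perm : (Multiset.range d.edges.length).map (s.num 3) = Multiset.range d.edges.length
  sorted : ∀ x y, x < y → y < d.edges.length → x / w = y / w → keyLE d (s.num 3 x) (s.num 3 y)

theorem runs_mergePass (hW : 4 * d.edges.length + 8 ≤ W) (hn : d.numStates ≤ d.edges.length + 1)
    {w : ℕ} (hw : 0 < w) (hwm : w < d.edges.length) (h : SortInv d w s) :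
    Runs W mergePass s (40 * d.edges.length + 6) fun s' =>
      HasKeys d d.edges.length s' ∧ s'.reg 3 = w ∧
      (Multiset.range d.edges.length).map (s'.num 4) = Multiset.range d.edges.length ∧
      ∀ x y, x < y → y < d.edges.length → x / (2 * w) = y / (2 * w) →
        keyLE d (s'.num 4 x) (s'.num 4 y) := by
  obtain ⟨h1, h2, h3, h4⟩ := h
  have ha := lt_of_map_range h3
  refine (Runs.seq (T := 1) (T' := 40 * d.edges.length + 5) ?_).mono (by omega) fun _ h => h
  refine (Runs.of_wp (p := .set 4 (.const 0)) ⟨Nat.zero_le _, ?_⟩)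
  refine (Runs.seq (T := 1) (T' := 40 * d.edges.length + 4) ?_).mono (by omega) fun _ h => h
  refine (Runs.of_wp (p := .set 5 (.const 0)) ⟨Nat.zero_le _, ?_⟩)
  refine (Runs.seq (T := 1) (T' := 40 * d.edges.length + 3) ?_).mono (by omega) fun _ h => h
  refine (Runs.of_wp (p := .set 6 (.const 0)) ⟨Nat.zero_le _, ?_⟩)
  refine (Runs.seq (T := 1) (T' := 40 * d.edges.length + 2) ?_).mono (by omega) fun _ h => h
  refine (Runs.of_wp (p := .set 7 (.const 0)) ⟨Nat.zero_le _, ?_⟩)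
  refine (Runs.seq (T := 1) (T' := 40 * d.edges.length + 1) ?_).mono (by omega) fun _ h => h
  refine (Runs.of_wp (p := .set 8 (.const 0)) ⟨Nat.zero_le _, ?_⟩)
  refine (Runs.forLoop (W := W) (x := 4) (y := 1) (by omega) (PassInv d w (s.num 3)) d.edges.length (by omega) ?_
    (i := 0) (Nat.zero_le _) (by simp [Operand.eval]) (by simp [h1.reg1]) ?_).mono ?_ ?_
  · intro k s' hk e4 e1 hI
    refine wp_nextBlocks hW hw hwm hk h4 hI e4 fun s'' hI' hk' e4' => ?_
    refine wp_chooseSide hW hn ha hI' hk' fun s3 hI3 hk3 e43 l r => ?_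
    exact wp_takeEntry hW hw ha hI3 hk3 (e43.trans e4') l r
  · refine ⟨h1.congr ?_ (by simp) rfl, ?_, by simp, ?_, Nat.zero_le _⟩
    · intro x hx
      simp [show x ≠ 4 by omega, show x ≠ 5 by omega, show x ≠ 6 by omega, show x ≠ 7 by omega,
        show x ≠ 8 by omega]
    · simp [h2]
    · simpa [Operand.eval] using MergeInv.init
  · simp only [Program.size, nextBlocks, chooseSide, takeEntry, compareEdges]
    omega
  · rintro s' ⟨-, hI⟩
    obtain ⟨f1, f2⟩ := hI.merge.final
    exact ⟨hI.keys, hI.reg3, f1.trans h3, f2⟩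

theorem runs_copyBack (hW : 4 * d.edges.length + 8 ≤ W) {w : ℕ} (h1 : HasKeys d d.edges.length s)
    (h2 : s.reg 3 = w)
    (h3 : (Multiset.range d.edges.length).map (s.num 4) = Multiset.range d.edges.length)
    (h4 : ∀ x y, x < y → y < d.edges.length → x / (2 * w) = y / (2 * w) →
        keyLE d (s.num 4 x) (s.num 4 y)) :
    Runs W copyBack s (4 * d.edges.length + 2) fun s' =>
      HasKeys d d.edges.length s' ∧ s'.reg 3 = w ∧
      (Multiset.range d.edges.length).map (s'.num 3) = Multiset.range d.edges.length ∧
      ∀ x y, x < y → y < d.edges.length → x / (2 * w) = y / (2 * w) →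
        keyLE d (s'.num 3 x) (s'.num 3 y) := by
  have ha := lt_of_map_range h3
  refine (Runs.seq (T := 1) (T' := 4 * d.edges.length + 1) ?_).mono (by omega) fun _ h => h
  refine (Runs.of_wp (p := .set 4 (.const 0)) ⟨Nat.zero_le _, ?_⟩)
  refine (Runs.forLoop (W := W) (x := 4) (y := 1) (by omega) (fun i s' => HasKeys d d.edges.length s' ∧ s'.reg 3 = w ∧
      s'.num 4 = s.num 4 ∧ ∀ j < i, s'.num 3 j = s.num 4 j) d.edges.length (by omega) ?_
    (i := 0) (Nat.zero_le _) (by simp [Operand.eval]) (by simp [h1.reg1]) ?_).mono ?_ ?_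
  · rintro i s' hi e4 e1 ⟨g1, g2, g3, g4⟩
    have := ha i hi
    simp only [wp, Operand.eval, Memory.setReg_num, Memory.setReg_reg, Memory.setNum_num,
      Memory.setNum_reg, e4, g3, reduceIte, Nat.reduceEqDiff]
    refine ⟨by omega, by omega, trivial, e1, g1.congr ?_ ?_ rfl, g2, trivial, ?_⟩
    · intro x hx
      simp [show x ≠ 4 by omega, show x ≠ 5 by omega]
    · intro x hx hx'
      simp [hx]
    · intro j hj
      simp only [Function.update_apply]
      split_ifs with hij
      · rw [hij]
      · exact g4 j (by omega)
  · refine ⟨h1.congr ?_ (by simp) rfl, by simp [h2], by simp, by intros; omega⟩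
    intro x hx
    simp [show x ≠ 4 by omega]
  · simp only [Program.size]
    omega
  · rintro s' ⟨-, g1, g2, g3, g4⟩
    refine ⟨g1, g2, ?_, ?_⟩
    · exact (Multiset.map_congr rfl fun x hx => g4 x (Multiset.mem_range.1 hx)).trans h3
    · intro x y hxy hy hd
      rw [g4 x (by omega), g4 y hy]
      exact h4 x y hxy hy hd

/-- Each pass doubles the length of the sorted blocks, so after `i` passes it is `2 ^ i`, and
`Nat.clog 2 |E|` passes of linear cost suffice. -/
theorem runs_sortLoop (hW : 4 * d.edges.length + 8 ≤ W) (hn : d.numStates ≤ d.edges.length + 1)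
    (h : HasKeys d d.edges.length s) (h3 : ∀ i < d.edges.length, s.num 3 i = i) :
    Runs W sortLoop s (Nat.clog 2 d.edges.length * (44 * d.edges.length + 10) + 2) fun s' =>
      HasKeys d d.edges.length s' ∧
      (Multiset.range d.edges.length).map (s'.num 3) = Multiset.range d.edges.length ∧
      ∀ x y, x < y → y < d.edges.length → keyLE d (s'.num 3 x) (s'.num 3 y) := by
  refine (Runs.seq (T := 1) (T' := Nat.clog 2 d.edges.length * (44 * d.edges.length + 10) + 1)
    ?_).mono (by omega) fun _ h => h
  refine (Runs.of_wp (p := .set 3 (.const 1)) ⟨by simp only [Operand.eval]; omega, ?_⟩)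
  refine (Runs.whileLoop (fun i s => SortInv d (2 ^ i) s) (Nat.clog 2 d.edges.length)
    (44 * d.edges.length + 9) ?_ (i := 0) (Nat.zero_le _) ?_).mono ?_ ?_
  · intro i s' hs' hc
    simp only [Test.Holds, Operand.eval, hs'.reg3, hs'.keys.reg1] at hc
    refine ⟨(Nat.lt_clog_iff_pow_lt one_lt_two).2 hc, ?_⟩
    refine (Runs.seq (T := 40 * d.edges.length + 6) (T' := 4 * d.edges.length + 3)
      ?_).mono (by omega) fun _ h => h
    refine (runs_mergePass hW hn (by positivity) hc hs').mono le_rfl ?_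
    rintro s₁ ⟨g1, g2, g3, g4⟩
    refine (Runs.seq (T := 4 * d.edges.length + 2) (T' := 1) ?_).mono (by omega) fun _ h => h
    refine (runs_copyBack hW g1 g2 g3 g4).mono le_rfl ?_
    rintro s₂ ⟨k1, k2, k3, k4⟩
    refine Runs.of_wp (p := .arith 3 .add (.reg 3) (.reg 3)) ⟨?_, ?_⟩
    · simp only [Operand.eval, ArithOp.eval, k2]
      omega
    · refine ⟨k1.congr ?_ (by simp) rfl, ?_, k3, ?_⟩
      · intro x hx
        simp [show x ≠ 3 by omega]
      · simp only [Operand.eval, ArithOp.eval, Memory.setReg_reg, k2, reduceIte]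
        ring
      · rw [pow_succ, mul_comm]
        exact k4
  · refine ⟨h.congr ?_ (by simp) rfl, ?_, ?_, ?_⟩
    · intro x hx
      simp [show x ≠ 3 by omega]
    · simp [Operand.eval]
    · conv_rhs => rw [← Multiset.map_id (Multiset.range d.edges.length)]
      exact Multiset.map_congr rfl fun x hx => h3 x (Multiset.mem_range.1 hx)
    · intro x y hxy _ hd
      simp only [pow_zero, Nat.div_one] at hd
      omega
  · simp
  · rintro s' ⟨i, -, hI, hc⟩
    simp only [Test.Holds, Operand.eval, hI.reg3, hI.keys.reg1, not_lt] at hc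
    refine ⟨hI.keys, hI.perm, fun x y hxy hy => hI.sorted x y hxy hy ?_⟩
    -- The block length now reaches the number of edges, so all indices lie in block 0.
    rw [Nat.div_eq_of_lt (by omega), Nat.div_eq_of_lt (by omega)]

end Sorting

/-! ## The boundaries between the classes -/

/-- The edges `u k → v k` with labels `c k`, for `k < m`, of a Wheeler automaton with the states
`0, …, n - 1`, sorted by their labels, and edges with the same label by their end points. -/
structure SortedEdges {τ : Type} [LinearOrder τ] (n m : ℕ) (u v : ℕ → ℕ) (c : ℕ → τ) : Prop where
  src_lt : ∀ k < m, u k < n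
  tgt_lt : ∀ k < m, v k < n
  lab_mono : ∀ k k', k ≤ k' → k' < m → c k ≤ c k'
  src_mono : ∀ k k', k ≤ k' → k' < m → c k = c k' → u k ≤ u k'
  tgt_mono : ∀ k k', k ≤ k' → k' < m → c k = c k' → v k ≤ v k'
  lab_le : ∀ k k', k < m → k' < m → v k < v k' → c k ≤ c k'
  incoming : ∀ j, 0 < j → j < n → ∃ k < m, v k = j

/-- The edges `k` and `k + 1` have the same label, and their sources are equal or adjacent. -/
def Linked {τ : Type} [LE τ] (u : ℕ → ℕ) (c : ℕ → τ) (k : ℕ) : Prop :=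
  c (k + 1) ≤ c k ∧ u (k + 1) ≤ u k + 1

/-- The first states of the classes of the maximum Wheeler autobisimulation (and some further numbers
that are not states). -/
inductive Boundary {τ : Type} [LE τ] (n m : ℕ) (u v : ℕ → ℕ) (c : ℕ → τ) (fin : ℕ → ℕ) : ℕ → Prop
  | zero : Boundary n m u v c fin 0
  | first (h : 0 < m) : Boundary n m u v c fin (u 0)
  | last (h : 0 < m) : Boundary n m u v c fin (u (m - 1) + 1)
  | gap_left (k : ℕ) (hk : k + 1 < m) (h : ¬ Linked u c k) : Boundary n m u v c fin (u k + 1)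
  | gap_right (k : ℕ) (hk : k + 1 < m) (h : ¬ Linked u c k) : Boundary n m u v c fin (u (k + 1))
  | final (j : ℕ) (hj : j + 1 < n) (h : fin j ≠ fin (j + 1)) : Boundary n m u v c fin (j + 1)
  | arc_left (k : ℕ) (hk : k + 1 < m) (h : Linked u c k) (hv : v k < v (k + 1))
      (hb : Boundary n m u v c fin (v (k + 1))) : Boundary n m u v c fin (u k + 1)
  | arc_right (k : ℕ) (hk : k + 1 < m) (h : Linked u c k) (hv : v k < v (k + 1))
      (hb : Boundary n m u v c fin (v (k + 1))) : Boundary n m u v c fin (u (k + 1))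

section Boundaries

variable {τ : Type} [LinearOrder τ] {n m : ℕ} {u v : ℕ → ℕ} {c : ℕ → τ} {fin : ℕ → ℕ}

theorem SortedEdges.lab_eq_of_linked (hE : SortedEdges n m u v c) {k : ℕ} (hk : k + 1 < m)
    (h : Linked u c k) : c k = c (k + 1) :=
  le_antisymm (hE.lab_mono k (k + 1) (by omega) hk) h.1

/-- Between adjacent edges with the same label no target is left out. -/
theorem SortedEdges.tgt_succ (hE : SortedEdges n m u v c) {k y : ℕ} (hk : k + 1 < m)
    (h : c k = c (k + 1)) (h1 : v k < y) (h2 : y ≤ v (k + 1)) : y = v (k + 1) := by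
  by_contra hne
  -- An omitted target is entered by some edge, whose label is squeezed between two equal labels.
  -- Sorted by target, that edge would have to stand strictly between neighbours.
  obtain ⟨k'', hk'', rfl⟩ := hE.incoming y (by omega) (by have := hE.tgt_lt _ hk; omega)
  have e1 := hE.lab_le k k'' (by omega) hk'' h1
  have e2 := hE.lab_le k'' (k + 1) hk'' hk (by omega)
  have e : c k = c k'' := le_antisymm e1 (h ▸ e2)
  rcases Nat.lt_or_ge k k'' with hlt | hge
  · have := hE.tgt_mono (k + 1) k'' hlt hk'' (h ▸ e)
    omega
  · have := hE.tgt_mono k'' k hge (by omega) e.symm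
    omega

/-- Every state is entered from at most one pair of adjacent edges with different targets. -/
theorem SortedEdges.arc_unique (hE : SortedEdges n m u v c) {k k' : ℕ} (hk : k + 1 < m)
    (hk' : k' + 1 < m) (h : Linked u c k) (h' : Linked u c k') (hv : v k < v (k + 1))
    (hv' : v k' < v (k' + 1)) (he : v (k + 1) = v (k' + 1)) : k = k' := by
  have key : ∀ k k', k + 1 < m → k' + 1 < m → Linked u c k → Linked u c k' → v k < v (k + 1) →
      v k' < v (k' + 1) → v (k + 1) = v (k' + 1) → ¬ k < k' := by
    intro k k' hk hk' h h' hv hv' he hlt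
    -- The target of `k'` is below the common target, so edge `k'`, which stands no earlier than `k
    -- + 1`, has the same label as `k + 1`. Sorting by target then gives `v (k + 1) ≤ v k'`, a
    -- contradiction.
    have e1 := hE.lab_le k' (k + 1) (by omega) hk (by omega)
    have e2 := hE.tgt_mono (k + 1) k' (by omega) (by omega)
      (le_antisymm (hE.lab_mono _ _ (by omega) (by omega)) e1)
    omega
  have h1 := key k k' hk hk' h h' hv hv' he
  have h2 := key k' k hk' hk h' h hv' hv he.symm
  omega

/-- The value `n` does occur, as the successor of the last state. The bound limits the queue of the
search to `n + 1` entries. -/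
theorem Boundary.le (hE : SortedEdges n m u v c) {x : ℕ}
    (h : Boundary n m u v c fin x) : x ≤ n := by
  induction h with
  | zero => exact Nat.zero_le _
  | first h => exact (hE.src_lt _ h).le
  | last h => exact hE.src_lt _ (by omega)
  | gap_left k hk h => exact hE.src_lt k (by omega)
  | gap_right k hk h => exact (hE.src_lt _ hk).le
  | final j hj h => exact hj.le
  | arc_left k hk h hv hb => exact hE.src_lt k (by omega)
  | arc_right k hk h hv hb => exact (hE.src_lt _ hk).le

/-- Bisimilar states are not separated by a boundary. -/
theorem Boundary.not_rel (hE : SortedEdges n m u v c) {S : ℕ → ℕ → Prop}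
    (hS : ∀ i j, S i j → S j i)
    (hforth : ∀ i k, k < m → i < n → S (u k) i →
      ∃ k' < m, u k' = i ∧ c k' = c k ∧ S (v k) (v k'))
    (hconv : ∀ i j x, S i j → i ≤ x → x + 1 ≤ j → j < n → S x (x + 1))
    (hfin : ∀ i, i + 1 < n → S i (i + 1) → fin i = fin (i + 1)) {x : ℕ}
    (h : Boundary n m u v c fin (x + 1)) (hx : x + 1 < n) : ¬ S x (x + 1) := by
  -- The index is made a variable so that the induction on `Boundary` can change `x`.
  obtain ⟨y, hy⟩ : ∃ y, y = x + 1 := ⟨_, rfl⟩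
  rw [← hy] at h
  induction h generalizing x with
  | zero => omega
  | first h =>
    intro hxx
    obtain ⟨k', hk', e1, e2, -⟩ := hforth x 0 h (by omega) (hy ▸ hS _ _ hxx)
    have := hE.src_mono 0 k' (Nat.zero_le _) hk' e2.symm
    omega
  | last h =>
    intro hxx
    have hxu : x = u (m - 1) := by omega
    obtain ⟨k', hk', e1, e2, -⟩ := hforth (x + 1) (m - 1) (by omega) hx (hxu ▸ hxx)
    have := hE.src_mono k' (m - 1) (by omega) (by omega) e2
    omega
  | gap_left k hk h =>
    intro hxx
    have hxu : x = u k := by omega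
    -- An equally labelled edge from `x + 1` must come after edge `k`. Then edge `k + 1` has the
    -- same label and a source at most `x + 1`, so the two edges would be linked.
    obtain ⟨k', hk', e1, e2, -⟩ := hforth (x + 1) k (by omega) hx (hxu ▸ hxx)
    rcases Nat.lt_or_ge k k' with hlt | hge
    · have e3 := hE.lab_mono (k + 1) k' hlt hk'
      have e4 := hE.lab_mono k (k + 1) (by omega) hk
      have e5 : c (k + 1) = c k := le_antisymm (e2 ▸ e3) e4
      have := hE.src_mono (k + 1) k' hlt hk' (e5.trans e2.symm)
      exact h ⟨e5.le, by omega⟩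
    · have := hE.src_mono k' k hge (by omega) e2
      omega
  | gap_right k hk h =>
    intro hxx
    obtain ⟨k', hk', e1, e2, -⟩ := hforth x (k + 1) hk (by omega) (hy ▸ hS _ _ hxx)
    rcases Nat.lt_or_ge k k' with hlt | hge
    · have := hE.src_mono (k + 1) k' hlt hk' e2.symm
      omega
    · have e3 := hE.lab_mono k' k hge (by omega)
      have e4 := hE.lab_mono k (k + 1) (by omega) hk
      have e5 : c (k + 1) = c k := le_antisymm (e2 ▸ e3) e4
      have := hE.src_mono k' k hge (by omega) (e2.trans e5)
      exact h ⟨e5.le, by omega⟩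
  | final j hj h =>
    intro hxx
    obtain rfl : j = x := by omega
    exact h (hfin j hj hxx)
  | arc_left k hk h hv hb ih =>
    intro hxx
    have hxu : x = u k := by omega
    have hlab := hE.lab_eq_of_linked hk h
    obtain ⟨k', hk', e1, e2, e3⟩ := hforth (x + 1) k (by omega) hx (hxu ▸ hxx)
    rcases Nat.lt_or_ge k k' with hlt | hge
    · have h1 := hE.tgt_mono (k + 1) k' hlt hk' (by rw [e2, hlab])
      have h2 := hE.tgt_lt k' hk'
      -- The matching edge lies at or beyond `k + 1`, so related targets lie on both sides of the
      -- boundary `v (k + 1)`; convexity then relates the two states next to it.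
      refine ih (x := v (k + 1) - 1) (by omega) (by omega) ?_
      exact hconv (v k) (v k') _ e3 (by omega) (by omega) h2
    · have := hE.src_mono k' k hge (by omega) e2
      omega
  | arc_right k hk h hv hb ih =>
    intro hxx
    have hlab := hE.lab_eq_of_linked hk h
    obtain ⟨k', hk', e1, e2, e3⟩ := hforth x (k + 1) hk (by omega) (hy ▸ hS _ _ hxx)
    rcases Nat.lt_or_ge k k' with hlt | hge
    · have := hE.src_mono (k + 1) k' hlt hk' e2.symm
      omega
    · have h1 := hE.tgt_mono k' k hge (by omega) (by rw [e2, hlab])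
      have h2 := hE.tgt_lt (k + 1) hk
      refine ih (x := v (k + 1) - 1) (by omega) (by omega) ?_
      exact hconv (v k') (v (k + 1)) _ (hS _ _ e3) (by omega) (by omega) h2

/-- No boundary separates `i` from `j`. -/
def SameClass (n m : ℕ) (u v : ℕ → ℕ) (c : ℕ → τ) (fin : ℕ → ℕ) (i j : ℕ) : Prop :=
  ∀ x, min i j < x → x ≤ max i j → ¬ Boundary n m u v c fin x

theorem SameClass.refl (i : ℕ) : SameClass n m u v c fin i i := by
  intro x h1 h2
  omega

theorem SameClass.symm {i j : ℕ} (h : SameClass n m u v c fin i j) : SameClass n m u v c fin j i := by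
  intro x h1 h2
  exact h x (by omega) (by omega)

theorem SameClass.trans {i j k : ℕ} (h : SameClass n m u v c fin i j)
    (h' : SameClass n m u v c fin j k) : SameClass n m u v c fin i k := by
  intro x h1 h2 hx
  by_cases hij : min i j < x ∧ x ≤ max i j
  · exact h x hij.1 hij.2 hx
  · exact h' x (by omega) (by omega) hx

theorem SameClass.mono {i j i' j' : ℕ} (h : SameClass n m u v c fin i j)
    (h1 : min i j ≤ min i' j') (h2 : max i' j' ≤ max i j) : SameClass n m u v c fin i' j' := by
  intro x h3 h4
  exact h x (by omega) (by omega)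

/-- Adjacent states of the same class have the same labels. -/
theorem SortedEdges.exists_right (hE : SortedEdges n m u v c) {x : ℕ}
    (hx : ¬ Boundary n m u v c fin (x + 1)) {k : ℕ} (hk : k < m) (hu : u k = x) :
    ∃ k' < m, u k' = x + 1 ∧ c k' = c k := by
  obtain ⟨r, hr⟩ : ∃ r, m - k = r := ⟨_, rfl⟩
  induction r generalizing k with
  | zero => omega
  | succ r ih =>
    by_cases hlast : k + 1 < m
    · by_cases hl : Linked u c k
      · have hlab := hE.lab_eq_of_linked hlast hl
        have h1 := hE.src_mono k (k + 1) (by omega) hlast hlab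
        have h2 := hl.2
        -- Walk through the equally labelled edges with source `x`. A missing link or the end of the
        -- list would make `x + 1` a boundary, so the walk reaches the source `x + 1`.
        by_cases he : u (k + 1) = x
        · obtain ⟨k', h3, h4, h5⟩ := ih hlast he (by omega)
          exact ⟨k', h3, h4, h5.trans hlab.symm⟩
        · exact ⟨k + 1, hlast, by omega, hlab.symm⟩
      · exact absurd (hu ▸ Boundary.gap_left k hlast hl) hx
    · obtain rfl : k = m - 1 := by omega
      exact absurd (hu ▸ Boundary.last (by omega)) hx

theorem SortedEdges.exists_left (hE : SortedEdges n m u v c) {x : ℕ}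
    (hx : ¬ Boundary n m u v c fin (x + 1)) {k : ℕ} (hk : k < m) (hu : u k = x + 1) :
    ∃ k' < m, u k' = x ∧ c k' = c k := by
  induction k with
  | zero => exact absurd (hu ▸ Boundary.first hk) hx
  | succ k ih =>
    by_cases hl : Linked u c k
    · have hlab := hE.lab_eq_of_linked hk hl
      have h1 := hE.src_mono k (k + 1) (by omega) hk hlab
      have h2 := hl.2
      by_cases he : u k = x + 1
      · obtain ⟨k', h3, h4, h5⟩ := ih (by omega) he
        exact ⟨k', h3, h4, h5.trans hlab⟩
      · exact ⟨k, by omega, by omega, hlab⟩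
    · exact absurd (hu ▸ Boundary.gap_right k hk hl) hx

/-- Equally labelled edges from adjacent states of the same class lead to the same class. -/
theorem SortedEdges.sameClass_tgt (hE : SortedEdges n m u v c) {x : ℕ}
    (hx : ¬ Boundary n m u v c fin (x + 1)) {k₁ k₂ : ℕ} (hk₁ : k₁ < m) (hk₂ : k₂ < m)
    (hu₁ : u k₁ = x) (hu₂ : u k₂ = x + 1) (hc : c k₁ = c k₂) :
    SameClass n m u v c fin (v k₁) (v k₂) := by
  have hlt : k₁ < k₂ := by
    by_contra hge
    have := hE.src_mono k₂ k₁ (by omega) hk₁ hc.symm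
    omega
  have hle := hE.tgt_mono k₁ k₂ hlt.le hk₂ hc
  intro y h1 h2 hy
  rw [min_eq_left hle] at h1
  rw [max_eq_right hle] at h2
  -- The neighbouring edges between `k₁` and `k₂` at which the target first reaches the supposed
  -- boundary `y`. By `SortedEdges.tgt_succ`, `y` is exactly the new target.
  obtain ⟨k, hk1, hk2, hk3, hk4⟩ : ∃ k, k₁ ≤ k ∧ k + 1 ≤ k₂ ∧ v k < y ∧ y ≤ v (k + 1) := by
    have hex : ∃ k, k₁ ≤ k ∧ y ≤ v k := ⟨k₂, hlt.le, h2⟩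
    classical
    have hspec := Nat.find_spec hex
    have hmin := Nat.find_min' hex ⟨hlt.le, h2⟩
    have hne : Nat.find hex ≠ k₁ := by
      intro he
      rw [he] at hspec
      omega
    have hprev := Nat.find_min hex (m := Nat.find hex - 1) (by omega)
    refine ⟨Nat.find hex - 1, by omega, by omega, by omega, ?_⟩
    rw [Nat.sub_add_cancel (by omega)]
    exact hspec.2
  have c1 := hE.lab_mono k₁ k hk1 (by omega)
  have c2 := hE.lab_mono k (k + 1) (by omega) (by omega)
  have c3 := hE.lab_mono (k + 1) k₂ hk2 hk₂
  have e1 : c k₁ = c k := le_antisymm c1 (c2.trans (c3.trans hc.ge))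
  have e2 : c (k + 1) = c k₂ := le_antisymm c3 (hc.ge.trans (c1.trans c2))
  have e3 : c k = c (k + 1) := e1.symm.trans (hc.trans e2.symm)
  have u1 := hE.src_mono k₁ k hk1 (by omega) e1
  have u2 := hE.src_mono k (k + 1) (by omega) (by omega) e3
  have u3 := hE.src_mono (k + 1) k₂ hk2 hk₂ e2
  obtain rfl := hE.tgt_succ (by omega) e3 hk3 hk4
  have hl : Linked u c k := ⟨e3.ge, by omega⟩
  -- The sources at the jump are squeezed between `x` and `x + 1`. In either case an arc rule
  -- carries the boundary `y` back to `x + 1`.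
  by_cases hkx : u k = x
  · exact hx (hkx ▸ Boundary.arc_left k (by omega) hl hk3 hy)
  · have : u (k + 1) = x + 1 := by omega
    exact hx (this ▸ Boundary.arc_right k (by omega) hl hk3 hy)

/-- The matching edge is transported from one state to the next; each step keeps the label and the
class of the target, and transitivity composes the steps. This is the bisimulation property of
`SameClass`. -/
theorem SortedEdges.sameClass_forth (hE : SortedEdges n m u v c) {k i : ℕ} (hk : k < m)
    (h : SameClass n m u v c fin (u k) i) :
    ∃ k' < m, u k' = i ∧ c k' = c k ∧ SameClass n m u v c fin (v k) (v k') := by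
  obtain ⟨r, hr⟩ : ∃ r, max (u k) i - min (u k) i = r := ⟨_, rfl⟩
  induction r generalizing k with
  | zero => exact ⟨k, hk, by omega, rfl, .refl _⟩
  | succ r ih =>
    rcases Nat.lt_or_ge (u k) i with hlt | hge
    · have hb : ¬ Boundary n m u v c fin (u k + 1) := h _ (by omega) (by omega)
      obtain ⟨k₁, h1, h2, h3⟩ := hE.exists_right hb hk rfl
      have h4 := hE.sameClass_tgt hb hk h1 rfl h2 h3.symm
      obtain ⟨k₂, g1, g2, g3, g4⟩ := ih h1 (h.mono (by omega) (by omega)) (by omega)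
      exact ⟨k₂, g1, g2, g3.trans h3, h4.trans g4⟩
    · obtain ⟨x, hx⟩ : ∃ x, u k = x + 1 := ⟨u k - 1, by omega⟩
      have hb : ¬ Boundary n m u v c fin (x + 1) := h _ (by omega) (by omega)
      obtain ⟨k₁, h1, h2, h3⟩ := hE.exists_left hb hk hx
      have h4 := (hE.sameClass_tgt hb h1 hk h2 hx h3).symm
      obtain ⟨k₂, g1, g2, g3, g4⟩ := ih h1 (h.mono (by omega) (by omega)) (by omega)
      exact ⟨k₂, g1, g2, g3.trans h3, h4.trans g4⟩

theorem SameClass.fin_eq {i j : ℕ} (h : SameClass n m u v c fin i j) (hi : i < n) (hj : j < n) :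
    fin i = fin j := by
  wlog hij : i ≤ j generalizing i j
  · exact (this h.symm hj hi (by omega)).symm
  induction j, hij using Nat.le_induction with
  | base => rfl
  | succ j hij ih =>
    rw [ih (h.mono (by omega) (by omega)) (by omega)]
    by_contra hne
    exact h (j + 1) (by omega) (by omega) (.final j hj hne)

end Boundaries

/-! ## Numbering the classes -/

open Classical in
/-- The number of the class of the state `i`. -/
noncomputable def classIndex (B : ℕ → Prop) : ℕ → ℕ
  | 0 => 0
  | i + 1 => classIndex B i + if B (i + 1) then 1 else 0

section ClassIndex

variable {B : ℕ → Prop} {i j : ℕ}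

theorem classIndex_mono : Monotone (classIndex B) :=
  monotone_nat_of_le_succ fun _ => Nat.le_add_right _ _

theorem classIndex_le : classIndex B i ≤ i := by
  induction i with
  | zero => exact le_rfl
  | succ i ih =>
    rw [classIndex]
    split_ifs <;> omega

/-- The index is monotone and increases exactly at the boundaries. -/
theorem classIndex_eq_iff : classIndex B i = classIndex B j ↔
    ∀ x, min i j < x → x ≤ max i j → ¬ B x := by
  wlog hij : i ≤ j generalizing i j
  · rw [eq_comm, this (le_of_not_ge hij), min_comm, max_comm]
  rw [min_eq_left hij, max_eq_right hij]
  induction j, hij using Nat.le_induction with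
  | base => simp; intros; omega
  | succ j hij ih =>
    have h := classIndex_mono (B := B) hij
    rw [classIndex]
    constructor
    · intro he x h1 h2 hx
      by_cases hxj : x = j + 1
      · subst hxj
        rw [if_pos hx] at he
        omega
      · exact ih.1 (by split_ifs at he <;> omega) x h1 (by omega) hx
    · intro hB
      rw [if_neg (hB _ (by omega) le_rfl), add_zero]
      exact ih.2 fun x h1 h2 => hB x h1 (by omega)

/-- The index grows by at most one per step, so no class number is skipped; this gives surjectivity
onto the quotient states. -/
theorem exists_classIndex_eq {t : ℕ} (h : t ≤ classIndex B j) : ∃ i ≤ j, classIndex B i = t := by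
  induction j with
  | zero => exact ⟨0, le_rfl, (Nat.le_zero.1 h).symm⟩
  | succ j ih =>
    by_cases ht : t = classIndex B (j + 1)
    · exact ⟨j + 1, le_rfl, ht.symm⟩
    · rw [classIndex] at h ht
      obtain ⟨i, hi, he⟩ := ih (by split_ifs at h ht <;> omega)
      exact ⟨i, by omega, he⟩

end ClassIndex

/-! ## The quotient automaton -/

namespace Automaton

variable {σ Q : Type} {A : Automaton σ Q} {le : Q → Q → Prop}

/-- The converse of a Wheeler autobisimulation is one too: images and preimages swap roles, as do
`forth` and `back`. -/
theorem wheelerEquiv.symm {u v : Q} (h : A.wheelerEquiv le u v) : A.wheelerEquiv le v u := by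
  obtain ⟨R, hR, huv⟩ := h
  refine ⟨fun x y => R y x, ⟨⟨⟨?_, ?_, hR.wheeler.bisim.start, ?_⟩, hR.wheeler.preimage_convex,
    hR.wheeler.image_convex⟩, hR.refl⟩, huv⟩
  · intro u v u' a h1 h2
    exact hR.wheeler.bisim.back u' u v a h1 h2
  · intro u u' v' a h1 h2
    exact hR.wheeler.bisim.forth u' v' u a h1 h2
  · intro u u' h
    exact (hR.wheeler.bisim.final u' u h).symm

/-- Wheeler autobisimulations compose: the image of a convex set under the composite is an image of
an image. -/
theorem wheelerEquiv.trans {u v w : Q} (h : A.wheelerEquiv le u v) (h' : A.wheelerEquiv le v w) :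
    A.wheelerEquiv le u w := by
  obtain ⟨R, hR, huv⟩ := h
  obtain ⟨S, hS, hvw⟩ := h'
  refine ⟨fun x z => ∃ y, R x y ∧ S y z, ⟨⟨⟨?_, ?_, ⟨_, hR.refl _, hS.refl _⟩, ?_⟩, ?_, ?_⟩,
    fun u => ⟨u, hR.refl u, hS.refl u⟩⟩, v, huv, hvw⟩
  · rintro x x' z a ⟨y, h1, h2⟩ hx
    obtain ⟨y', h3, h4⟩ := hR.wheeler.bisim.forth _ _ _ _ h1 hx
    obtain ⟨z', h5, h6⟩ := hS.wheeler.bisim.forth _ _ _ _ h2 h4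
    exact ⟨z', ⟨y', h3, h5⟩, h6⟩
  · rintro x z z' a ⟨y, h1, h2⟩ hz
    obtain ⟨y', h3, h4⟩ := hS.wheeler.bisim.back _ _ _ _ h2 hz
    obtain ⟨x', h5, h6⟩ := hR.wheeler.bisim.back _ _ _ _ h1 h4
    exact ⟨x', ⟨y', h5, h3⟩, h6⟩
  · rintro x z ⟨y, h1, h2⟩
    exact (hR.wheeler.bisim.final x y h1).trans (hS.wheeler.bisim.final y z h2)
  · intro C hC
    convert hS.wheeler.image_convex _ (hR.wheeler.image_convex C hC) using 1
    ext z
    exact ⟨fun ⟨x, hx, y, h1, h2⟩ => ⟨y, ⟨x, hx, h1⟩, h2⟩, fun ⟨y, ⟨x, hx, h1⟩, h2⟩ => ⟨x, hx, y, h1, h2⟩⟩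
  · intro C hC
    convert hR.wheeler.preimage_convex _ (hS.wheeler.preimage_convex C hC) using 1
    ext x
    exact ⟨fun ⟨z, hz, y, h1, h2⟩ => ⟨y, ⟨z, hz, h2⟩, h1⟩, fun ⟨y, ⟨z, hz, h2⟩, h1⟩ => ⟨z, hz, y, h1, h2⟩⟩

section Wheeler

variable [LE σ]

theorem IsWheelerNFA.equiv_refl (h : A.IsWheelerNFA le) (u : Q) : A.wheelerEquiv le u u :=
  (wheelerEquiv_isMaximum A le h).1.refl u

/-- A class is the image of a singleton, which is convex by antisymmetry. -/
theorem IsWheelerNFA.class_convex (h : A.IsWheelerNFA le) (u : Q) :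
    IsConvexFor le {v | A.wheelerEquiv le u v} := by
  have := (wheelerEquiv_isMaximum A le h).1.wheeler.image_convex {u} (by
    rintro x y z hxy hyz rfl rfl
    exact h.antisymm _ _ hyz hxy)
  simpa using this

theorem IsWheelerNFA.wheelerClass_eq_iff (h : A.IsWheelerNFA le) {u v : Q} :
    A.wheelerClass le u = A.wheelerClass le v ↔ A.wheelerEquiv le u v := by
  constructor
  · intro he
    have : v ∈ A.wheelerClass le u := he ▸ h.equiv_refl v
    exact this
  · intro huv
    ext w
    exact ⟨fun hw => huv.symm.trans hw, fun hw => huv.trans hw⟩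

end Wheeler

end Automaton

/-- Surjections with the same fibres have isomorphic targets. -/
theorem exists_equiv_of_surjective {α β γ : Type} {f : α → β} {g : α → γ}
    (hf : Function.Surjective f) (hg : Function.Surjective g) (h : ∀ x y, f x = f y ↔ g x = g y) :
    ∃ e : β ≃ γ, ∀ x, e (f x) = g x := by
  have hspec : ∀ x, g (Function.surjInv hf (f x)) = g x := fun x =>
    (h _ _).1 (Function.surjInv_eq hf (f x))
  refine ⟨Equiv.ofBijective (fun b => g (Function.surjInv hf b)) ⟨?_, ?_⟩, hspec⟩
  · intro b b' hb
    have := (h _ _).2 hb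
    rwa [Function.surjInv_eq hf, Function.surjInv_eq hf] at this
  · intro z
    obtain ⟨x, rfl⟩ := hg z
    exact ⟨f x, hspec x⟩

/-! ### Recognising the quotient and counting the states -/

namespace Description

variable {σ Q : Type} {d : Description σ} {A : Automaton σ Q} {le : Q → Q → Prop}

/-- A criterion for describing the quotient. -/
theorem describes_quotient [LE σ] (h : A.IsWheelerNFA le) (e : Fin d.numStates ≃ Q)
    (he : ∀ i j, i ≤ j ↔ le (e i) (e j))
    (hE : ∀ i j a, (i, j, a) ∈ d.edges ↔ (e i, e j, a) ∈ A.edges) (hs : e d.start = A.start)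
    (hF : ∀ i, d.final i = true ↔ e i ∈ A.final) (d' : Description σ)
    (f : Fin d.numStates → Fin d'.numStates) (hf : Function.Surjective f) (hmono : Monotone f)
    (hker : ∀ i j, f i = f j ↔ A.wheelerEquiv le (e i) (e j)) (hnd : d'.edges.Nodup)
    (hedges : ∀ t, t ∈ d'.edges ↔ ∃ x ∈ d.edges, (f x.1, f x.2.1, x.2.2) = t)
    (hstart : d'.start = f d.start) (hfinal : ∀ i, d'.final (f i) = d.final i) :
    d'.Describes (A.quotient le) (A.quotientLE le) := by
  set g : Fin d.numStates → A.QuotientState le :=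
    fun i => ⟨A.wheelerClass le (e i), Set.mem_range_self _⟩ with hg
  have hgs : Function.Surjective g := by
    rintro ⟨_, u, rfl⟩
    exact ⟨e.symm u, by simp [hg]⟩
  obtain ⟨e', he'⟩ := exists_equiv_of_surjective hf hgs fun i j => by
    rw [hker, hg, Subtype.mk.injEq, h.wheelerClass_eq_iff]
  have hmem : ∀ i u, u ∈ (e' (f i)).1 ↔ f (e.symm u) = f i := by
    intro i u
    rw [he', hker, Equiv.apply_symm_apply]
    exact ⟨fun h => h.symm, fun h => h.symm⟩
  refine ⟨e', ?_, hnd, ?_, ?_, ?_⟩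
  · intro i' j'
    obtain ⟨i, rfl⟩ := hf i'
    obtain ⟨j, rfl⟩ := hf j'
    constructor
    · intro hij
      -- If the chosen representatives are in the wrong order, their classes coincide, and one state
      -- represents both.
      by_cases hle : i ≤ j
      · exact ⟨e i, by simp [hmem], e j, by simp [hmem], (he i j).1 hle⟩
      · have heq := le_antisymm hij (hmono (le_of_not_ge hle))
        exact ⟨e i, by simp [hmem], e i, by simp [hmem, heq], h.refl _⟩
    · rintro ⟨u, hu, v, hv, huv⟩
      rw [hmem] at hu hv
      rw [← hu, ← hv]
      refine hmono ((he _ _).2 ?_)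
      simpa using huv
  · intro i' j' a
    obtain ⟨i, rfl⟩ := hf i'
    obtain ⟨j, rfl⟩ := hf j'
    rw [hedges]
    constructor
    · rintro ⟨⟨x, y, b⟩, hx, hxy⟩
      simp only [Prod.mk.injEq] at hxy
      obtain ⟨h1, h2, rfl⟩ := hxy
      exact ⟨e x, by simp [hmem, h1], e y, by simp [hmem, h2], (hE _ _ _).1 hx⟩
    · rintro ⟨u, hu, v, hv, huv⟩
      simp only at hu hv huv
      rw [hmem] at hu hv
      refine ⟨(e.symm u, e.symm v, a), (hE _ _ _).2 (by simpa using huv), ?_⟩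
      rw [hu, hv]
  · rw [hstart, he', hg]
    exact Subtype.ext (by simp [Automaton.quotient, hs])
  · intro i'
    obtain ⟨i, rfl⟩ := hf i'
    rw [hfinal, hF]
    constructor
    · intro hi
      exact ⟨e i, by simp [hmem], hi⟩
    · rintro ⟨u, hu, huF⟩
      rw [hmem, hker, Equiv.apply_symm_apply] at hu
      obtain ⟨R, hR, hui⟩ := hu
      exact (hR.wheeler.bisim.final _ _ hui).1 huF

theorem start_eq_zero [LE σ] (h : A.IsWheelerNFA le) (hd : d.Describes A le) :
    (d.start : ℕ) = 0 := by
  obtain ⟨e, he, -, -, hs, -⟩ := hd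
  have hpos : 0 < d.numStates := d.start.pos
  have := (he d.start ⟨0, hpos⟩).2 (hs ▸ h.axiom_start _)
  exact Nat.le_zero.1 this

/-- Every state but the first one has an incoming edge. -/
theorem exists_incoming [LE σ] (h : A.IsWheelerNFA le) (hd : d.Describes A le) (j : ℕ) (hj : 0 < j)
    (hjn : j < d.numStates) : ∃ k < d.edges.length, d.tgt k = j := by
  have h0 := start_eq_zero h hd
  obtain ⟨e, he, -, hE, hs, -⟩ := hd
  have hr := h.reachable (e ⟨j, hjn⟩)
  rcases Relation.ReflTransGen.cases_tail hr with hr | ⟨u, -, a, ha⟩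
  · rw [← hs, e.injective.eq_iff] at hr
    have := congrArg Fin.val hr
    simp only at this
    omega
  · have := (hE (e.symm u) ⟨j, hjn⟩ a).2 (by simpa using ha)
    obtain ⟨k, hk, hke⟩ := List.getElem_of_mem this
    exact ⟨k, hk, by rw [tgt_eq hk, hke]⟩

/-- Every state but 0 is the target of an edge. So loops over the states also take time linear in
the number of edges. -/
theorem numStates_le [LE σ] (h : A.IsWheelerNFA le) (hd : d.Describes A le) :
    d.numStates ≤ d.edges.length + 1 := by
  have hsub : Finset.range d.numStates ⊆ insert 0 ((Finset.range d.edges.length).image d.tgt) := by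
    intro j hj
    rw [Finset.mem_range] at hj
    rw [Finset.mem_insert, Finset.mem_image]
    rcases Nat.eq_zero_or_pos j with h0 | h0
    · exact .inl h0
    · obtain ⟨k, hk, hkj⟩ := exists_incoming h hd j h0 hj
      exact .inr ⟨k, Finset.mem_range.2 hk, hkj⟩
  have h1 := Finset.card_le_card hsub
  have h2 := Finset.card_insert_le 0 ((Finset.range d.edges.length).image d.tgt)
  have h3 := Finset.card_image_le (s := Finset.range d.edges.length) (f := d.tgt)
  rw [Finset.card_range] at h1 h3
  omega

end Description

/-! ### From the sorted edges to the maximum autobisimulation -/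

section Sorted

variable {σ Q : Type} [LinearOrder σ] {d : Description σ} {A : Automaton σ Q} {le : Q → Q → Prop}
  {a : ℕ → ℕ}

theorem exists_of_perm {m : ℕ} {a : ℕ → ℕ}
    (hperm : (Multiset.range m).map a = Multiset.range m) {k : ℕ}
    (hk : k < m) : ∃ k' < m, a k' = k := by
  have : k ∈ (Multiset.range m).map a := by rwa [hperm, Multiset.mem_range]
  obtain ⟨k', h1, h2⟩ := Multiset.mem_map.1 this
  exact ⟨k', Multiset.mem_range.1 h1, h2⟩

theorem mem_edges_iff {σ : Type} {d : Description σ} {a : ℕ → ℕ}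
    (hperm : (Multiset.range d.edges.length).map a = Multiset.range d.edges.length)
    (i j : Fin d.numStates) (x : σ) : (i, j, x) ∈ d.edges ↔
      ∃ k < d.edges.length, d.src (a k) = i ∧ d.tgt (a k) = j ∧ d.lab (a k) = x := by
  constructor
  · intro h
    obtain ⟨k, hk, hke⟩ := List.getElem_of_mem h
    obtain ⟨k', hk', rfl⟩ := exists_of_perm hperm hk
    refine ⟨k', hk', ?_, ?_, ?_⟩
    · rw [Description.src_eq hk, hke]
    · rw [Description.tgt_eq hk, hke]
    · rw [Description.lab_eq hk, hke]
  · rintro ⟨k, hk, h1, h2, h3⟩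
    have hk' := lt_of_map_range hperm k hk
    rw [Description.src_eq hk'] at h1
    rw [Description.tgt_eq hk'] at h2
    rw [Description.lab_eq hk', WithBot.coe_inj] at h3
    rw [← h3, ← Fin.ext h1, ← Fin.ext h2]
    exact List.getElem_mem hk'

/-- For equal labels, the axiom on sources forbids source and target to move in opposite directions.
Hence a weakly larger sum means that both are weakly larger, and the single number `src + tgt`
orders both coordinates. -/
theorem sortedEdges_of_sorted (h : A.IsWheelerNFA le) (hd : d.Describes A le)
    (hperm : (Multiset.range d.edges.length).map a = Multiset.range d.edges.length)
    (hsort : ∀ x y, x < y → y < d.edges.length → keyLE d (a x) (a y)) :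
    SortedEdges d.numStates d.edges.length (fun k => d.src (a k)) (fun k => d.tgt (a k))
      (fun k => d.lab (a k)) := by
  have ha := lt_of_map_range hperm
  have hinc := Description.exists_incoming h hd
  obtain ⟨e, he, -, hE, -, -⟩ := hd
  have hedge : ∀ k (hk : k < d.edges.length), ∃ (i j : Fin d.numStates) (x : σ),
      (e i, e j, x) ∈ A.edges ∧ d.src (a k) = i ∧ d.tgt (a k) = j ∧ d.lab (a k) = x := by
    intro k hk
    have hk' := ha k hk
    exact ⟨d.edges[a k].1, d.edges[a k].2.1, d.edges[a k].2.2,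
      (hE _ _ _).1 (List.getElem_mem hk'), Description.src_eq hk', Description.tgt_eq hk',
      Description.lab_eq hk'⟩
  have hsrc : ∀ k k', k < d.edges.length → k' < d.edges.length → d.lab (a k) = d.lab (a k') →
      d.tgt (a k) < d.tgt (a k') → d.src (a k) ≤ d.src (a k') := by
    intro k k' hk hk' hc hv
    obtain ⟨i, j, x, h1, h2, h3, h4⟩ := hedge k hk
    obtain ⟨i', j', x', h1', h2', h3', h4'⟩ := hedge k' hk'
    rw [h4, h4', WithBot.coe_inj] at hc
    subst hc
    rw [h3, h3', ← Fin.lt_def] at hv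
    rw [h2, h2', ← Fin.le_def, he]
    exact h.axiom_sources _ _ _ _ _ h1 h1' ((he _ _).1 hv.le) fun heq => hv.ne (e.injective heq)
  have hkey : ∀ k k', k < k' → k' < d.edges.length → d.lab (a k) < d.lab (a k') ∨
      d.lab (a k) = d.lab (a k') ∧ d.src (a k) + d.tgt (a k) ≤ d.src (a k') + d.tgt (a k') :=
    fun k k' h1 h2 => Prod.Lex.le_iff.1 (hsort k k' h1 h2)
  have hchain : ∀ k k', k ≤ k' → k' < d.edges.length → d.lab (a k) = d.lab (a k') →
      d.src (a k) ≤ d.src (a k') ∧ d.tgt (a k) ≤ d.tgt (a k') := by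
    intro k k' hkk hk' hc
    rcases Nat.eq_or_lt_of_le hkk with rfl | hlt
    · exact ⟨le_rfl, le_rfl⟩
    · have hsum := ((hkey k k' hlt hk').resolve_left (by rw [hc]; exact lt_irrefl _)).2
      have h1 := hsrc k k' (by omega) hk' hc
      have h2 := hsrc k' k hk' (by omega) hc.symm
      omega
  refine ⟨fun k hk => Description.src_lt (ha k hk), fun k hk => Description.tgt_lt (ha k hk), ?_,
    fun k k' h1 h2 h3 => (hchain k k' h1 h2 h3).1, fun k k' h1 h2 h3 => (hchain k k' h1 h2 h3).2,
    ?_, ?_⟩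
  · intro k k' hkk hk'
    rcases Nat.eq_or_lt_of_le hkk with rfl | hlt
    · exact le_rfl
    · exact (hkey k k' hlt hk').elim le_of_lt fun h => h.1.le
  · intro k k' hk hk' hv
    obtain ⟨i, j, x, h1, h2, h3, h4⟩ := hedge k hk
    obtain ⟨i', j', x', h1', h2', h3', h4'⟩ := hedge k' hk'
    rw [h3, h3', ← Fin.lt_def] at hv
    rw [h4, h4', WithBot.coe_le_coe]
    exact h.axiom_labels _ _ _ _ _ _ h1 h1' ((he _ _).1 hv.le) fun heq => hv.ne (e.injective heq)
  · intro j hj hjn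
    obtain ⟨k, hk, hkj⟩ := hinc j hj hjn
    obtain ⟨k', hk', rfl⟩ := exists_of_perm hperm hk
    exact ⟨k', hk', hkj⟩

/-- The boundaries of the automaton `d` with its edges in the order `a`. -/
def IsBoundary (d : Description σ) (a : ℕ → ℕ) : ℕ → Prop :=
  Boundary d.numStates d.edges.length (fun k => d.src (a k)) (fun k => d.tgt (a k))
    (fun k => d.lab (a k)) d.fin

/-- In one direction `SameClass` is itself a Wheeler autobisimulation, hence contained in the
maximum one. In the other, a boundary between equivalent states would by convexity separate two
adjacent equivalent states, contrary to `Boundary.not_rel`. -/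
theorem classIndex_eq_iff_wheelerEquiv (h : A.IsWheelerNFA le) (e : Fin d.numStates ≃ Q)
    (he : ∀ i j, i ≤ j ↔ le (e i) (e j))
    (hE : ∀ i j a, (i, j, a) ∈ d.edges ↔ (e i, e j, a) ∈ A.edges)
    (hF : ∀ i, d.final i = true ↔ e i ∈ A.final)
    (hperm : (Multiset.range d.edges.length).map a = Multiset.range d.edges.length)
    (hsort : SortedEdges d.numStates d.edges.length (fun k => d.src (a k)) (fun k => d.tgt (a k))
      (fun k => d.lab (a k))) (i j : Fin d.numStates) :
    classIndex (IsBoundary d a) i = classIndex (IsBoundary d a) j ↔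
      A.wheelerEquiv le (e i) (e j) := by
  have ha := lt_of_map_range hperm
  have hmem : ∀ i j x, (e i, e j, x) ∈ A.edges ↔
      ∃ k < d.edges.length, d.src (a k) = i ∧ d.tgt (a k) = j ∧ d.lab (a k) = x := fun i j x =>
    (hE i j x).symm.trans (mem_edges_iff hperm i j x)
  have hfin : ∀ i j : Fin d.numStates, d.fin i = d.fin j ↔ (e i ∈ A.final ↔ e j ∈ A.final) := by
    intro i j
    rw [← hF, ← hF, Description.fin_eq, Description.fin_eq]
    cases d.final i <;> cases d.final j <;> simp
  set R : ℕ → ℕ → Prop := SameClass d.numStates d.edges.length (fun k => d.src (a k))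
    (fun k => d.tgt (a k)) (fun k => d.lab (a k)) d.fin with hR
  rw [classIndex_eq_iff]
  constructor
  · intro hij
    have forth : ∀ i i' j x, R (e.symm i) (e.symm i') → (i, j, x) ∈ A.edges →
        ∃ j', R (e.symm j) (e.symm j') ∧ (i', j', x) ∈ A.edges := by
      intro i i' j x hii hx
      obtain ⟨i, rfl⟩ := e.surjective i
      obtain ⟨i', rfl⟩ := e.surjective i'
      obtain ⟨j, rfl⟩ := e.surjective j
      simp only [Equiv.symm_apply_apply] at hii ⊢
      obtain ⟨k, hk, h1, h2, h3⟩ := (hmem i j x).1 hx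
      rw [← h1] at hii
      obtain ⟨k', hk', g1, g2, g3⟩ := hsort.sameClass_forth hk hii
      rw [← h2]
      refine ⟨e ⟨d.tgt (a k'), Description.tgt_lt (ha k' hk')⟩, by simpa using g3, ?_⟩
      exact (hmem _ _ _).2 ⟨k', hk', g1, rfl, g2.trans h3⟩
    -- If `v` lies in the class of neither end, boundaries on both sides of `v` confine the
    -- witnesses `x` and `y` to opposite sides of it, so `v` is in `C` by convexity of `C`.
    have hconv : ∀ C, IsConvexFor le C → IsConvexFor le {v | ∃ u ∈ C, R (e.symm u) (e.symm v)} := by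
      rintro C hC u v w huv hvw ⟨x, hx, hxu⟩ ⟨y, hy, hyw⟩
      have huv' : e.symm u ≤ e.symm v := (he _ _).2 (by simpa using huv)
      have hvw' : e.symm v ≤ e.symm w := (he _ _).2 (by simpa using hvw)
      rw [Fin.le_def] at huv' hvw'
      by_cases h1 : R (e.symm u) (e.symm v)
      · exact ⟨x, hx, hxu.trans h1⟩
      by_cases h2 : R (e.symm w) (e.symm v)
      · exact ⟨y, hy, hyw.trans h2⟩
      rw [hR] at h1 h2
      simp only [SameClass, not_forall, not_not] at h1 h2
      obtain ⟨b, hb1, hb2, hb⟩ := h1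
      obtain ⟨b', hb1', hb2', hb'⟩ := h2
      have k1 : (e.symm x : ℕ) < b := by
        by_contra hge
        exact hxu b (by omega) (by omega) hb
      have k2 : b' ≤ (e.symm y : ℕ) := by
        by_contra hlt
        exact hyw b' (by omega) (by omega) hb'
      refine ⟨v, hC x v y ?_ ?_ hx hy, .refl _⟩
      · have := (he (e.symm x) (e.symm v)).1 (Fin.le_def.2 (by omega))
        simpa using this
      · have := (he (e.symm v) (e.symm y)).1 (Fin.le_def.2 (by omega))
        simpa using this
    refine ⟨fun u v => R (e.symm u) (e.symm v), ⟨⟨⟨fun u v u' x => forth u u' v x, ?_, .refl _, ?_⟩,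
      hconv, ?_⟩, fun u => .refl _⟩, ?_⟩
    · intro u u' v' x huu hx
      obtain ⟨v, h1, h2⟩ := forth u' u v' x huu.symm hx
      exact ⟨v, h1.symm, h2⟩
    · intro u u' huu
      have := (hfin (e.symm u) (e.symm u')).1 (huu.fin_eq (Fin.is_lt _) (Fin.is_lt _))
      simpa using this
    · intro C hC
      have : {u | ∃ u' ∈ C, R (e.symm u) (e.symm u')} = {v | ∃ u ∈ C, R (e.symm u) (e.symm v)} :=
        Set.ext fun u => exists_congr fun u' => and_congr Iff.rfl ⟨.symm, .symm⟩
      rw [this]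
      exact hconv C hC
    · simp only [Equiv.symm_apply_apply]
      exact hij
  · intro hij x hx1 hx2 hx
    obtain ⟨x, rfl⟩ : ∃ y, x = y + 1 := ⟨x - 1, by omega⟩
    have hi := i.2
    have hj := j.2
    -- The maximum autobisimulation, read as a relation on numbers.
    refine Boundary.not_rel hsort (S := fun i j => ∃ (hi : i < d.numStates) (hj : j < d.numStates),
      A.wheelerEquiv le (e ⟨i, hi⟩) (e ⟨j, hj⟩)) ?_ ?_ ?_ ?_ hx (by omega) ?_
    · rintro i j ⟨hi, hj, h⟩
      exact ⟨hj, hi, h.symm⟩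
    · rintro i k hk hi ⟨hu, _, R', hR', hui⟩
      have hk' := ha k hk
      have hedge := (hmem ⟨_, hu⟩ ⟨_, Description.tgt_lt hk'⟩ d.edges[a k].2.2).2
        ⟨k, hk, rfl, rfl, Description.lab_eq hk'⟩
      obtain ⟨w, h1, h2⟩ := hR'.wheeler.bisim.forth _ _ _ _ hui hedge
      obtain ⟨w, rfl⟩ := e.surjective w
      obtain ⟨k', g1, g2, g3, g4⟩ := (hmem _ _ _).1 h2
      have g5 := w.2
      refine ⟨k', g1, g2, g4.trans (Description.lab_eq hk').symm, Description.tgt_lt hk', ?_, R',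
        hR', ?_⟩
      · rw [g3]
        exact g5
      · simpa only [g3] using h1
    · rintro i j x ⟨hi, hj, hij⟩ hix hxj _
      have hc := h.class_convex (e ⟨i, hi⟩)
      have m1 : A.wheelerEquiv le (e ⟨i, hi⟩) (e ⟨x, by omega⟩) :=
        hc _ _ _ ((he ⟨i, hi⟩ ⟨x, by omega⟩).1 (Fin.le_def.2 hix))
          ((he ⟨x, by omega⟩ ⟨j, hj⟩).1 (Fin.le_def.2 (by simp only; omega))) (h.equiv_refl _) hij
      have m2 : A.wheelerEquiv le (e ⟨i, hi⟩) (e ⟨x + 1, by omega⟩) :=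
        hc _ _ _ ((he ⟨i, hi⟩ ⟨x + 1, by omega⟩).1 (Fin.le_def.2 (by simp only; omega)))
          ((he ⟨x + 1, by omega⟩ ⟨j, hj⟩).1 (Fin.le_def.2 (by simp only; omega))) (h.equiv_refl _)
          hij
      exact ⟨by omega, by omega, m1.symm.trans m2⟩
    · rintro i _ ⟨hi, hj, R', hR', hij⟩
      exact (hfin ⟨i, hi⟩ ⟨i + 1, hj⟩).2 (hR'.wheeler.bisim.final _ _ hij)
    · rcases le_total (i : ℕ) j with hle | hle
      · have hc := h.class_convex (e i)
        have m1 : A.wheelerEquiv le (e i) (e ⟨x, by omega⟩) :=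
          hc _ _ _ ((he i ⟨x, by omega⟩).1 (Fin.le_def.2 (by simp only; omega)))
            ((he ⟨x, by omega⟩ j).1 (Fin.le_def.2 (by simp only; omega))) (h.equiv_refl _) hij
        have m2 : A.wheelerEquiv le (e i) (e ⟨x + 1, by omega⟩) :=
          hc _ _ _ ((he i ⟨x + 1, by omega⟩).1 (Fin.le_def.2 (by simp only; omega)))
            ((he ⟨x + 1, by omega⟩ j).1 (Fin.le_def.2 (by simp only; omega))) (h.equiv_refl _) hij
        exact ⟨by omega, by omega, m1.symm.trans m2⟩
      · have hc := h.class_convex (e j)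
        have m1 : A.wheelerEquiv le (e j) (e ⟨x, by omega⟩) :=
          hc _ _ _ ((he j ⟨x, by omega⟩).1 (Fin.le_def.2 (by simp only; omega)))
            ((he ⟨x, by omega⟩ i).1 (Fin.le_def.2 (by simp only; omega))) (h.equiv_refl _) hij.symm
        have m2 : A.wheelerEquiv le (e j) (e ⟨x + 1, by omega⟩) :=
          hc _ _ _ ((he j ⟨x + 1, by omega⟩).1 (Fin.le_def.2 (by simp only; omega)))
            ((he ⟨x + 1, by omega⟩ i).1 (Fin.le_def.2 (by simp only; omega))) (h.equiv_refl _) hij.symm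
        exact ⟨by omega, by omega, m1.symm.trans m2⟩

end Sorted

/-! ## Computing the boundaries -/

/-- Append the content of register `x` to the queue in array 7, unless it is marked in array 6. -/
def push (x : ℕ) : Program :=
  .seq (.load 22 6 (.reg x)) <|
  .ite (.eq (.reg 22) (.const 0))
    (.seq (.store 6 (.reg x) (.const 1)) <|
      .seq (.store 7 (.reg 20) (.reg x)) <| .arith 20 .add (.reg 20) (.const 1))
    .skip

def pushed (l : List ℕ) (v : ℕ) : List ℕ := if v ∈ l then l else l ++ [v]

/-- The queue contains the list `l` of numbers that are at most `n`. -/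
structure HasQueue {σ : Type} (n : ℕ) (l : List ℕ) (s : Memory σ) : Prop where
  nodup : l.Nodup
  le : ∀ x ∈ l, x ≤ n
  reg20 : s.reg 20 = l.length
  mark : ∀ x, s.num 6 x = if x ∈ l then 1 else 0
  queue : ∀ (i : ℕ) (h : i < l.length), s.num 7 i = l[i]

section Queue

variable {σ : Type} {n : ℕ} {l : List ℕ} {s s' : Memory σ}

theorem subset_pushed (l : List ℕ) (v : ℕ) : l ⊆ pushed l v := by
  intro x hx
  rw [pushed]
  split_ifs
  · exact hx
  · exact List.mem_append_left _ hx

theorem mem_pushed (l : List ℕ) (v : ℕ) : v ∈ pushed l v := by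
  rw [pushed]
  split_ifs with h
  · exact h
  · simp

theorem mem_or_eq_of_mem_pushed {v x : ℕ} (h : x ∈ pushed l v) : x ∈ l ∨ x = v := by
  rw [pushed] at h
  split_ifs at h
  · exact .inl h
  · simpa using h

theorem exists_pushed_eq_append (l : List ℕ) (v : ℕ) : ∃ l', pushed l v = l ++ l' := by
  rw [pushed]
  split_ifs
  · exact ⟨[], by simp⟩
  · exact ⟨_, rfl⟩

/-- The marks keep the queue free of repetitions. This bounds the number of passes of the search. -/
theorem HasQueue.length_le (h : HasQueue n l s) : l.length ≤ n + 1 := by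
  rw [← List.toFinset_card_of_nodup h.nodup]
  have : l.toFinset ⊆ Finset.range (n + 1) := by
    intro x hx
    have := h.le x (List.mem_toFinset.1 hx)
    rw [Finset.mem_range]
    omega
  simpa using Finset.card_le_card this

theorem HasQueue.congr (h : HasQueue n l s) (h20 : s'.reg 20 = s.reg 20) (h6 : s'.num 6 = s.num 6)
    (h7 : s'.num 7 = s.num 7) : HasQueue n l s' :=
  ⟨h.nodup, h.le, h20.trans h.reg20, fun x => by rw [h6, h.mark], fun i hi => by rw [h7, h.queue]⟩

theorem wp_push [LE σ] {W x v : ℕ} (hW : n + 1 ≤ W) (h : HasQueue n l s) (hx : s.reg x = v)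
    (hx20 : x < 20) (hv : v ≤ n) {Post : Memory σ → Prop}
    (hP : ∀ s', HasQueue n (pushed l v) s' → (∀ y < 20, s'.reg y = s.reg y) →
      s'.reg 21 = s.reg 21 → (∀ b, b ≠ 6 → b ≠ 7 → s'.num b = s.num b) → s'.char = s.char → Post s') :
    wp W (push x) Post s := by
  have hm := h.mark v
  have hl := h.length_le
  have hne : x ≠ 22 := by omega
  simp only [push, wp, Operand.eval, Test.Holds, ArithOp.eval, Memory.setReg_reg,
    Memory.setNum_reg, reduceIte, Nat.reduceEqDiff, hne, hx, hm]
  by_cases hmem : v ∈ l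
  · simp only [hmem, reduceIte]
    refine ⟨by omega, fun hc => absurd hc (by omega), fun _ => hP _ ?_ ?_ ?_ ?_ rfl⟩
    · rw [pushed, if_pos hmem]
      exact h.congr (by simp) rfl rfl
    · intro y hy
      simp [show y ≠ 22 by omega]
    · simp
    · simp
  · have hnd : (l ++ [v]).Nodup := by
      rw [List.nodup_append]
      exact ⟨h.nodup, by simp, by rintro a ha b hb rfl; simp at hb; exact hmem (hb ▸ ha)⟩
    have hle : ∀ y ∈ l ++ [v], y ≤ n := by
      intro y hy
      rcases List.mem_append.1 hy with hy | hy
      · exact h.le y hy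
      · rw [List.mem_singleton.1 hy]
        exact hv
    have hq : HasQueue n (l ++ [v])
        ((((s.setReg 22 0).setNum 6 v 1).setNum 7 (s.reg 20) v).setReg 20 (s.reg 20 + 1)) := by
      refine ⟨hnd, hle, ?_, ?_, ?_⟩
      · simp [h.reg20]
      · intro y
        simp only [Memory.setReg_num, Memory.setNum_num, reduceIte, Nat.reduceEqDiff,
          Function.update_apply, h.mark, List.mem_append, List.mem_singleton]
        by_cases hy : y = v <;> simp [hy]
      · intro i hi
        simp only [Memory.setReg_num, Memory.setNum_num, reduceIte, Nat.reduceEqDiff,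
          Function.update_apply, h.reg20]
        split_ifs with hil
        · simp [hil]
        · simp only [List.length_append, List.length_singleton] at hi
          rw [List.getElem_append_left (by omega), h.queue]
    have := hq.length_le
    simp only [List.length_append, List.length_singleton] at this
    simp only [hmem, reduceIte]
    refine ⟨by omega, fun _ => ⟨by omega, by omega, ?_, hP _ ?_ ?_ ?_ ?_ rfl⟩,
      fun hc => absurd trivial hc⟩
    · rw [h.reg20]
      omega
    · rw [pushed, if_neg hmem]
      exact hq
    · intro y hy
      simp [show y ≠ 20 by omega, show y ≠ 22 by omega]
    · simp
    · intro b hb hb'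
      simp [hb, hb']

end Queue

/-- The sources of the first edge and of the last edge yield boundaries. -/
def pushEnds : Program :=
  .seq (.set 4 (.const 0)) <|
  .seq (.set 20 (.const 0)) <|
  .seq (push 4) <|
  .ite (.lt (.const 0) (.reg 1))
    (.seq (.load 5 3 (.const 0)) <|
      .seq (.load 6 0 (.reg 5)) <|
      .seq (push 6) <|
      .seq (.arith 5 .sub (.reg 1) (.const 1)) <|
      .seq (.load 5 3 (.reg 5)) <|
      .seq (.load 6 0 (.reg 5)) <|
      .seq (.arith 6 .add (.reg 6) (.const 1)) <|
      push 6)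
    .skip

/-- Load the end points of the edges `k` and `k + 1`. -/
def loadEdges : Program :=
  .seq (.load 5 3 (.reg 4)) <|
  .seq (.arith 6 .add (.reg 4) (.const 1)) <|
  .seq (.load 6 3 (.reg 6)) <|
  .seq (.load 7 0 (.reg 5)) <|
  .seq (.arith 7 .add (.reg 7) (.const 1)) <|
  .seq (.load 8 0 (.reg 6)) <|
  .seq (.load 9 1 (.reg 5)) <|
  .seq (.load 10 1 (.reg 6)) <|
  .seq (.set 11 (.const 0)) <|
  .ite (.charLE 0 (.reg 6) 0 (.reg 5)) (.ite (.le (.reg 8) (.reg 7)) (.set 11 (.const 1)) .skip) .skip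

/-- Linked edges with different targets leave an arc, stored at the new target in the arrays 8 and
9. Edges that are not linked give two boundaries at once. -/
def scanStep : Program :=
  .ite (.eq (.reg 11) (.const 1))
    (.ite (.lt (.reg 9) (.reg 10))
      (.seq (.store 8 (.reg 10) (.reg 7)) (.store 9 (.reg 10) (.reg 8)))
      .skip)
    (.seq (push 7) (push 8))

/-- Find the boundaries that come from adjacent edges, and the arcs. -/
def scanLoop : Program :=
  .seq (.arith 14 .sub (.reg 1) (.const 1)) <|
  .seq (.set 4 (.const 0)) <|
  forLoop 4 14 (.seq loadEdges scanStep)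

/-- Find the boundaries between final and non-final states. -/
def finalLoop : Program :=
  .seq (.arith 14 .sub (.reg 0) (.const 1)) <|
  .seq (.set 4 (.const 0)) <|
  forLoop 4 14 <|
    .seq (.load 5 2 (.reg 4)) <|
    .seq (.arith 7 .add (.reg 4) (.const 1)) <|
    .seq (.load 6 2 (.reg 7)) <|
    .ite (.eq (.reg 5) (.reg 6)) .skip (push 7)

/-- Follow the arcs. -/
def searchLoop : Program :=
  .seq (.set 21 (.const 0)) <|
  .while (.lt (.reg 21) (.reg 20)) <|
    .seq (.load 5 7 (.reg 21)) <|
    .seq (.load 6 8 (.reg 5)) <|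
    .seq (.load 7 9 (.reg 5)) <|
    .seq (push 6) <|
    .seq (push 7) <|
    .arith 21 .add (.reg 21) (.const 1)

/-! ### Correctness and cost of the search for boundaries -/

section Search

variable {σ : Type} [LinearOrder σ] {d : Description σ} {a : ℕ → ℕ} {W : ℕ} {l : List ℕ}
  {s s' : Memory σ}

/-- Adjacent edges with the same label and adjacent or equal sources. -/
def IsLinked (d : Description σ) (a : ℕ → ℕ) (k : ℕ) : Prop :=
  Linked (fun k => d.src (a k)) (fun k => d.lab (a k)) k

/-- The memory contains `d`, its edges in the order `a`, and a queue of boundaries. -/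
structure HasBoundaries (d : Description σ) (a : ℕ → ℕ) (l : List ℕ) (s : Memory σ) : Prop where
  input : HasInput d s
  num3 : s.num 3 = a
  queue : HasQueue d.numStates l s
  boundary : ∀ x ∈ l, IsBoundary d a x

theorem HasBoundaries.congr (h : HasBoundaries d a l s) (hr : ∀ x < 3, s'.reg x = s.reg x)
    (h20 : s'.reg 20 = s.reg 20) (hn : ∀ b < 8, s'.num b = s.num b) (hc : s'.char 0 = s.char 0) :
    HasBoundaries d a l s' :=
  ⟨h.input.congr hr (fun b hb => hn b (by omega)) hc, (hn 3 (by omega)).trans h.num3,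
    h.queue.congr h20 (hn 6 (by omega)) (hn 7 (by omega)), h.boundary⟩

theorem HasBoundaries.wp_push (hW : d.numStates + 1 ≤ W)
    (hE : SortedEdges d.numStates d.edges.length (fun k => d.src (a k)) (fun k => d.tgt (a k))
      (fun k => d.lab (a k)))
    {x v : ℕ} (h : HasBoundaries d a l s) (hx : s.reg x = v) (hx20 : x < 20)
    (hv : IsBoundary d a v) {Post : Memory σ → Prop}
    (hP : ∀ s', HasBoundaries d a (pushed l v) s' → (∀ y < 20, s'.reg y = s.reg y) →
      s'.reg 21 = s.reg 21 → s'.num 8 = s.num 8 → s'.num 9 = s.num 9 → Post s') :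
    wp W (push x) Post s := by
  refine _root_.wp_push hW h.queue hx hx20 (Boundary.le hE hv) fun s' h1 h2 h3 h4 h5 => ?_
  refine hP s' ⟨h.input.congr (fun y hy => h2 y (by omega))
    (fun b hb => h4 b (by omega) (by omega)) (by rw [h5]), ?_, h1, ?_⟩ h2 h3 (h4 8 (by omega) (by omega))
    (h4 9 (by omega) (by omega))
  · rw [h4 3 (by omega) (by omega), h.num3]
  · intro y hy
    rcases mem_or_eq_of_mem_pushed hy with hy | rfl
    · exact h.boundary y hy
    · exact hv

/-- `EndsIn`, `GapsIn` and `FinalsIn` say that the boundaries with no boundary as premise are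
queued. They persist when the queue grows, so each stage preserves the work of the earlier ones. -/
def EndsIn (d : Description σ) (a : ℕ → ℕ) (l : List ℕ) : Prop :=
  0 ∈ l ∧ (0 < d.edges.length → d.src (a 0) ∈ l ∧ d.src (a (d.edges.length - 1)) + 1 ∈ l)

def GapsIn (d : Description σ) (a : ℕ → ℕ) (k : ℕ) (l : List ℕ) : Prop :=
  ∀ j < k, j + 1 < d.edges.length → ¬ IsLinked d a j →
    d.src (a j) + 1 ∈ l ∧ d.src (a (j + 1)) ∈ l

def FinalsIn (d : Description σ) (k : ℕ) (l : List ℕ) : Prop :=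
  ∀ j < k, d.fin j ≠ d.fin (j + 1) → j + 1 ∈ l

/-- There is an arc from the target of the edge `j + 1`. -/
def IsArc (d : Description σ) (a : ℕ → ℕ) (j : ℕ) : Prop :=
  j + 1 < d.edges.length ∧ IsLinked d a j ∧ d.tgt (a j) < d.tgt (a (j + 1))

/-- The arrays `L` and `R` contain the arcs that come from the first `k` pairs of edges. -/
structure HasArcs (d : Description σ) (a : ℕ → ℕ) (k : ℕ) (L R : ℕ → ℕ) : Prop where
  arc : ∀ j < k, IsArc d a j → L (d.tgt (a (j + 1))) = d.src (a j) + 1 ∧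
    R (d.tgt (a (j + 1))) = d.src (a (j + 1))
  cases : ∀ y, L y = 0 ∧ R y = 0 ∨ ∃ j < k, IsArc d a j ∧ y = d.tgt (a (j + 1)) ∧
    L y = d.src (a j) + 1 ∧ R y = d.src (a (j + 1))

theorem EndsIn.mono {σ : Type} {d : Description σ} {a : ℕ → ℕ} {l l' : List ℕ}
    (h : EndsIn d a l) (hl : l ⊆ l') : EndsIn d a l' :=
  ⟨hl h.1, fun hm => ⟨hl (h.2 hm).1, hl (h.2 hm).2⟩⟩

theorem GapsIn.mono {k : ℕ} {l l' : List ℕ} (h : GapsIn d a k l) (hl : l ⊆ l') : GapsIn d a k l' :=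
  fun j hj hj' hl' => ⟨hl (h j hj hj' hl').1, hl (h j hj hj' hl').2⟩

theorem FinalsIn.mono {σ : Type} {d : Description σ} {k : ℕ} {l l' : List ℕ}
    (h : FinalsIn d k l) (hl : l ⊆ l') : FinalsIn d k l' :=
  fun j hj hj' => hl (h j hj hj')

/-- The untouched arrays provide the initial data: array 6 contains no marks, and the zeros in the
arrays 8 and 9 mean that there are no arcs. -/
theorem runs_pushEnds (hW : 4 * d.edges.length + 8 ≤ W) (hn : d.numStates ≤ d.edges.length + 1)
    (hE : SortedEdges d.numStates d.edges.length (fun k => d.src (a k)) (fun k => d.tgt (a k))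
      (fun k => d.lab (a k))) (ha : ∀ x < d.edges.length, a x < d.edges.length)
    (h : HasKeys d d.edges.length s) (h3 : s.num 3 = a) :
    Runs W pushEnds s 30 fun s' => ∃ l, HasBoundaries d a l s' ∧ EndsIn d a l ∧
      s'.num 8 = (fun _ => 0) ∧ s'.num 9 = (fun _ => 0) := by
  refine (Runs.of_wp ?_).mono (by simp [pushEnds, push, Program.size]) fun _ h => h
  have hr1 := h.reg1
  simp only [pushEnds, wp, Operand.eval]
  refine ⟨Nat.zero_le _, Nat.zero_le _, ?_⟩
  refine HasBoundaries.wp_push (d := d) (a := a) (l := []) (by omega) hE (v := 0) ?_ (by simp)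
    (by omega) .zero ?_
  · refine ⟨h.toHasInput.congr ?_ (by simp) rfl, by simp [h3], ⟨by simp, by simp, by simp, ?_, by simp⟩,
      by simp⟩
    · intro x hx
      simp [show x ≠ 4 by omega, show x ≠ 20 by omega]
    · simp [h.unused 6 (by omega)]
  intro s₁ g1 g2 g3 g4 g5
  have g1r := g1.input.reg1
  simp only [Memory.setReg_num, h.unused 8 (by omega)] at g4
  simp only [Memory.setReg_num, h.unused 9 (by omega)] at g5
  simp only [Test.Holds, Operand.eval, g1r]
  refine ⟨fun hm => ?_, fun hm => ⟨_, g1, ⟨mem_pushed _ _, fun hm' => absurd hm' hm⟩, g4, g5⟩⟩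
  have a0 := ha 0 hm
  have aL := ha (d.edges.length - 1) (by omega)
  have b0 := hE.src_lt 0 hm
  have bL := hE.src_lt (d.edges.length - 1) (by omega)
  simp only [g1.num3, g1.input.num0, Memory.setReg_num, Memory.setReg_reg, reduceIte]
  refine ⟨by omega, by omega, ?_⟩
  refine HasBoundaries.wp_push (l := pushed [] 0) (by omega) hE (v := d.src (a 0))
    (x := 6) ?_ (by simp) (by omega) (.first hm) ?_
  · refine g1.congr (fun x hx => ?_) (by simp) (by simp) rfl
    simp [show x ≠ 5 by omega, show x ≠ 6 by omega]
  intro s₂ k1 k2 k3 k4 k5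
  simp only [ArithOp.eval, k1.num3, k1.input.num0, k1.input.reg1]
  refine ⟨by omega, by omega, by omega, by omega, ?_⟩
  refine HasBoundaries.wp_push (l := pushed (pushed [] 0) (d.src (a 0))) (by omega) hE
    (v := d.src (a (d.edges.length - 1)) + 1)
    (x := 6) ?_ (by simp) (by omega) (.last hm) ?_
  · refine k1.congr (fun x hx => ?_) (by simp) (by simp) rfl
    simp [show x ≠ 5 by omega, show x ≠ 6 by omega]
  intro s₃ m1 m2 m3 m4 m5
  refine ⟨_, m1, ⟨?_, fun _ => ⟨?_, mem_pushed _ _⟩⟩, ?_, ?_⟩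
  · exact subset_pushed _ _ (subset_pushed _ _ (mem_pushed _ _))
  · exact subset_pushed _ _ (mem_pushed _ _)
  · rw [m4, Memory.setReg_num, Memory.setReg_num, Memory.setReg_num, Memory.setReg_num, k4,
      Memory.setReg_num, Memory.setReg_num, g4]
  · rw [m5, Memory.setReg_num, Memory.setReg_num, Memory.setReg_num, Memory.setReg_num, k5,
      Memory.setReg_num, Memory.setReg_num, g5]

theorem wp_loadEdges (hW : 4 * d.edges.length + 8 ≤ W) (hn : d.numStates ≤ d.edges.length + 1)
    (ha : ∀ x < d.edges.length, a x < d.edges.length)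
    (h : HasBoundaries d a l s) {k : ℕ} (hk : k + 1 < d.edges.length) (h4 : s.reg 4 = k)
    {Post : Memory σ → Prop}
    (hP : ∀ s', HasBoundaries d a l s' → (s'.reg 11 = 1 ↔ IsLinked d a k) → s'.reg 4 = k →
      s'.reg 14 = s.reg 14 → s'.reg 7 = d.src (a k) + 1 → s'.reg 8 = d.src (a (k + 1)) →
      s'.reg 9 = d.tgt (a k) → s'.reg 10 = d.tgt (a (k + 1)) → s'.num = s.num → Post s') :
    wp W loadEdges Post s := by
  have a0 := ha k (by omega)
  have a1 := ha (k + 1) hk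
  have b1 := Description.src_lt a0
  have b2 := Description.src_lt a1
  have b3 := Description.tgt_lt a0
  have b4 := Description.tgt_lt a1
  simp only [loadEdges, wp, Operand.eval, ArithOp.eval, h.num3, h.input.num0, h.input.num1, h4,
    Memory.setReg_num, Memory.setReg_reg, reduceIte, Nat.reduceEqDiff]
  refine ⟨by omega, by omega, by omega, by omega, by omega, by omega, by omega, by omega, by omega,
    ?_⟩
  have hI := h.input
  have hc := charLE_holds (d := d) (b₁ := 0) (b₂ := 0) (o₁ := .reg 6) (o₂ := .reg 5)
    (s := ((((((((s.setReg 5 (a k)).setReg 6 (k + 1)).setReg 6 (a (k + 1))).setReg 7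
      (d.src (a k))).setReg 7 (d.src (a k) + 1)).setReg 8 (d.src (a (k + 1)))).setReg 9
      (d.tgt (a k))).setReg 10 (d.tgt (a (k + 1)))).setReg 11 0) (x := a (k + 1)) (y := a k)
    (by simp [Operand.eval, hI.char0]; rfl) (by simp [Operand.eval, hI.char0]; rfl) a1 a0
  simp only [hc]
  have hframe : ∀ v, HasBoundaries d a l (((((((((((s.setReg 5 (a k)).setReg 6 (k + 1)).setReg 6
      (a (k + 1))).setReg 7
      (d.src (a k))).setReg 7 (d.src (a k) + 1)).setReg 8 (d.src (a (k + 1)))).setReg 9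
      (d.tgt (a k))).setReg 10 (d.tgt (a (k + 1)))).setReg 11 0)).setReg 11 v) := by
    intro v
    refine h.congr ?_ (by simp) (by simp) rfl
    intro x hx
    simp [show x ≠ 5 by omega, show x ≠ 6 by omega, show x ≠ 7 by omega, show x ≠ 8 by omega,
      show x ≠ 9 by omega, show x ≠ 10 by omega, show x ≠ 11 by omega]
  have hframe' : HasBoundaries d a l ((((((((((s.setReg 5 (a k)).setReg 6 (k + 1)).setReg 6
      (a (k + 1))).setReg 7
      (d.src (a k))).setReg 7 (d.src (a k) + 1)).setReg 8 (d.src (a (k + 1)))).setReg 9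
      (d.tgt (a k))).setReg 10 (d.tgt (a (k + 1)))).setReg 11 0)) := by
    refine (hframe 0).congr ?_ (by simp) (by simp) rfl
    intro x hx
    simp [show x ≠ 11 by omega]
  have hl : IsLinked d a k ↔ d.lab (a (k + 1)) ≤ d.lab (a k) ∧ d.src (a (k + 1)) ≤ d.src (a k) + 1 :=
    Iff.rfl
  refine ⟨fun c1 => ⟨fun c2 => ⟨by omega, ?_⟩, fun c2 => ?_⟩, fun c1 => ?_⟩
  · exact hP _ (hframe 1) (by simpa using hl.2 ⟨c1, c2⟩) (by simp [h4]) (by simp) (by simp) (by simp)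
      (by simp) (by simp) rfl
  · exact hP _ hframe' (by simpa using fun h => c2 (hl.1 h).2) (by simp [h4]) (by simp) (by simp)
      (by simp) (by simp) (by simp) rfl
  · exact hP _ hframe' (by simpa using fun h => c1 (hl.1 h).1) (by simp [h4]) (by simp) (by simp)
      (by simp) (by simp) (by simp) rfl

theorem HasArcs.skip {k : ℕ} {L R : ℕ → ℕ} (h : HasArcs d a k L R) (hk : ¬ IsArc d a k) :
    HasArcs d a (k + 1) L R := by
  refine ⟨fun j hj hj' => h.arc j ?_ hj', fun y => (h.cases y).imp id ?_⟩
  · rcases Nat.lt_succ_iff_lt_or_eq.1 hj with hj | rfl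
    · exact hj
    · exact absurd hj' hk
  · rintro ⟨j, hj, h⟩
    exact ⟨j, by omega, h⟩

/-- By `SortedEdges.arc_unique` the new entry overwrites no earlier arc, so one cell per target
suffices. -/
theorem HasArcs.update
    (hE : SortedEdges d.numStates d.edges.length (fun k => d.src (a k)) (fun k => d.tgt (a k))
      (fun k => d.lab (a k))) {k : ℕ} {L R : ℕ → ℕ} (h : HasArcs d a k L R) (hk : IsArc d a k) :
    HasArcs d a (k + 1) (Function.update L (d.tgt (a (k + 1))) (d.src (a k) + 1))
      (Function.update R (d.tgt (a (k + 1))) (d.src (a (k + 1)))) := by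
  refine ⟨fun j hj hj' => ?_, fun y => ?_⟩
  · rcases Nat.lt_succ_iff_lt_or_eq.1 hj with hj | rfl
    · have hne : d.tgt (a (j + 1)) ≠ d.tgt (a (k + 1)) := fun heq =>
        hj.ne (hE.arc_unique hj'.1 hk.1 hj'.2.1 hk.2.1 hj'.2.2 hk.2.2 heq)
      rw [Function.update_of_ne hne, Function.update_of_ne hne]
      exact h.arc j hj hj'
    · simp
  · by_cases hy : y = d.tgt (a (k + 1))
    · subst hy
      exact .inr ⟨k, by omega, hk, rfl, by simp, by simp⟩
    · rw [Function.update_of_ne hy, Function.update_of_ne hy]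
      refine (h.cases y).imp id ?_
      rintro ⟨j, hj, h⟩
      exact ⟨j, by omega, h⟩

theorem runs_scanLoop (hW : 4 * d.edges.length + 8 ≤ W) (hn : d.numStates ≤ d.edges.length + 1)
    (hE : SortedEdges d.numStates d.edges.length (fun k => d.src (a k)) (fun k => d.tgt (a k))
      (fun k => d.lab (a k))) (ha : ∀ x < d.edges.length, a x < d.edges.length)
    (h : HasBoundaries d a l s) (hends : EndsIn d a l) (h8 : s.num 8 = fun _ => 0)
    (h9 : s.num 9 = fun _ => 0) :
    Runs W scanLoop s (40 * d.edges.length + 3) fun s' => ∃ l, HasBoundaries d a l s' ∧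
      EndsIn d a l ∧ GapsIn d a (d.edges.length - 1) l ∧
      HasArcs d a (d.edges.length - 1) (s'.num 8) (s'.num 9) := by
  refine (Runs.seq (T := 1) (T' := 40 * d.edges.length + 2) ?_).mono (by omega) fun _ h => h
  refine Runs.of_wp (p := .arith 14 .sub (.reg 1) (.const 1)) ⟨?_, ?_⟩
  · simp only [Operand.eval, ArithOp.eval, h.input.reg1]
    omega
  refine (Runs.seq (T := 1) (T' := 40 * d.edges.length + 1) ?_).mono (by omega) fun _ h => h
  refine Runs.of_wp (p := .set 4 (.const 0)) ⟨Nat.zero_le _, ?_⟩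
  refine (Runs.forLoop (W := W) (x := 4) (y := 14) (by omega) (fun k s' => ∃ l, HasBoundaries d a l s' ∧
      EndsIn d a l ∧ GapsIn d a k l ∧ HasArcs d a k (s'.num 8) (s'.num 9)) (d.edges.length - 1)
      (by omega) ?_ (i := 0) (Nat.zero_le _) (by simp [Operand.eval])
      (by simp [Operand.eval, ArithOp.eval, h.input.reg1]) ?_).mono ?_ ?_
  · rintro k s₀ hk e4 e14 ⟨l, f1, f2, f3, f4⟩
    refine wp_loadEdges hW hn ha f1 (by omega) e4 ?_
    intro s₁ g1 g2 g3 g4 g5 g6 g7 g8 g9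
    have b1 := Description.src_lt (ha k (by omega))
    have b2 := Description.src_lt (ha (k + 1) (by omega))
    have hskip : IsLinked d a k → GapsIn d a (k + 1) l := by
      intro hl j hj hj' hl'
      rcases Nat.lt_succ_iff_lt_or_eq.1 hj with hj | rfl
      · exact f3 j hj hj' hl'
      · exact absurd hl hl'
    rw [← g9] at f4
    simp only [scanStep, wp, Operand.eval, Test.Holds]
    refine ⟨fun c1 => ⟨fun c2 => ?_, fun c2 => ?_⟩, fun c1 => ?_⟩
    · rw [g2] at c1
      simp only [Memory.setNum_reg, g5, g6, g8, g3, g4, e14]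
      refine ⟨by omega, by omega, trivial, trivial, l, g1.congr ?_ ?_ ?_ rfl, f2, hskip c1, ?_⟩
      · intro x hx
        simp [show x ≠ 4 by omega]
      · simp
      · intro b hb
        simp [show b ≠ 8 by omega, show b ≠ 9 by omega]
      · simp only [Memory.setReg_num, Memory.setNum_num, reduceIte, Nat.reduceEqDiff]
        refine f4.update hE ⟨by omega, c1, ?_⟩
        rwa [g7, g8] at c2
    · rw [g2] at c1
      refine ⟨g3, g4.trans e14, l, g1.congr ?_ (by simp) (by simp) rfl, f2, hskip c1, ?_⟩
      · intro x hx
        simp [show x ≠ 4 by omega]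
      · refine f4.skip fun hk => c2 ?_
        rw [g7, g8]
        exact hk.2.2
    · rw [g2] at c1
      refine HasBoundaries.wp_push (by omega) hE g1 g5 (by omega) (.gap_left k (by omega) c1) ?_
      intro s₂ k1 k2 k3 k4 k5
      refine HasBoundaries.wp_push (by omega) hE k1 ((k2 8 (by omega)).trans g6) (by omega)
        (.gap_right k (by omega) c1) ?_
      intro s₃ m1 m2 m3 m4 m5
      refine ⟨?_, ?_, _, m1.congr ?_ (by simp) (by simp) rfl,
        f2.mono fun x hx => subset_pushed _ _ (subset_pushed _ _ hx), ?_, ?_⟩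
      · rw [m2 4 (by omega), k2 4 (by omega), g3]
      · rw [m2 14 (by omega), k2 14 (by omega), g4, e14]
      · intro x hx
        simp [show x ≠ 4 by omega]
      · intro j hj hj' hl
        rcases Nat.lt_succ_iff_lt_or_eq.1 hj with hj | rfl
        · exact (f3.mono fun x hx => subset_pushed _ _ (subset_pushed _ _ hx)) j hj hj' hl
        · exact ⟨subset_pushed _ _ (mem_pushed _ _), mem_pushed _ _⟩
      · rw [Memory.setReg_num, m4, m5, k4, k5]
        exact f4.skip fun hk => c1 hk.2.1
  · refine ⟨l, h.congr ?_ (by simp) (by simp) rfl, hends, by intro j hj; omega, ?_⟩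
    · intro x hx
      simp [show x ≠ 4 by omega, show x ≠ 14 by omega]
    · rw [Memory.setReg_num, Memory.setReg_num, h8, h9]
      exact ⟨by intros; omega, fun y => .inl ⟨rfl, rfl⟩⟩
  · have : (d.edges.length - 1) * ((loadEdges.seq scanStep).size + 2) ≤ d.edges.length * 40 :=
      Nat.mul_le_mul (by omega) (by simp [Program.size, loadEdges, scanStep, push])
    omega
  · rintro s' ⟨-, h⟩
    exact h

theorem fin_le_one {σ : Type} {d : Description σ} (i : ℕ) : d.fin i ≤ 1 := by
  simp only [Description.fin, Description.toMemory]
  simp only [OfNat.ofNat_ne_zero, OfNat.ofNat_ne_one, reduceIte]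
  split_ifs
  · exact Bool.toNat_le _
  · exact Nat.zero_le _

theorem runs_finalLoop (hW : 4 * d.edges.length + 8 ≤ W) (hn : d.numStates ≤ d.edges.length + 1)
    (hE : SortedEdges d.numStates d.edges.length (fun k => d.src (a k)) (fun k => d.tgt (a k))
      (fun k => d.lab (a k))) (h : HasBoundaries d a l s) (hends : EndsIn d a l) {k : ℕ}
    (hgaps : GapsIn d a k l) (harcs : HasArcs d a k (s.num 8) (s.num 9)) :
    Runs W finalLoop s (20 * d.edges.length + 23) fun s' => ∃ l, HasBoundaries d a l s' ∧
      EndsIn d a l ∧ GapsIn d a k l ∧ FinalsIn d (d.numStates - 1) l ∧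
      HasArcs d a k (s'.num 8) (s'.num 9) := by
  refine (Runs.seq (T := 1) (T' := 20 * d.edges.length + 22) ?_).mono (by omega) fun _ h => h
  refine Runs.of_wp (p := .arith 14 .sub (.reg 0) (.const 1)) ⟨?_, ?_⟩
  · simp only [Operand.eval, ArithOp.eval, h.input.reg0]
    omega
  refine (Runs.seq (T := 1) (T' := 20 * d.edges.length + 21) ?_).mono (by omega) fun _ h => h
  refine Runs.of_wp (p := .set 4 (.const 0)) ⟨Nat.zero_le _, ?_⟩
  refine (Runs.forLoop (W := W) (x := 4) (y := 14) (by omega) (fun j s' => ∃ l, HasBoundaries d a l s' ∧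
      EndsIn d a l ∧ GapsIn d a k l ∧ FinalsIn d j l ∧ HasArcs d a k (s'.num 8) (s'.num 9))
      (d.numStates - 1)
      (by omega) ?_ (i := 0) (Nat.zero_le _) (by simp [Operand.eval])
      (by simp [Operand.eval, ArithOp.eval, h.input.reg0]) ?_).mono ?_ ?_
  · rintro j s₀ hj e4 e14 ⟨l, f1, f2, f3, f4, f5⟩
    have b1 := fin_le_one (d := d) j
    have b2 := fin_le_one (d := d) (j + 1)
    simp only [wp, Operand.eval, ArithOp.eval, Test.Holds, Memory.setReg_num, Memory.setReg_reg,
      f1.input.num2, e4, reduceIte, Nat.reduceEqDiff]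
    refine ⟨by omega, by omega, by omega, fun c => ?_, fun c => ?_⟩
    · refine ⟨trivial, e14, l, f1.congr ?_ (by simp) (by simp) rfl, f2, f3, ?_, f5⟩
      · intro x hx
        simp [show x ≠ 4 by omega, show x ≠ 5 by omega, show x ≠ 6 by omega, show x ≠ 7 by omega]
      · intro j' hj' hne
        rcases Nat.lt_succ_iff_lt_or_eq.1 hj' with hj' | rfl
        · exact f4 j' hj' hne
        · exact absurd c hne
    · refine HasBoundaries.wp_push (l := l) (a := a) (d := d) (v := j + 1) (by omega) hE
        (x := 7) ?_ (by simp) (by omega) (.final j (by omega) c) ?_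
      · refine f1.congr (fun x hx => ?_) (by simp) (by simp) rfl
        simp [show x ≠ 5 by omega, show x ≠ 6 by omega, show x ≠ 7 by omega]
      intro s₂ k1 k2 k3 k4 k5
      refine ⟨?_, ?_, _, k1.congr ?_ (by simp) (by simp) rfl, f2.mono (subset_pushed _ _),
        f3.mono (subset_pushed _ _), ?_, ?_⟩
      · rw [k2 4 (by omega)]
        simp [e4]
      · rw [k2 14 (by omega)]
        simp [e14]
      · intro x hx
        simp [show x ≠ 4 by omega]
      · intro j' hj' hne
        rcases Nat.lt_succ_iff_lt_or_eq.1 hj' with hj' | rfl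
        · exact subset_pushed _ _ (f4 j' hj' hne)
        · exact mem_pushed _ _
      · rw [k4, k5]
        exact f5
  · refine ⟨l, h.congr ?_ (by simp) (by simp) rfl, hends, hgaps, by intro j hj; omega, harcs⟩
    intro x hx
    simp [show x ≠ 4 by omega, show x ≠ 14 by omega]
  · simp only [Program.size, push]
    omega
  · rintro s' ⟨-, h⟩
    exact h

/-- Graph search: the arcs of the first `i` queue entries have been followed. When the queue is
exhausted it is closed under the arcs, and it contains all initial boundaries, so it consists of all
boundaries. -/
theorem runs_searchLoop (hW : 4 * d.edges.length + 8 ≤ W) (hn : d.numStates ≤ d.edges.length + 1)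
    (hE : SortedEdges d.numStates d.edges.length (fun k => d.src (a k)) (fun k => d.tgt (a k))
      (fun k => d.lab (a k))) (h : HasBoundaries d a l s) (hends : EndsIn d a l)
    (hgaps : GapsIn d a (d.edges.length - 1) l) (hfin : FinalsIn d (d.numStates - 1) l)
    (harcs : HasArcs d a (d.edges.length - 1) (s.num 8) (s.num 9)) :
    Runs W searchLoop s (20 * d.edges.length + 42) fun s' => HasInput d s' ∧ s'.num 3 = a ∧
      ∀ x, (IsBoundary d a x → s'.num 6 x = 1) ∧ (¬ IsBoundary d a x → s'.num 6 x = 0) := by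
  refine (Runs.seq (T := 1) (T' := 20 * d.edges.length + 41) ?_).mono (by omega) fun _ h => h
  refine Runs.of_wp (p := .set 21 (.const 0)) ⟨Nat.zero_le _, ?_⟩
  refine (Runs.whileLoop (fun i s' => ∃ l, HasBoundaries d a l s' ∧ EndsIn d a l ∧
    GapsIn d a (d.edges.length - 1) l ∧ FinalsIn d (d.numStates - 1) l ∧ s'.reg 21 = i ∧
    i ≤ l.length ∧ s'.num 8 = s.num 8 ∧ s'.num 9 = s.num 9 ∧
    ∀ x ∈ l.take i, s.num 8 x ∈ l ∧ s.num 9 x ∈ l)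
    (d.numStates + 1) 16 ?_ (i := 0) (Nat.zero_le _) ?_).mono ?_ ?_
  · rintro i s₀ ⟨l, f1, f2, f3, f4, f5, f6, f7, f8, f9⟩ hc
    simp only [Test.Holds, Operand.eval, f5, f1.queue.reg20] at hc
    have hlen := f1.queue.length_le
    refine ⟨by omega, (Runs.of_wp ?_).mono (by simp [Program.size, push]) fun _ h => h⟩
    have hx := f1.queue.queue i hc
    have hle := f1.queue.le _ (List.getElem_mem hc)
    have hb := f1.boundary _ (List.getElem_mem hc)
    simp only [wp, Operand.eval, ArithOp.eval, Memory.setReg_num, Memory.setReg_reg, f5, f7, f8, hx,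
      reduceIte, Nat.reduceEqDiff]
    obtain ⟨hb1, hb2⟩ : IsBoundary d a (s.num 8 l[i]) ∧ IsBoundary d a (s.num 9 l[i]) := by
      -- Without an arc both cells hold 0, which is a boundary itself, so pushing it does no harm.
      rcases harcs.cases l[i] with ⟨h1, h2⟩ | ⟨j, hj, ⟨h1, h2, h3⟩, h4, h5, h6⟩
      · rw [h1, h2]
        exact ⟨.zero, .zero⟩
      · rw [h5, h6]
        rw [h4] at hb
        exact ⟨.arc_left j h1 h2 h3 hb, .arc_right j h1 h2 h3 hb⟩
    have hl1 := Boundary.le hE hb1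
    have hl2 := Boundary.le hE hb2
    refine ⟨by omega, by omega, by omega, ?_⟩
    refine HasBoundaries.wp_push (l := l) (a := a) (d := d) (v := s.num 8 l[i]) (by omega) hE
      (x := 6) ?_ (by simp) (by omega) hb1 ?_
    · refine f1.congr (fun x hx => ?_) (by simp) (by simp) rfl
      simp [show x ≠ 5 by omega, show x ≠ 6 by omega, show x ≠ 7 by omega]
    intro s₁ g1 g2 g3 g4 g5
    refine HasBoundaries.wp_push (v := s.num 9 l[i]) (by omega) hE g1 ?_ (by omega) hb2 ?_
    · rw [g2 7 (by omega)]
      simp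
    intro s₂ k1 k2 k3 k4 k5
    have h21 : s₂.reg 21 = i := by
      rw [k3, g3]
      simp [f5]
    set l' := pushed (pushed l (s.num 8 l[i])) (s.num 9 l[i]) with hl'
    have hsub : l ⊆ l' := fun x hx => subset_pushed _ _ (subset_pushed _ _ hx)
    obtain ⟨l₁, hl₁⟩ := exists_pushed_eq_append l (s.num 8 l[i])
    obtain ⟨l₂, hl₂⟩ := exists_pushed_eq_append (pushed l (s.num 8 l[i])) (s.num 9 l[i])
    have hlen' : l.length ≤ l'.length := by
      rw [hl', hl₂, hl₁]
      simp
    -- Pushing only appends, so the processed prefix is unchanged.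
    have htake : l'.take (i + 1) = l.take i ++ [l[i]] := by
      rw [hl', hl₂, hl₁, List.append_assoc, List.take_append_of_le_length hc,
        List.take_append_getElem hc]
    rw [h21]
    refine ⟨by omega, l', k1.congr ?_ (by simp) (by simp) rfl, f2.mono hsub, f3.mono hsub,
      f4.mono hsub, by simp, by omega, ?_, ?_, ?_⟩
    · intro x hx
      simp [show x ≠ 21 by omega]
    · rw [k4, g4]
      exact f7
    · rw [k5, g5]
      exact f8
    · intro x hx
      rw [htake] at hx
      rcases List.mem_append.1 hx with hx | hx
      · exact ⟨hsub (f9 x hx).1, hsub (f9 x hx).2⟩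
      · rw [List.mem_singleton.1 hx]
        exact ⟨subset_pushed _ _ (mem_pushed _ _), mem_pushed _ _⟩
  · refine ⟨l, h.congr ?_ (by simp) (by simp) rfl, hends, hgaps, hfin, by simp [Operand.eval],
      Nat.zero_le _, rfl, rfl, by simp⟩
    intro x hx
    simp [show x ≠ 21 by omega]
  · omega
  · rintro s' ⟨i, -, ⟨l, f1, f2, f3, f4, f5, f6, f7, f8, f9⟩, hc⟩
    simp only [Test.Holds, Operand.eval, f5, f1.queue.reg20, not_lt] at hc
    rw [List.take_of_length_le hc] at f9
    -- Each rule of `Boundary` corresponds to one of the recorded closure properties of the queue.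
    have hall : ∀ x, IsBoundary d a x → x ∈ l := by
      intro x hx
      induction hx with
      | zero => exact f2.1
      | first h => exact (f2.2 h).1
      | last h => exact (f2.2 h).2
      | gap_left k hk h => exact (f3 k (by omega) hk h).1
      | gap_right k hk h => exact (f3 k (by omega) hk h).2
      | final j hj h => exact f4 j (by omega) h
      | arc_left k hk h hv _ ih =>
        have := (f9 _ ih).1
        rwa [(harcs.arc k (by omega) ⟨hk, h, hv⟩).1] at this
      | arc_right k hk h hv _ ih =>
        have := (f9 _ ih).2
        rwa [(harcs.arc k (by omega) ⟨hk, h, hv⟩).2] at this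
    refine ⟨f1.input, f1.num3, fun x => ⟨fun hx => ?_, fun hx => ?_⟩⟩
    · rw [f1.queue.mark, if_pos (hall x hx)]
    · rw [f1.queue.mark, if_neg fun hm => hx (f1.boundary x hm)]

end Search

/-! ## Writing the quotient -/

/-- Number the classes (array 10) and write the final classes to array 2. -/
def classLoop : Program :=
  .seq (.set 5 (.const 0)) <|
  .seq (.set 4 (.const 0)) <|
  .seq (forLoop 4 0 <|
    .seq (.load 6 6 (.reg 4)) <|
    .seq (.arith 5 .add (.reg 5) (.reg 6)) <|
    .seq (.arith 7 .sub (.reg 5) (.const 1)) <|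
    .seq (.store 10 (.reg 4) (.reg 7)) <|
    .seq (.load 8 2 (.reg 4)) <|
    .store 2 (.reg 7) (.reg 8)) <|
  .set 0 (.reg 5)

/-- Write the classes of the end points of the sorted edges to the arrays 11 and 12, and the labels
to the character array 1. -/
def mapLoop : Program :=
  .seq (.set 4 (.const 0)) <|
  forLoop 4 1 <|
    .seq (.load 5 3 (.reg 4)) <|
    .seq (.load 6 0 (.reg 5)) <|
    .seq (.load 6 10 (.reg 6)) <|
    .seq (.store 11 (.reg 4) (.reg 6)) <|
    .seq (.load 6 1 (.reg 5)) <|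
    .seq (.load 6 10 (.reg 6)) <|
    .seq (.store 12 (.reg 4) (.reg 6)) <|
    .copyChar 1 (.reg 4) 0 (.reg 5)

/-- Clear register 9 if the edge `k` is mapped to the same edge as the edge `k - 1`. -/
def checkRepeated : Program :=
  .seq (.set 9 (.const 1)) <|
  .seq (.arith 5 .sub (.reg 4) (.const 1)) <|
  .ite (.lt (.const 0) (.reg 4))
    (.seq (.load 6 11 (.reg 4)) <|
      .seq (.load 7 11 (.reg 5)) <|
      .seq (.load 8 12 (.reg 4)) <|
      .seq (.load 10 12 (.reg 5)) <|
      .ite (.eq (.reg 6) (.reg 7))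
        (.ite (.eq (.reg 8) (.reg 10))
          (.ite (.charLE 1 (.reg 4) 1 (.reg 5)) (.set 9 (.const 0)) .skip)
          .skip)
        .skip)
    .skip

/-- Append an edge to the output. -/
def writeEdge : Program :=
  .ite (.eq (.reg 9) (.const 1))
    (.seq (.load 6 11 (.reg 4)) <|
      .seq (.store 0 (.reg 13) (.reg 6)) <|
      .seq (.load 6 12 (.reg 4)) <|
      .seq (.store 1 (.reg 13) (.reg 6)) <|
      .seq (.copyChar 0 (.reg 13) 1 (.reg 4)) <|
      .arith 13 .add (.reg 13) (.const 1))
    .skip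

def writeLoop : Program :=
  .seq (.set 13 (.const 0)) <|
  .seq (.set 4 (.const 0)) <|
  .seq (forLoop 4 1 (.seq checkRepeated writeEdge)) <|
  .set 1 (.reg 13)

/-! ### Correctness and cost of the output -/

section Output

variable {σ : Type} [LinearOrder σ] {d : Description σ} {a : ℕ → ℕ} {W : ℕ} {s s' : Memory σ}

/-- The number of the class of a state. -/
noncomputable def classOf (d : Description σ) (a : ℕ → ℕ) (i : ℕ) : ℕ := classIndex (IsBoundary d a) i

/-- The memory contains `d`, with its states replaced by the classes where no edges are involved, its
edges in the order `a`, and the classes. -/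
structure HasClasses (d : Description σ) (a : ℕ → ℕ) (s : Memory σ) : Prop where
  reg0 : s.reg 0 = classOf d a (d.numStates - 1) + 1
  reg1 : s.reg 1 = d.edges.length
  reg2 : s.reg 2 = d.start
  num0 : s.num 0 = d.src
  num1 : s.num 1 = d.tgt
  num2 : ∀ j < d.numStates, s.num 2 (classOf d a j) = d.fin j
  num3 : s.num 3 = a
  num10 : ∀ j < d.numStates, s.num 10 j = classOf d a j
  char0 : s.char 0 = d.lab

/-- Array 2 can be overwritten in place: the number of a class is at most that of any of its states,
so no entry still to be read is lost. Several writes to one class agree by `hfin`. -/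
theorem runs_classLoop (hW : 4 * d.edges.length + 8 ≤ W) (hn : d.numStates ≤ d.edges.length + 1)
    (hfin : ∀ i j, i < d.numStates → j < d.numStates → classOf d a i = classOf d a j →
      d.fin i = d.fin j)
    (h : HasInput d s) (h3 : s.num 3 = a)
    (h6 : ∀ x, (IsBoundary d a x → s.num 6 x = 1) ∧ (¬ IsBoundary d a x → s.num 6 x = 0)) :
    Runs W classLoop s (8 * d.edges.length + 12) (HasClasses d a) := by
  have hmark : ∀ i, s.num 6 (i + 1) + classOf d a i = classOf d a (i + 1) := by
    intro i
    rw [classOf, classOf, classIndex]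
    by_cases hi : IsBoundary d a (i + 1)
    · rw [(h6 _).1 hi, if_pos hi, add_comm]
    · rw [(h6 _).2 hi, if_neg hi, zero_add, add_zero]
  have hmark1 : ∀ i, s.num 6 i ≤ 1 := by
    intro i
    by_cases hi : IsBoundary d a i
    · rw [(h6 _).1 hi]
    · rw [(h6 _).2 hi]
      exact Nat.zero_le _
  have hpos : 0 < d.numStates := d.start.pos
  refine (Runs.seq (T := 1) (T' := 8 * d.edges.length + 11) ?_).mono (by omega) fun _ h => h
  refine Runs.of_wp (p := .set 5 (.const 0)) ⟨Nat.zero_le _, ?_⟩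
  refine (Runs.seq (T := 1) (T' := 8 * d.edges.length + 10) ?_).mono (by omega) fun _ h => h
  refine Runs.of_wp (p := .set 4 (.const 0)) ⟨Nat.zero_le _, ?_⟩
  refine (Runs.seq (T := 8 * d.edges.length + 9) (T' := 1) ?_).mono (by omega) fun _ h => h
  refine (Runs.forLoop (W := W) (x := 4) (y := 0) (by omega) (fun i s' =>
      s'.reg 1 = d.edges.length ∧ s'.reg 2 = d.start ∧ s'.num 0 = d.src ∧ s'.num 1 = d.tgt ∧
      s'.num 3 = a ∧ s'.char 0 = d.lab ∧ s'.num 6 = s.num 6 ∧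
      (∀ j < i, s'.num 2 (classOf d a j) = d.fin j) ∧ (∀ j, i ≤ j → s'.num 2 j = d.fin j) ∧
      (∀ j < i, s'.num 10 j = classOf d a j) ∧ (i = 0 → s'.reg 5 = 0) ∧
      (∀ j, i = j + 1 → s'.reg 5 = classOf d a j + 1))
      d.numStates (by omega) ?_ (i := 0) (Nat.zero_le _) (by simp [Operand.eval])
      (by simp [Operand.eval, h.reg0]) ?_).mono ?_ ?_
  · rintro i s₀ hi e4 e0 ⟨f1, f2, f3, f4, f5, f6, f7, f8, f9, f10, f11, f12⟩
    -- The counter includes the boundary 0, so it exceeds the number of the current class by one;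
    -- the program subtracts it again.
    have hcount : s₀.reg 5 + s.num 6 i = classOf d a i + 1 := by
      rcases i with _ | i
      · rw [f11 rfl, (h6 0).1 .zero]
        rfl
      · rw [f12 i rfl, ← hmark]
        omega
    have hcls : classOf d a i ≤ i := classIndex_le
    have hf := fin_le_one (d := d) i
    simp only [wp, Operand.eval, ArithOp.eval, Memory.setReg_num, Memory.setReg_reg,
      Memory.setNum_num, Memory.setNum_reg, f7, e4, hcount, f9 i le_rfl, Nat.add_sub_cancel, reduceIte,
      Nat.reduceEqDiff]
    refine ⟨?_, by omega, by omega, by omega, by omega, by omega, trivial, e0, ?_⟩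
    · have := hmark1 i
      omega
    refine ⟨f1, f2, f3, f4, f5, f6, trivial, ?_, ?_, ?_, fun h => h.elim, ?_⟩
    · intro j hj
      simp only [Function.update_apply]
      split_ifs with hc
      · exact hfin i j hi (by omega) hc.symm
      · rcases Nat.lt_succ_iff_lt_or_eq.1 hj with hj | rfl
        · exact f8 j hj
        · exact absurd rfl hc
    · intro j hj
      rw [Function.update_of_ne (by omega)]
      exact f9 j (by omega)
    · intro j hj
      simp only [Function.update_apply]
      split_ifs with hc
      · rw [hc]
      · exact f10 j (by omega)
    · intro j hj
      obtain rfl : i = j := by omega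
      simp
  · simp [Operand.eval, h.reg1, h.reg2, h.num0, h.num1, h.num2, h3, h.char0]
    rfl
  · have : d.numStates * 8 ≤ (d.edges.length + 1) * 8 := Nat.mul_le_mul hn le_rfl
    simp only [Program.size]
    omega
  · rintro s' ⟨e0, f1, f2, f3, f4, f5, f6, f7, f8, f9, f10, f11, f12⟩
    have h5 := f12 (d.numStates - 1) (by omega)
    have hcls : classOf d a (d.numStates - 1) ≤ d.numStates - 1 := classIndex_le
    refine Runs.of_wp (p := .set 0 (.reg 5)) ⟨?_, ?_⟩
    · simp only [Operand.eval, h5]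
      omega
    · exact ⟨by simp [Operand.eval, h5], by simp [f1], by simp [f2], by simp [f3], by simp [f4],
        by simpa using f8, by simp [f5], by simpa using f10, by simp [f6]; rfl⟩

/-- The mapped edges are available. -/
structure HasMapped (d : Description σ) (a : ℕ → ℕ) (k : ℕ) (s : Memory σ) : Prop where
  reg0 : s.reg 0 = classOf d a (d.numStates - 1) + 1
  reg1 : s.reg 1 = d.edges.length
  reg2 : s.reg 2 = d.start
  num2 : ∀ j < d.numStates, s.num 2 (classOf d a j) = d.fin j
  num11 : ∀ i < k, s.num 11 i = classOf d a (d.src (a i))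
  num12 : ∀ i < k, s.num 12 i = classOf d a (d.tgt (a i))
  char1 : ∀ i < k, s.char 1 i = d.lab (a i)

theorem HasMapped.congr {k : ℕ} (h : HasMapped d a k s) (hr : ∀ x < 3, s'.reg x = s.reg x)
    (h2 : s'.num 2 = s.num 2) (h11 : s'.num 11 = s.num 11) (h12 : s'.num 12 = s.num 12)
    (hc : s'.char 1 = s.char 1) : HasMapped d a k s' :=
  ⟨(hr 0 (by omega)).trans h.reg0, (hr 1 (by omega)).trans h.reg1, (hr 2 (by omega)).trans h.reg2,
    h2 ▸ h.num2, h11 ▸ h.num11, h12 ▸ h.num12, hc ▸ h.char1⟩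

/-- The mapped edges go to fresh arrays, because the output will overwrite the arrays from which
they are read. -/
theorem runs_mapLoop (hW : 4 * d.edges.length + 8 ≤ W) (hn : d.numStates ≤ d.edges.length + 1)
    (ha : ∀ x < d.edges.length, a x < d.edges.length) (h : HasClasses d a s) :
    Runs W mapLoop s (10 * d.edges.length + 2) (HasMapped d a d.edges.length) := by
  refine (Runs.seq (T := 1) (T' := 10 * d.edges.length + 1) ?_).mono (by omega) fun _ h => h
  refine Runs.of_wp (p := .set 4 (.const 0)) ⟨Nat.zero_le _, ?_⟩
  refine (Runs.forLoop (W := W) (x := 4) (y := 1) (by omega) (fun i s' =>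
      HasClasses d a s' ∧ HasMapped d a i s')
      d.edges.length (by omega) ?_ (i := 0) (Nat.zero_le _) (by simp [Operand.eval])
      (by simp [h.reg1]) ?_).mono ?_ ?_
  · rintro i s₀ hi e4 e1 ⟨f, g⟩
    have hai := ha i hi
    have hs := Description.src_lt hai
    have ht := Description.tgt_lt hai
    have c1 : classOf d a (d.src (a i)) ≤ d.src (a i) := classIndex_le
    have c2 : classOf d a (d.tgt (a i)) ≤ d.tgt (a i) := classIndex_le
    simp only [wp, Operand.eval, Memory.setReg_num, Memory.setReg_reg,
      Memory.setNum_num, Memory.setNum_reg, f.num0, f.num1, f.num3, e4, f.num10 _ hs, f.num10 _ ht,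
      reduceIte, Nat.reduceEqDiff, Memory.setReg_char, Memory.setNum_char,
      Memory.setChar_reg]
    refine ⟨by omega, by omega, by omega, by omega, by omega, by omega, by omega, trivial, e1, ?_, ?_⟩
    · refine ⟨by simp [f.reg0], by simp [f.reg1], by simp [f.reg2], by simp [f.num0], by simp [f.num1],
        by simpa using f.num2, by simp [f.num3], by simpa using f.num10, ?_⟩
      simpa using f.char0
    · refine ⟨by simp [f.reg0], by simp [f.reg1], by simp [f.reg2], by simpa using f.num2, ?_, ?_, ?_⟩
      · intro j hj
        simp only [Memory.setReg_num, Memory.setChar_num, Memory.setNum_num, reduceIte,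
          Nat.reduceEqDiff, Function.update_apply]
        split_ifs with hji
        · rw [hji]
        · exact g.num11 j (by omega)
      · intro j hj
        simp only [Memory.setReg_num, Memory.setChar_num, Memory.setNum_num, reduceIte,
          Nat.reduceEqDiff, Function.update_apply]
        split_ifs with hji
        · rw [hji]
        · exact g.num12 j (by omega)
      · intro j hj
        simp only [Memory.setReg_char, Memory.setChar_char, Memory.setNum_char, reduceIte,
          Function.update_apply]
        split_ifs with hji
        · rw [hji]
          exact congrFun f.char0 (a i)
        · exact g.char1 j (by omega)
  · refine ⟨⟨by simp [h.reg0], by simp [h.reg1], by simp [h.reg2], by simp [h.num0], by simp [h.num1],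
        by simpa using h.num2, by simp [h.num3], by simpa using h.num10, by simp [h.char0]; rfl⟩,
      ⟨by simp [h.reg0], by simp [h.reg1], by simp [h.reg2], by simpa using h.num2, ?_, ?_, ?_⟩⟩ <;>
    · intros
      omega
  · simp only [Program.size]
    omega
  · rintro s' ⟨-, -, h⟩
    exact h

/-- The edge `k` is mapped to the same edge as its predecessor. -/
def IsRepeated (d : Description σ) (a : ℕ → ℕ) (k : ℕ) : Prop :=
  0 < k ∧ classOf d a (d.src (a k)) = classOf d a (d.src (a (k - 1))) ∧
    classOf d a (d.tgt (a k)) = classOf d a (d.tgt (a (k - 1))) ∧ d.lab (a k) ≤ d.lab (a (k - 1))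

theorem wp_checkRepeated (hW : 4 * d.edges.length + 8 ≤ W) (hn : d.numStates ≤ d.edges.length + 1)
    (ha : ∀ x < d.edges.length, a x < d.edges.length) (h : HasMapped d a d.edges.length s) {k : ℕ}
    (hk : k < d.edges.length) (h4 : s.reg 4 = k) {Post : Memory σ → Prop}
    (hP : ∀ s', (s'.reg 9 = 1 ↔ ¬ IsRepeated d a k) → (∀ x < 5, s'.reg x = s.reg x) →
      s'.reg 13 = s.reg 13 → s'.num = s.num → s'.char = s.char → Post s') :
    wp W checkRepeated Post s := by
  have hb : ∀ j < d.edges.length, classOf d a (d.src (a j)) ≤ W ∧ classOf d a (d.tgt (a j)) ≤ W := by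
    intro j hj
    have c1 : classOf d a (d.src (a j)) ≤ d.src (a j) := classIndex_le
    have c2 : classOf d a (d.tgt (a j)) ≤ d.tgt (a j) := classIndex_le
    have c3 := Description.src_lt (ha j hj)
    have c4 := Description.tgt_lt (ha j hj)
    omega
  have hk' : k - 1 < d.edges.length := by omega
  have hc := charLE_holds (d := d) (b₁ := 1) (b₂ := 1) (o₁ := .reg 4) (o₂ := .reg 5)
    (s := ((((((s.setReg 9 1).setReg 5 (k - 1)).setReg 6 (classOf d a (d.src (a k)))).setReg 7
      (classOf d a (d.src (a (k - 1))))).setReg 8 (classOf d a (d.tgt (a k)))).setReg 10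
      (classOf d a (d.tgt (a (k - 1))))))
    (x := a k) (y := a (k - 1)) (by simpa [Operand.eval, h4] using h.char1 k hk)
    (by simpa [Operand.eval] using h.char1 _ hk') (ha k hk) (ha _ hk')
  simp only [Test.Holds, Operand.eval, Memory.setReg_reg, h4, reduceIte, Nat.reduceEqDiff] at hc
  simp only [checkRepeated, wp, Operand.eval, ArithOp.eval, Memory.setReg_num, Memory.setReg_reg,
    Test.Holds, h4, h.num11 k hk, h.num11 _ hk', h.num12 k hk, h.num12 _ hk', reduceIte,
    Nat.reduceEqDiff, hc]
  refine ⟨by omega, by omega, fun c0 => ⟨(hb k hk).1, (hb _ hk').1, (hb k hk).2, (hb _ hk').2,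
    fun c1 => ⟨fun c2 => ⟨fun c3 => ?_, fun c3 => ?_⟩, fun c2 => ?_⟩, fun c1 => ?_⟩, fun c0 => ?_⟩
  · refine ⟨Nat.zero_le _, hP _ ?_ ?_ (by simp) rfl rfl⟩
    · simpa using ⟨c0, c1, c2, c3⟩
    · intro x hx
      simp [show x ≠ 5 by omega, show x ≠ 6 by omega, show x ≠ 7 by omega, show x ≠ 8 by omega,
        show x ≠ 9 by omega, show x ≠ 10 by omega]
  · refine hP _ ?_ ?_ (by simp) rfl rfl
    · simpa using fun hr : IsRepeated d a k => c3 hr.2.2.2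
    · intro x hx
      simp [show x ≠ 5 by omega, show x ≠ 6 by omega, show x ≠ 7 by omega, show x ≠ 8 by omega,
        show x ≠ 9 by omega, show x ≠ 10 by omega]
  · refine hP _ ?_ ?_ (by simp) rfl rfl
    · simpa using fun hr : IsRepeated d a k => c2 hr.2.2.1
    · intro x hx
      simp [show x ≠ 5 by omega, show x ≠ 6 by omega, show x ≠ 7 by omega, show x ≠ 8 by omega,
        show x ≠ 9 by omega, show x ≠ 10 by omega]
  · refine hP _ ?_ ?_ (by simp) rfl rfl
    · simpa using fun hr : IsRepeated d a k => c1 hr.2.1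
    · intro x hx
      simp [show x ≠ 5 by omega, show x ≠ 6 by omega, show x ≠ 7 by omega, show x ≠ 8 by omega,
        show x ≠ 9 by omega, show x ≠ 10 by omega]
  · refine hP _ ?_ ?_ (by simp) rfl rfl
    · simpa using fun hr : IsRepeated d a k => c0 hr.1
    · intro x hx
      simp [show x ≠ 5 by omega, show x ≠ 9 by omega]

/-- The first `k` edges are mapped to the edges of the list `l`, which is stored as the output. -/
structure HasOutput {N : ℕ} (d : Description σ) (a : ℕ → ℕ) (f : ℕ → Fin N × Fin N × WithBot σ) (k : ℕ)
    (l : List (Fin N × Fin N × σ)) (s : Memory σ) : Prop where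
  mapped : HasMapped d a d.edges.length s
  nodup : l.Nodup
  mem : ∀ i j x, (i, j, x) ∈ l ↔ ∃ k' < k, f k' = (i, j, (x : WithBot σ))
  reg13 : s.reg 13 = l.length
  stored : ∀ (i : ℕ) (h : i < l.length), s.num 0 i = l[i].1 ∧ s.num 1 i = l[i].2.1 ∧
    s.char 0 i = some l[i].2.2

/-- The class map is monotone, so the mapped edges remain sorted and equal ones are contiguous.
Comparing each edge with its predecessor therefore removes all repetitions. -/
theorem runs_writeLoop (hW : 4 * d.edges.length + 8 ≤ W) (hn : d.numStates ≤ d.edges.length + 1)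
    (hE : SortedEdges d.numStates d.edges.length (fun k => d.src (a k)) (fun k => d.tgt (a k))
      (fun k => d.lab (a k))) (ha : ∀ x < d.edges.length, a x < d.edges.length)
    {N : ℕ} (f : ℕ → Fin N × Fin N × WithBot σ)
    (hf : ∀ k < d.edges.length, ((f k).1 : ℕ) = classOf d a (d.src (a k)) ∧
      ((f k).2.1 : ℕ) = classOf d a (d.tgt (a k)) ∧ (f k).2.2 = d.lab (a k))
    (h : HasMapped d a d.edges.length s) :
    Runs W writeLoop s (25 * d.edges.length + 4) fun s' => ∃ l : List (Fin N × Fin N × σ),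
      l.Nodup ∧ (∀ i j x, (i, j, x) ∈ l ↔ ∃ k < d.edges.length, f k = (i, j, (x : WithBot σ))) ∧
      s'.reg 0 = classOf d a (d.numStates - 1) + 1 ∧ s'.reg 1 = l.length ∧ s'.reg 2 = d.start ∧
      (∀ j < d.numStates, s'.num 2 (classOf d a j) = d.fin j) ∧
      ∀ (i : ℕ) (h : i < l.length), s'.num 0 i = l[i].1 ∧ s'.num 1 i = l[i].2.1 ∧
        s'.char 0 i = some l[i].2.2 := by
  -- Edge `k - 1` lies between `k'` and `k`, so its label and the classes of its ends are squeezed.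
  have hrep : ∀ k < d.edges.length, ∀ k' < k, f k' = f k → IsRepeated d a k := by
    intro k hk k' hkk he
    obtain ⟨e1, e2, e3⟩ := hf k hk
    obtain ⟨g1, g2, g3⟩ := hf k' (by omega)
    have h1 : d.lab (a k') = d.lab (a k) := by rw [← g3, ← e3, he]
    have h2 : classOf d a (d.src (a k')) = classOf d a (d.src (a k)) := by rw [← g1, ← e1, he]
    have h3 : classOf d a (d.tgt (a k')) = classOf d a (d.tgt (a k)) := by rw [← g2, ← e2, he]
    have l1 := hE.lab_mono k' (k - 1) (by omega) (by omega)
    have l2 := hE.lab_mono (k - 1) k (by omega) hk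
    have q1 : d.lab (a k') = d.lab (a (k - 1)) := le_antisymm l1 (l2.trans h1.ge)
    have q2 : d.lab (a (k - 1)) = d.lab (a k) := q1.symm.trans h1
    have s1 := hE.src_mono k' (k - 1) (by omega) (by omega) q1
    have s2 := hE.src_mono (k - 1) k (by omega) hk q2
    have t1 := hE.tgt_mono k' (k - 1) (by omega) (by omega) q1
    have t2 := hE.tgt_mono (k - 1) k (by omega) hk q2
    refine ⟨by omega, ?_, ?_, q2.ge⟩
    · exact le_antisymm (h2 ▸ classIndex_mono s1) (classIndex_mono s2)
    · exact le_antisymm (h3 ▸ classIndex_mono t1) (classIndex_mono t2)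
  -- One label query is enough, since sortedness supplies the opposite inequality.
  have hrep' : ∀ k < d.edges.length, IsRepeated d a k → f k = f (k - 1) := by
    rintro k hk ⟨h0, h1, h2, h3⟩
    obtain ⟨e1, e2, e3⟩ := hf k hk
    obtain ⟨g1, g2, g3⟩ := hf (k - 1) (by omega)
    refine Prod.ext (Fin.ext (by rw [e1, g1, h1])) (Prod.ext (Fin.ext (by rw [e2, g2, h2])) ?_)
    rw [e3, g3]
    exact le_antisymm h3 (hE.lab_mono (k - 1) k (by omega) hk)
  refine (Runs.seq (T := 1) (T' := 25 * d.edges.length + 3) ?_).mono (by omega) fun _ h => h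
  refine Runs.of_wp (p := .set 13 (.const 0)) ⟨Nat.zero_le _, ?_⟩
  refine (Runs.seq (T := 1) (T' := 25 * d.edges.length + 2) ?_).mono (by omega) fun _ h => h
  refine Runs.of_wp (p := .set 4 (.const 0)) ⟨Nat.zero_le _, ?_⟩
  refine (Runs.seq (T := 25 * d.edges.length + 1) (T' := 1) ?_).mono (by omega) fun _ h => h
  refine (Runs.forLoop (W := W) (x := 4) (y := 1) (by omega) (fun k s' => ∃ l, l.length ≤ k ∧
      HasOutput d a f k l s')
      d.edges.length (by omega) ?_ (i := 0) (Nat.zero_le _) (by simp [Operand.eval])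
      (by simp [h.reg1]) ?_).mono ?_ ?_
  · rintro k s₀ hk e4 e1 ⟨l, hl, g1, g2, g3, g4, g5⟩
    refine wp_checkRepeated hW hn ha g1 hk e4 ?_
    intro s₁ m1 m2 m3 m4 m5
    have hmap : HasMapped d a d.edges.length s₁ :=
      g1.congr (fun x hx => m2 x (by omega)) (by rw [m4]) (by rw [m4]) (by rw [m4]) (by rw [m5])
    have m24 := (m2 4 (by omega)).trans e4
    have m21 := (m2 1 (by omega)).trans e1
    simp only [writeEdge, wp, Operand.eval, ArithOp.eval, Test.Holds, m1, Memory.setReg_num,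
      Memory.setReg_reg, Memory.setNum_num, Memory.setNum_reg, m24, hmap.num11 k hk, hmap.num12 k hk,
      Memory.setChar_reg, m3, g4, reduceIte, Nat.reduceEqDiff]
    refine ⟨fun c => ?_, fun c => ?_⟩
    · obtain ⟨x, hx⟩ : ∃ x : σ, d.lab (a k) = x := ⟨_, Description.lab_eq (ha k hk)⟩
      obtain ⟨e1, e2, e3⟩ := hf k hk
      have c1 : classOf d a (d.src (a k)) ≤ d.src (a k) := classIndex_le
      have c2 : classOf d a (d.tgt (a k)) ≤ d.tgt (a k) := classIndex_le
      have c3 := Description.src_lt (ha k hk)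
      have c4 := Description.tgt_lt (ha k hk)
      have hfk : f k = ((f k).1, (f k).2.1, (x : WithBot σ)) := by
        rw [← hx, ← e3]
      have hnot : ((f k).1, (f k).2.1, x) ∉ l := by
        rw [g3]
        rintro ⟨k', hk', he⟩
        exact c (hrep k hk k' hk' (he.trans hfk.symm))
      refine ⟨by omega, by omega, by omega, by omega, by omega, trivial, m21,
        l ++ [((f k).1, (f k).2.1, x)], by simpa using hl, ?_, ?_, ?_, ?_, ?_⟩
      · refine hmap.congr ?_ (by simp) (by simp) (by simp) (by simp)
        intro y hy
        simp [show y ≠ 4 by omega, show y ≠ 6 by omega, show y ≠ 13 by omega]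
      · rw [List.nodup_append]
        refine ⟨g2, by simp, ?_⟩
        rintro p hp q hq rfl
        rw [List.mem_singleton] at hq
        exact hnot (hq ▸ hp)
      · intro i j y
        rw [List.mem_append, g3, List.mem_singleton]
        constructor
        · rintro (⟨k', hk', he⟩ | he)
          · exact ⟨k', by omega, he⟩
          · refine ⟨k, by omega, ?_⟩
            simp only [Prod.mk.injEq] at he
            obtain ⟨rfl, rfl, rfl⟩ := he
            exact hfk
        · rintro ⟨k', hk', he⟩
          rcases Nat.lt_succ_iff_lt_or_eq.1 hk' with hk' | rfl
          · exact .inl ⟨k', hk', he⟩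
          · right
            rw [hfk] at he
            simp only [Prod.mk.injEq, WithBot.coe_inj] at he ⊢
            exact ⟨he.1.symm, he.2.1.symm, he.2.2.symm⟩
      · simp
      · intro i hi
        simp only [Memory.setReg_num, Memory.setChar_num, Memory.setNum_num, Memory.setReg_char,
          Memory.setChar_char, Memory.setNum_char, reduceIte, Nat.reduceEqDiff,
          Function.update_apply]
        split_ifs with hil
        · subst hil
          simp only [List.getElem_concat_length, e1, e2, true_and]
          rw [hmap.char1 k hk, hx]
          rfl
        · simp only [List.length_append, List.length_singleton] at hi
          rw [List.getElem_append_left (by omega), m4, m5]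
          exact g5 i (by omega)
    · rw [not_not] at c
      have h0 := c.1
      refine ⟨trivial, m21, l, by omega, ?_, g2, ?_, ?_, ?_⟩
      · refine hmap.congr ?_ rfl rfl rfl rfl
        intro y hy
        simp [show y ≠ 4 by omega]
      · intro i j y
        rw [g3]
        constructor
        · rintro ⟨k', hk', he⟩
          exact ⟨k', by omega, he⟩
        · rintro ⟨k', hk', he⟩
          rcases Nat.lt_succ_iff_lt_or_eq.1 hk' with hk' | rfl
          · exact ⟨k', hk', he⟩
          · exact ⟨k' - 1, by omega, (hrep' k' hk c).symm.trans he⟩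
      · simp [m3, g4]
      · intro i hi
        rw [Memory.setReg_num, Memory.setReg_char, m4, m5]
        exact g5 i hi
  · refine ⟨[], by simp, h.congr ?_ rfl rfl rfl rfl, by simp, by simp, by simp [Operand.eval],
      by intro i hi; simp at hi⟩
    intro x hx
    simp [show x ≠ 4 by omega, show x ≠ 13 by omega]
  · simp only [Program.size, checkRepeated, writeEdge]
    omega
  · rintro s' ⟨e1, l, hl, g1, g2, g3, g4, g5⟩
    refine Runs.of_wp (p := .set 1 (.reg 13)) ⟨?_, l, g2, g3, ?_, ?_, ?_, ?_, ?_⟩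
    · simp only [Operand.eval, g4]
      omega
    · simp [g1.reg0]
    · simp [Operand.eval, g4]
    · simp [g1.reg2]
    · simpa using g1.num2
    · simpa using g5

end Output

/-! ## The program and its running time -/

def quotientProgram : Program :=
  .seq initLoop <| .seq sortLoop <| .seq pushEnds <| .seq scanLoop <| .seq finalLoop <|
  .seq searchLoop <| .seq classLoop <| .seq mapLoop writeLoop

/-- A bound for the running time of `quotientProgram` on automata with `m` edges. -/
def quotientTime (m : ℕ) : ℕ := Nat.clog 2 m * (44 * m + 10) + 130 * m + 120

theorem bool_eq_decide_toNat (b : Bool) : decide (b.toNat = 1) = b := by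
  cases b <;> rfl

section Program

variable {σ Q : Type} [LinearOrder σ] {d : Description σ} {A : Automaton σ Q} {le : Q → Q → Prop}
  {a : ℕ → ℕ} {W : ℕ}

/-- The output of `writeLoop` is a description of the quotient. -/
theorem exists_description_quotient (h : A.IsWheelerNFA le) (hd : d.Describes A le)
    (hperm : (Multiset.range d.edges.length).map a = Multiset.range d.edges.length)
    (hsort : SortedEdges d.numStates d.edges.length (fun k => d.src (a k)) (fun k => d.tgt (a k))
      (fun k => d.lab (a k))) {N : ℕ} (hN : N = classOf d a (d.numStates - 1) + 1)
    {f : ℕ → Fin N × Fin N × WithBot σ}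
    (hf : ∀ k < d.edges.length, ((f k).1 : ℕ) = classOf d a (d.src (a k)) ∧
      ((f k).2.1 : ℕ) = classOf d a (d.tgt (a k)) ∧ (f k).2.2 = d.lab (a k))
    {l : List (Fin N × Fin N × σ)} (hl : l.Nodup)
    (hmem : ∀ i j x, (i, j, x) ∈ l ↔ ∃ k < d.edges.length, f k = (i, j, (x : WithBot σ)))
    {s : Memory σ} (h0 : s.reg 0 = N) (h1 : s.reg 1 = l.length) (h2 : s.reg 2 = d.start)
    (hs2 : ∀ j < d.numStates, s.num 2 (classOf d a j) = d.fin j)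
    (hs : ∀ (i : ℕ) (h : i < l.length), s.num 0 i = l[i].1 ∧ s.num 1 i = l[i].2.1 ∧
      s.char 0 i = some l[i].2.2) :
    ∃ d' : Description σ, d'.Describes (A.quotient le) (A.quotientLE le) ∧ d'.StoredIn s := by
  have hstart := Description.start_eq_zero h hd
  obtain ⟨e, he, -, hE, hes, hF⟩ := hd
  have hlt : ∀ i : Fin d.numStates, classOf d a i < N := fun i =>
    hN ▸ Nat.lt_succ_of_le (classIndex_mono (by omega))
  set q : Fin d.numStates → Fin N := fun i => ⟨classOf d a i, hlt i⟩ with hq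
  have hqs : Function.Surjective q := by
    rintro ⟨t, ht⟩
    obtain ⟨i, hi, rfl⟩ := exists_classIndex_eq (B := IsBoundary d a) (j := d.numStates - 1)
      (t := t) (Nat.le_of_lt_succ (ht.trans_eq hN))
    exact ⟨⟨i, by have := d.start.pos; omega⟩, rfl⟩
  have hqfin : ∀ i, s.num 2 (q i) = (d.final i).toNat := fun i =>
    (hs2 i i.2).trans (Description.fin_eq i)
  refine ⟨⟨N, l, q d.start, fun t => decide (s.num 2 t = 1)⟩,
    Description.describes_quotient h e he hE hes hF _ q hqs ?_ ?_ hl ?_ rfl ?_, h0, h1, ?_, hs, ?_⟩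
  · intro i j hij
    exact Fin.le_def.2 (classIndex_mono (Fin.le_def.1 hij))
  · intro i j
    rw [← classIndex_eq_iff_wheelerEquiv h e he hE hF hperm hsort, hq, Fin.mk.injEq]
    rfl
  · rintro ⟨i, j, x⟩
    constructor
    · intro ht
      obtain ⟨k, hk, hfk⟩ := (hmem i j x).1 ht
      have hak := lt_of_map_range hperm k hk
      obtain ⟨e1, e2, e3⟩ := hf k hk
      rw [hfk] at e1 e2 e3
      refine ⟨(⟨_, Description.src_lt hak⟩, ⟨_, Description.tgt_lt hak⟩, x),
        (mem_edges_iff hperm _ _ _).2 ⟨k, hk, rfl, rfl, e3.symm⟩, ?_⟩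
      exact Prod.ext (Fin.ext e1.symm) (Prod.ext (Fin.ext e2.symm) rfl)
    · rintro ⟨⟨i', j', y⟩, ht, hij⟩
      obtain ⟨k, hk, e1, e2, e3⟩ := (mem_edges_iff hperm _ _ _).1 ht
      simp only [Prod.mk.injEq] at hij
      obtain ⟨rfl, rfl, rfl⟩ := hij
      obtain ⟨f1, f2, f3⟩ := hf k hk
      rw [e1] at f1
      rw [e2] at f2
      exact (hmem _ _ _).2 ⟨k, hk, Prod.ext (Fin.ext f1) (Prod.ext (Fin.ext f2) (f3.trans e3))⟩
  · intro i
    simp only [hqfin, bool_eq_decide_toNat]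
  -- Register 2 is never rewritten. It still holds the initial state 0, which is also the number of
  -- its class.
  · rw [h2, hq]
    simp only [hstart]
    rfl
  · intro t
    obtain ⟨i, rfl⟩ := hqs t
    simp only [hqfin, bool_eq_decide_toNat]

theorem runs_quotientProgram (hW : 4 * d.edges.length + 8 ≤ W) (h : A.IsWheelerNFA le)
    (hd : d.Describes A le) :
    Runs W quotientProgram d.toMemory (quotientTime d.edges.length) fun s' =>
      ∃ d' : Description σ, d'.Describes (A.quotient le) (A.quotientLE le) ∧ d'.StoredIn s' := by
  have hn := Description.numStates_le h hd
  obtain ⟨m, hm⟩ : ∃ m, m = d.edges.length := ⟨_, rfl⟩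
  rw [← hm]
  have hT : 7 * m + 2 + (Nat.clog 2 m * (44 * m + 10) + 2 + (30 + (40 * m + 3 + (20 * m + 23 +
      (20 * m + 42 + (8 * m + 12 + (10 * m + 2 + (25 * m + 4)))))))) ≤ quotientTime m := by
    rw [quotientTime]
    omega
  refine (Runs.seq ?_).mono hT fun _ h => h
  subst hm
  refine (runs_initLoop hW hn).mono le_rfl ?_
  rintro s₁ ⟨hk, hi⟩
  refine Runs.seq ((runs_sortLoop hW hn hk hi).mono le_rfl ?_)
  rintro s₂ ⟨hk, hperm, hkey⟩
  obtain ⟨a, ha⟩ : ∃ a, s₂.num 3 = a := ⟨_, rfl⟩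
  rw [ha] at hperm hkey
  have hsort := sortedEdges_of_sorted h hd hperm hkey
  have hlt := lt_of_map_range hperm
  refine Runs.seq ((runs_pushEnds hW hn hsort hlt hk ha).mono le_rfl ?_)
  rintro s₃ ⟨l, hb, hends, h8, h9⟩
  refine Runs.seq ((runs_scanLoop hW hn hsort hlt hb hends h8 h9).mono le_rfl ?_)
  rintro s₄ ⟨l, hb, hends, hgaps, harcs⟩
  refine Runs.seq ((runs_finalLoop hW hn hsort hb hends hgaps harcs).mono le_rfl ?_)
  rintro s₅ ⟨l, hb, hends, hgaps, hfinals, harcs⟩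
  refine Runs.seq ((runs_searchLoop hW hn hsort hb hends hgaps hfinals harcs).mono le_rfl ?_)
  rintro s₆ ⟨hin, h3, h6⟩
  have hfin : ∀ i j, i < d.numStates → j < d.numStates → classOf d a i = classOf d a j →
      d.fin i = d.fin j := fun i j hi hj hij =>
    SameClass.fin_eq (classIndex_eq_iff.1 hij) hi hj
  refine Runs.seq ((runs_classLoop hW hn hfin hin h3 h6).mono le_rfl ?_)
  intro s₇ hc
  refine Runs.seq ((runs_mapLoop hW hn hlt hc).mono le_rfl ?_)
  intro s₈ hmap
  have hcls : ∀ i < d.numStates, classOf d a i < classOf d a (d.numStates - 1) + 1 := fun i hi =>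
    Nat.lt_succ_of_le (classIndex_mono (by omega))
  -- `Fin.ofNat` reduces modulo the number of classes, which changes nothing because class numbers
  -- are smaller.
  have hf : ∀ k < d.edges.length,
      ((Fin.ofNat (classOf d a (d.numStates - 1) + 1) (classOf d a (d.src (a k))) : Fin _) : ℕ) =
        classOf d a (d.src (a k)) ∧
      ((Fin.ofNat (classOf d a (d.numStates - 1) + 1) (classOf d a (d.tgt (a k))) : Fin _) : ℕ) =
        classOf d a (d.tgt (a k)) ∧ d.lab (a k) = d.lab (a k) := fun k hk =>
    ⟨Nat.mod_eq_of_lt (hcls _ (Description.src_lt (hlt k hk))),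
      Nat.mod_eq_of_lt (hcls _ (Description.tgt_lt (hlt k hk))), rfl⟩
  refine (runs_writeLoop hW hn hsort hlt (fun k => (Fin.ofNat _ (classOf d a (d.src (a k))),
    Fin.ofNat _ (classOf d a (d.tgt (a k))), d.lab (a k))) hf hmap).mono le_rfl ?_
  rintro s₉ ⟨l, g1, g2, g3, g4, g5, g6, g7⟩
  exact exists_description_quotient h hd hperm hsort rfl hf g1 g2 g3 g4 g5 g6 g7

end Program

theorem buildsQuotient_quotientProgram (K : ∀ σ Q : Type, Automaton σ Q → Prop) :
    BuildsQuotient K quotientProgram quotientTime fun m => (m + 2) ^ 3 := by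
  intro σ _ _ Q A le h _ d hd
  rw [hd.ncard_edges]
  refine runs_quotientProgram ?_ h hd
  generalize d.edges.length = m
  nlinarith [Nat.zero_le (m ^ 3), Nat.zero_le (m ^ 2)]

theorem quotientTime_isBigO :
    (fun m => (quotientTime m : ℝ)) =O[atTop] fun m : ℕ => m * Real.log m := by
  refine IsBigO.of_bound 1000 ?_
  filter_upwards [eventually_ge_atTop 2] with m hm
  have hm' : (2 : ℝ) ≤ m := by exact_mod_cast hm
  have hlog2 := Real.log_two_gt_d9
  have hlog : Real.log 2 ≤ Real.log m := Real.log_le_log (by norm_num) hm'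
  -- From `2 ^ (clog - 1) < m`; the rounding term 1 is absorbed since `log m ≥ log 2 > 1 / 2`.
  have hclog : (Nat.clog 2 m : ℝ) ≤ 4 * Real.log m := by
    have h1 : 2 ^ (Nat.clog 2 m - 1) < m := Nat.pow_pred_clog_lt_self one_lt_two (by omega)
    have h2 : (2 : ℝ) ^ (Nat.clog 2 m - 1) ≤ m := by exact_mod_cast h1.le
    have h3 := Real.log_le_log (by positivity) h2
    rw [Real.log_pow] at h3
    have h4 : 0 < Nat.clog 2 m := Nat.clog_pos one_lt_two hm
    have h5 : ((Nat.clog 2 m - 1 : ℕ) : ℝ) = (Nat.clog 2 m : ℝ) - 1 := by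
      rw [Nat.cast_sub h4, Nat.cast_one]
    rw [h5] at h3
    have h6 : (1 : ℝ) ≤ Nat.clog 2 m := by exact_mod_cast h4
    nlinarith
  rw [Real.norm_of_nonneg (by positivity), Real.norm_of_nonneg (by positivity), quotientTime]
  push_cast
  have h1 : (Nat.clog 2 m : ℝ) * (44 * m + 10) ≤ 4 * Real.log m * (49 * m) :=
    mul_le_mul hclog (by linarith) (by positivity) (by positivity)
  have h2 : (m : ℝ) * (1 / 2) ≤ m * Real.log m :=
    mul_le_mul_of_nonneg_left (by linarith) (by positivity)
  nlinarith

/-- A program for all Wheeler NFAs is in particular one for Wheeler DFAs, so the lower bound only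
has to be proved for DFAs. -/
theorem BuildsQuotient.mono {K K' : ∀ σ Q : Type, Automaton σ Q → Prop} {p : Program} {f W : ℕ → ℕ}
    (hp : BuildsQuotient K p f W) (hK : ∀ σ Q A, K' σ Q A → K σ Q A) : BuildsQuotient K' p f W :=
  fun σ _ _ Q A le h hA => hp σ Q A le h (hK _ _ _ hA)

/-- In the comparison model, building the quotient of a Wheeler NFA takes time `Θ(|E| log |E|)`,
and the same holds when the inputs are restricted to Wheeler DFAs. -/
theorem mainTheorem9 :
    QuotientTimeIsTheta (fun _ _ _ => True) (fun m => m * Real.log m) ∧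
    QuotientTimeIsTheta (fun _ _ A => A.IsDFA) (fun m => m * Real.log m) := by
  have hupper := fun K => buildsQuotient_quotientProgram K
  exact ⟨⟨⟨_, _, 3, hupper _, quotientTime_isBigO⟩,
      fun p f W hp => (hp.mono fun _ _ _ _ => trivial).isBigO⟩,
    ⟨⟨_, _, 3, hupper _, quotientTime_isBigO⟩, fun p f W hp => hp.isBigO⟩⟩
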